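/- **Conventions.** A DGA-module is a $\mathbb Z$-graded abelian group with a differential of degree $-1$ and chain maps $\epsilon:M\to\mathbb Z$, $\eta:\mathbb Z\to M$ of degree $0$ with $\epsilon\eta=\mathrm{id}$. An $\mathbb S$-module is a family $M=\{M(n)\}_{n\ge1}$ of DGA-modules with right actions of the symmetric groups $\Sigma_n$ by chain maps preserving $\epsilon$. An operad $\mathcal P$ is an $\mathbb S$-module with a unit $1\in\mathcal P(1)_0$ ($\partial 1=0$, $\epsilon(1)=1$) and compositions $\gamma:\mathcal P(r)\otimes\mathcal P(i_1)\otimes\cdots\otimes\mathcal P(i_r)\to\mathcal P(i_1+\cdots+i_r)$, which are chain maps preserving $\epsilon$ and are unital, associative and equivariant with the Koszul signs. An isomorphism of operads consists of isomorphisms of DGA-modules in each arity respecting the actions, unit and compositions. An operadic ideal of $\mathcal P$ is a family of graded subgroups $\mathcal I(n)\subseteq\ker\epsilon\subseteq\mathcal P(n)$, stable under $\partial$ and the actions, with $\gamma(x;y_1,\dots,y_r)\in\mathcal I$ whenever one of $x,y_1,\dots,y_r$ lies in $\mathcal I$; then $\mathcal P/\mathcal I$, with components $\mathcal P(n)/\mathcal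 I(n)$, is an operad. **The $\mathbb S$-module $S$.** Let $S(n)=R\Sigma_n$ be the normalized bar resolution of $\mathbb Z$ over $\mathbb Z[\Sigma_n]$, with basis in degree $m$ the symbols $\sigma[\sigma_1/\cdots/\sigma_m]$, $\sigma_j\ne1$, with $\epsilon(\sigma[\,])=1$, $\eta(1)=[\,]_n$, and right action $x\cdot\tau=\tau^{-1}x$. The symbol $\sigma[\sigma_1/\cdots/\sigma_m]$ is identified with the sequence of vertices $(\sigma,\sigma\sigma_1,\dots,\sigma\sigma_1\cdots\sigma_m)$; the boundary is the alternating sum of the faces omitting one vertex, and a sequence with two equal consecutive entries is zero. **The operad $\mathfrak S$.** Smith's operad $\mathfrak S$ (the Barratt–Eccles operad in bar notation) has underlying $\mathbb S$-module $S$, unit $[\,]_1$, and composition $\gamma(x;y_1,\dots,y_r)$ obtained by applying the Eilenberg–Zilber shuffle map to $x\otimes y_1\otimes\cdots\otimes y_r$ and then, in each vertex, the composition of permutations which substitutes into the word $w(1)\cdots w(r)$ of $w\in\Sigma_r$, for each letter $j$, the word of $v_j\in\Sigma_{i_j}$ on the $j$-th block of letters. **The operad $\mathcal R$.** Let $F(S)$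 be the free operad on $S$, with coaugmentations induced from those of $S$, and let $\mathcal J$ be the operadic ideal of $F(S)$ generated by the degree-zero elements $x-y$, where $x$ and $y$ are of the same arity and both are iterated compositions of the generators $[\,]_n$, $n\ge1$ (the unit of $F(S)$ being the empty composition). Put $\mathcal R=F(S)/\mathcal J$, and let $\kappa:S\to\mathcal R$ be the canonical map. **Corollary.** $\mathfrak S$ is an operad, and there is an operadic ideal $\mathcal I$ of $\mathcal R$ with an isomorphism of operads $\mathfrak S\cong\mathcal R/\mathcal I$. More precisely, $\mathcal I$ is the operadic ideal generated by the identifications made by the compositions of $\mathfrak S$, that is, by all elements $$\kappa\bigl(\gamma_{\mathfrak S}(x;y_1,\dots,y_r)\bigr)-\gamma_{\mathcal R}\bigl(\kappa(x);\kappa(y_1),\dots,\kappa(y_r)\bigr),\qquad x\in S(r),\ y_j\in S(i_j)\ \text{homogeneous},$$ and the isomorphism sends $x\in S(n)$ to the class of $\kappa(x)$. -/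

import Mathlib

/-! ### Differential graded modules with augmentation -/

/-- A DGA-module: a `ℤ`-graded abelian group with a differential of degree `-1`, an augmentation
`ε` to `ℤ` and a coaugmentation `η` from `ℤ`, which are chain maps of degree `0` (`ℤ` sits in
degree `0`) with `ε ∘ η = id`. The differential `X k → X (k - 1)` is indexed by pairs `k, l` with
`l + 1 = k`. The augmentation is given on all degrees and vanishes outside degree `0`. -/
structure DGAModule where
  X : ℤ → Type
  [grp : ∀ k, AddCommGroup (X k)]
  d : ∀ {k l : ℤ}, l + 1 = k → X k →+ X l
  d_d : ∀ {k l m : ℤ} (h : l + 1 = k) (h' : m + 1 = l) (x : X k), d h' (d h x) = 0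
  aug : ∀ k : ℤ, X k →+ ℤ
  aug_of_ne : ∀ (k : ℤ) (x : X k), k ≠ 0 → aug k x = 0
  aug_d : ∀ {k l : ℤ} (h : l + 1 = k) (x : X k), aug l (d h x) = 0
  coaug : ℤ →+ X 0
  d_coaug : ∀ {l : ℤ} (h : l + 1 = 0) (a : ℤ), d h (coaug a) = 0
  aug_coaug : ∀ a : ℤ, aug 0 (coaug a) = a

attribute [instance] DGAModule.grp

/-- An `𝕊`-module: DGA-modules `M(n)`, `n ≥ 1`, with right actions of the symmetric groups by
augmentation-preserving chain maps; `act σ x` is `x · σ`. -/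
structure SModule where
  obj : ℕ+ → DGAModule
  act : ∀ {n : ℕ+} {k : ℤ}, Equiv.Perm (Fin n) → (obj n).X k →+ (obj n).X k
  act_one : ∀ {n : ℕ+} {k : ℤ} (x : (obj n).X k), act 1 x = x
  act_mul : ∀ {n : ℕ+} {k : ℤ} (σ τ : Equiv.Perm (Fin n)) (x : (obj n).X k),
    act (σ * τ) x = act τ (act σ x)
  act_d : ∀ {n : ℕ+} {k l : ℤ} (h : l + 1 = k) (σ : Equiv.Perm (Fin n)) (x : (obj n).X k),
    act σ ((obj n).d h x) = (obj n).d h (act σ x)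
  aug_act : ∀ {n : ℕ+} {k : ℤ} (σ : Equiv.Perm (Fin n)) (x : (obj n).X k),
    (obj n).aug k (act σ x) = (obj n).aug k x

namespace SModule

/-- The elements of arity `n` and degree `k`. -/
abbrev El (M : SModule) (n : ℕ+) (k : ℤ) : Type := (M.obj n).X k

/-- The differential. -/
abbrev d (M : SModule) {n : ℕ+} {k l : ℤ} (h : l + 1 = k) : M.El n k →+ M.El n l :=
  (M.obj n).d h

/-- The augmentation. -/
abbrev aug (M : SModule) {n : ℕ+} {k : ℤ} : M.El n k →+ ℤ := (M.obj n).aug k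

end SModule

/-! ### Block permutations -/

/-- The order isomorphism of the concatenation of blocks of sizes `i 0, i 1, …` with
`{0, …, n - 1}`, where `n` is the sum of the sizes. -/
def blockEquiv {r n : ℕ+} {i : Fin r → ℕ+} (hn : ∑ j, (i j : ℕ) = n) :
    (Σ j : Fin r, Fin (i j)) ≃ Fin n :=
  finSigmaFinEquiv.trans (finCongr hn)

lemma sum_comp_perm {r n : ℕ+} {i : Fin r → ℕ+} (hn : ∑ j, (i j : ℕ) = n)
    (σ : Equiv.Perm (Fin r)) : ∑ j, (i (σ j) : ℕ) = n := by
  rw [← hn]; exact Equiv.sum_comp σ fun j => (i j : ℕ)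

/-- The block permutation `σ(i₁, …, i_r)`: it moves the `j`-th block, of size `i j`, to the
`σ j`-th place, preserving the order inside of the blocks. -/
def blockPerm {r n : ℕ+} {i : Fin r → ℕ+} (hn : ∑ j, (i j : ℕ) = n) (σ : Equiv.Perm (Fin r)) :
    Equiv.Perm (Fin n) :=
  ((blockEquiv hn).symm.trans
    (Equiv.sigmaCongrLeft (β := fun j => Fin (i j)) σ.symm).symm).trans
    (blockEquiv (i := fun l => i (σ.symm l)) (sum_comp_perm hn σ.symm))

/-- The direct sum `τ₁ ⊕ ⋯ ⊕ τ_r` of permutations. -/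
def sumPerm {r n : ℕ+} {i : Fin r → ℕ+} (hn : ∑ j, (i j : ℕ) = n)
    (τ : ∀ j, Equiv.Perm (Fin (i j))) : Equiv.Perm (Fin n) :=
  ((blockEquiv hn).symm.trans (Equiv.sigmaCongrRight τ)).trans (blockEquiv hn)

/-! ### Signs and differentials of tuples -/

/-- The sign `(-1)^e` as an integer. -/
def ksign (e : ℤ) : ℤ := ((Int.negOnePow e : ℤˣ) : ℤ)

/-- The Koszul sign exponent of `(y₁, …, y_r) ↦ (y_{σ⁻¹(1)}, …, y_{σ⁻¹(r)})`, for `y_j` of degree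
`q j`. -/
def permExp {r : ℕ+} (σ : Equiv.Perm (Fin r)) (q : Fin r → ℤ) : ℤ :=
  ∑ j, ∑ j', if j < j' ∧ σ j' < σ j then q j * q j' else 0

/-- The Koszul sign exponent of
`(y₁, …, y_r, z₁₁, z₁₂, …, z_{r1}, …) ↦ (y₁, z₁₁, z₁₂, …, y₂, z₂₁, …, y_r, z_{r1}, …)`, for `y_j`
of degree `q j` and `z_{jl}` of degree `u j l`. -/
def assocExp {r : ℕ+} {i : Fin r → ℕ+} (q : Fin r → ℤ) (u : ∀ j, Fin (i j) → ℤ) : ℤ :=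
  ∑ j, ∑ j', if j < j' then q j' * ∑ l, u j l else 0

/-- Transport along an equality of degrees. -/
def castDeg {X : ℕ+ → ℤ → Type} {n : ℕ+} {k k' : ℤ} (h : k = k') (x : X n k) : X n k' := h ▸ x

/-- The tuple `(y₁, …, d y_j, …, y_r)`. -/
def diffAt (X : ℕ+ → ℤ → Type) (d : ∀ {n : ℕ+} {k l : ℤ}, l + 1 = k → X n k → X n l)
    {r : ℕ+} {i : Fin r → ℕ+} {q : Fin r → ℤ} (y : ∀ l, X (i l) (q l)) (j : Fin r) :
    ∀ l, X (i l) (q l - if l = j then 1 else 0) := fun l =>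
  if h : l = j then d (by simp [h]) (y l) else castDeg (by simp [h]) (y l)

lemma map_castDeg {X Y : ℕ+ → ℤ → Type} (f : ∀ (n : ℕ+) (k : ℤ), X n k → Y n k) {n : ℕ+}
    {k k' : ℤ} (h : k = k') (x : X n k) : f n k' (castDeg h x) = castDeg h (f n k x) := by
  subst h; rfl

lemma map_diffAt {X Y : ℕ+ → ℤ → Type} (f : ∀ (n : ℕ+) (k : ℤ), X n k → Y n k)
    (d : ∀ {n : ℕ+} {k l : ℤ}, l + 1 = k → X n k → X n l)
    (d' : ∀ {n : ℕ+} {k l : ℤ}, l + 1 = k → Y n k → Y n l)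
    (hf : ∀ {n : ℕ+} {k l : ℤ} (h : l + 1 = k) (x : X n k), f n l (d h x) = d' h (f n k x))
    {r : ℕ+} {i : Fin r → ℕ+} {q : Fin r → ℤ} (y : ∀ l, X (i l) (q l)) (j l : Fin r) :
    f _ _ (diffAt X d y j l) = diffAt Y d' (fun l => f (i l) (q l) (y l)) j l := by
  unfold diffAt
  split
  · exact hf _ _
  · exact map_castDeg f _ _

/-! ### Operads -/

/-- The data of an operad: an `𝕊`-module with a unit of arity `1` and compositions
`γ(x; y₁, …, y_r)`, given on homogeneous elements. -/
structure PreOperad extends SModule where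
  one : (obj 1).X 0
  comp : ∀ {r n : ℕ+} {i : Fin r → ℕ+} {p m : ℤ} {q : Fin r → ℤ},
    ∑ j, (i j : ℕ) = n → p + ∑ j, q j = m →
    (obj r).X p → (∀ j, (obj (i j)).X (q j)) → (obj n).X m

/-- The laws of an operad in DGA-modules: `γ` is multilinear, a chain map and compatible with the
augmentations, and it is unital, associative and equivariant, with the Koszul signs. -/
structure PreOperad.IsOperad (P : PreOperad) : Prop where
  comp_add_left : ∀ {r n : ℕ+} {i : Fin r → ℕ+} {p m : ℤ} {q : Fin r → ℤ}
    (hn : ∑ j, (i j : ℕ) = n) (hm : p + ∑ j, q j = m)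
    (x x' : P.El r p) (y : ∀ j, P.El (i j) (q j)),
    P.comp hn hm (x + x') y = P.comp hn hm x y + P.comp hn hm x' y
  comp_add_right : ∀ {r n : ℕ+} {i : Fin r → ℕ+} {p m : ℤ} {q : Fin r → ℤ}
    (hn : ∑ j, (i j : ℕ) = n) (hm : p + ∑ j, q j = m)
    (x : P.El r p) (y : ∀ j, P.El (i j) (q j)) (j : Fin r) (a b : P.El (i j) (q j)),
    P.comp hn hm x (Function.update y j (a + b)) =
      P.comp hn hm x (Function.update y j a) + P.comp hn hm x (Function.update y j b)
  d_one : ∀ {l : ℤ} (h : l + 1 = 0), P.d h P.one = 0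
  d_comp : ∀ {r n : ℕ+} {i : Fin r → ℕ+} {p p' m m' : ℤ} {q : Fin r → ℤ}
    (hn : ∑ j, (i j : ℕ) = n) (hm : p + ∑ j, q j = m) (hp : p' + 1 = p) (hm' : m' + 1 = m)
    (h₁ : p' + ∑ j, q j = m') (h₂ : ∀ j, p + ∑ l, (q l - if l = j then 1 else 0) = m')
    (x : P.El r p) (y : ∀ j, P.El (i j) (q j)),
    P.d hm' (P.comp hn hm x y) = P.comp hn h₁ (P.d hp x) y +
      ∑ j, ksign (p + ∑ l with l < j, q l) •
        P.comp hn (h₂ j) x (diffAt P.El (fun h => P.d h) y j)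
  aug_one : P.aug P.one = 1
  aug_comp : ∀ {r n : ℕ+} {i : Fin r → ℕ+} {p m : ℤ} {q : Fin r → ℤ}
    (hn : ∑ j, (i j : ℕ) = n) (hm : p + ∑ j, q j = m)
    (x : P.El r p) (y : ∀ j, P.El (i j) (q j)),
    P.aug (P.comp hn hm x y) = P.aug x * ∏ j, P.aug (y j)
  one_comp : ∀ {n : ℕ+} {k : ℤ} (hn : ∑ _j : Fin (1 : ℕ+), (n : ℕ) = n)
    (hk : 0 + ∑ _j : Fin (1 : ℕ+), k = k) (y : P.El n k),
    P.comp (i := fun _ => n) (q := fun _ => k) hn hk P.one (fun _ => y) = y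
  comp_one : ∀ {n : ℕ+} {k : ℤ} (hn : ∑ _j : Fin n, ((1 : ℕ+) : ℕ) = n)
    (hk : k + ∑ _j : Fin n, 0 = k) (x : P.El n k),
    P.comp (i := fun _ => 1) (q := fun _ => 0) hn hk x (fun _ => P.one) = x
  assoc : ∀ {r s n : ℕ+} {i a : Fin r → ℕ+} {c : ∀ j, Fin (i j) → ℕ+} {p e m : ℤ}
    {q b : Fin r → ℤ} {u : ∀ j, Fin (i j) → ℤ}
    (hs : ∑ j, (i j : ℕ) = s) (he : p + ∑ j, q j = e)
    (ha : ∀ j, ∑ l, (c j l : ℕ) = a j) (hb : ∀ j, q j + ∑ l, u j l = b j)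
    (hn : ∑ j, (a j : ℕ) = n) (hm : p + ∑ j, b j = m)
    (hn' : ∑ t, (c ((blockEquiv hs).symm t).1 ((blockEquiv hs).symm t).2 : ℕ) = n)
    (hm' : e + ∑ t, u ((blockEquiv hs).symm t).1 ((blockEquiv hs).symm t).2 = m)
    (x : P.El r p) (y : ∀ j, P.El (i j) (q j)) (z : ∀ j l, P.El (c j l) (u j l)),
    P.comp hn' hm' (P.comp hs he x y)
        (fun t => z ((blockEquiv hs).symm t).1 ((blockEquiv hs).symm t).2) =
      ksign (assocExp q u) • P.comp hn hm x (fun j => P.comp (ha j) (hb j) (y j) (z j))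
  comp_act_left : ∀ {r n : ℕ+} {i : Fin r → ℕ+} {p m : ℤ} {q : Fin r → ℤ}
    (hn : ∑ j, (i j : ℕ) = n) (hm : p + ∑ j, q j = m) (σ : Equiv.Perm (Fin r))
    (hn' : ∑ j, (i (σ.symm j) : ℕ) = n) (hm' : p + ∑ j, q (σ.symm j) = m)
    (x : P.El r p) (y : ∀ j, P.El (i j) (q j)),
    P.comp hn hm (P.act σ x) y = ksign (permExp σ q) •
      P.act (blockPerm hn σ) (P.comp hn' hm' x (fun j => y (σ.symm j)))
  comp_act_right : ∀ {r n : ℕ+} {i : Fin r → ℕ+} {p m : ℤ} {q : Fin r → ℤ}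
    (hn : ∑ j, (i j : ℕ) = n) (hm : p + ∑ j, q j = m) (τ : ∀ j, Equiv.Perm (Fin (i j)))
    (x : P.El r p) (y : ∀ j, P.El (i j) (q j)),
    P.comp hn hm x (fun j => P.act (τ j) (y j)) = P.act (sumPerm hn τ) (P.comp hn hm x y)

/-- An operad in DGA-modules. -/
structure Operad extends PreOperad where
  isOperad : toPreOperad.IsOperad

/-- An isomorphism of operads: bijective morphisms of DGA-modules of degree `0` in each arity which
respect the actions, the unit and the compositions. -/
structure OperadIso (P Q : PreOperad) where
  toEquiv : ∀ {n : ℕ+} {k : ℤ}, P.El n k ≃+ Q.El n k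
  map_d : ∀ {n : ℕ+} {k l : ℤ} (h : l + 1 = k) (x : P.El n k),
    toEquiv (P.d h x) = Q.d h (toEquiv x)
  map_aug : ∀ {n : ℕ+} {k : ℤ} (x : P.El n k), Q.aug (toEquiv x) = P.aug x
  map_coaug : ∀ {n : ℕ+} (a : ℤ), toEquiv ((P.obj n).coaug a) = (Q.obj n).coaug a
  map_act : ∀ {n : ℕ+} {k : ℤ} (σ : Equiv.Perm (Fin n)) (x : P.El n k),
    toEquiv (P.act σ x) = Q.act σ (toEquiv x)
  map_one : toEquiv P.one = Q.one
  map_comp : ∀ {r n : ℕ+} {i : Fin r → ℕ+} {p m : ℤ} {q : Fin r → ℤ}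
    (hn : ∑ j, (i j : ℕ) = n) (hm : p + ∑ j, q j = m)
    (x : P.El r p) (y : ∀ j, P.El (i j) (q j)),
    toEquiv (P.comp hn hm x y) = Q.comp hn hm (toEquiv x) (fun j => toEquiv (y j))

/-! ### Operadic ideals and quotients -/

/-- An operadic ideal: a sub-`𝕊`-module (graded subgroups stable under differential and actions)
that contains `γ(x; y₁, …, y_r)` as soon as it contains one of `x, y₁, …, y_r`. It lies in the
kernel of the augmentation, so that the quotient is again augmented. -/
structure OperadicIdeal (P : PreOperad) where
  carrier : ∀ (n : ℕ+) (k : ℤ), AddSubgroup (P.El n k)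
  d_mem : ∀ {n : ℕ+} {k l : ℤ} (h : l + 1 = k) {x : P.El n k},
    x ∈ carrier n k → P.d h x ∈ carrier n l
  act_mem : ∀ {n : ℕ+} {k : ℤ} (σ : Equiv.Perm (Fin n)) {x : P.El n k},
    x ∈ carrier n k → P.act σ x ∈ carrier n k
  comp_mem_left : ∀ {r n : ℕ+} {i : Fin r → ℕ+} {p m : ℤ} {q : Fin r → ℤ}
    (hn : ∑ j, (i j : ℕ) = n) (hm : p + ∑ j, q j = m)
    {x : P.El r p} (y : ∀ j, P.El (i j) (q j)),
    x ∈ carrier r p → P.comp hn hm x y ∈ carrier n m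
  comp_mem_right : ∀ {r n : ℕ+} {i : Fin r → ℕ+} {p m : ℤ} {q : Fin r → ℤ}
    (hn : ∑ j, (i j : ℕ) = n) (hm : p + ∑ j, q j = m)
    (x : P.El r p) {y : ∀ j, P.El (i j) (q j)} (j : Fin r),
    y j ∈ carrier (i j) (q j) → P.comp hn hm x y ∈ carrier n m
  aug_eq_zero : ∀ {n : ℕ+} {k : ℤ} {x : P.El n k}, x ∈ carrier n k → P.aug x = 0

/-- The smallest family of graded subgroups that contains `G` and is stable under the differential,
the actions and the compositions having at least one argument in it: the elements of the operadic
ideal generated by `G`. -/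
inductive IdealClosure (P : PreOperad) (G : ∀ (n : ℕ+) (k : ℤ), P.El n k → Prop) :
    ∀ (n : ℕ+) (k : ℤ), P.El n k → Prop
  | base {n : ℕ+} {k : ℤ} {x : P.El n k} : G n k x → IdealClosure P G n k x
  | zero {n : ℕ+} {k : ℤ} : IdealClosure P G n k 0
  | add {n : ℕ+} {k : ℤ} {x y : P.El n k} :
      IdealClosure P G n k x → IdealClosure P G n k y → IdealClosure P G n k (x + y)
  | neg {n : ℕ+} {k : ℤ} {x : P.El n k} : IdealClosure P G n k x → IdealClosure P G n k (-x)
  | d {n : ℕ+} {k l : ℤ} (h : l + 1 = k) {x : P.El n k} :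
      IdealClosure P G n k x → IdealClosure P G n l (P.d h x)
  | act {n : ℕ+} {k : ℤ} (σ : Equiv.Perm (Fin n)) {x : P.El n k} :
      IdealClosure P G n k x → IdealClosure P G n k (P.act σ x)
  | comp_left {r n : ℕ+} {i : Fin r → ℕ+} {p m : ℤ} {q : Fin r → ℤ}
      (hn : ∑ j, (i j : ℕ) = n) (hm : p + ∑ j, q j = m)
      {x : P.El r p} (y : ∀ j, P.El (i j) (q j)) :
      IdealClosure P G r p x → IdealClosure P G n m (P.comp hn hm x y)
  | comp_right {r n : ℕ+} {i : Fin r → ℕ+} {p m : ℤ} {q : Fin r → ℤ}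
      (hn : ∑ j, (i j : ℕ) = n) (hm : p + ∑ j, q j = m)
      (x : P.El r p) {y : ∀ j, P.El (i j) (q j)} (j : Fin r) :
      IdealClosure P G (i j) (q j) (y j) → IdealClosure P G n m (P.comp hn hm x y)

lemma IdealClosure.aug_eq_zero {P : Operad}
    {G : ∀ (n : ℕ+) (k : ℤ), P.El n k → Prop} (hG : ∀ n k x, G n k x → P.aug x = 0)
    {n : ℕ+} {k : ℤ} {x : P.El n k} (hx : IdealClosure P.toPreOperad G n k x) : P.aug x = 0 := by
  induction hx with
  | base h => exact hG _ _ _ h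
  | zero => exact map_zero _
  | add _ _ h h' => rw [map_add, h, h', add_zero]
  | neg _ h => rw [map_neg, h, neg_zero]
  | d h _ _ => exact (P.obj _).aug_d h _
  | act σ _ h => exact (P.aug_act σ _).trans h
  | comp_left hn hm y _ h => rw [P.isOperad.aug_comp, h, zero_mul]
  | comp_right hn hm x j _ h =>
    rw [P.isOperad.aug_comp, Finset.prod_eq_zero (Finset.mem_univ j) h, mul_zero]

/-- The operadic ideal generated by a set of elements of augmentation zero. -/
def OperadicIdeal.span (P : Operad) (G : ∀ (n : ℕ+) (k : ℤ), P.El n k → Prop)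
    (hG : ∀ n k x, G n k x → P.aug x = 0) : OperadicIdeal P.toPreOperad where
  carrier n k :=
    { carrier := {x | IdealClosure P.toPreOperad G n k x}
      zero_mem' := .zero
      add_mem' := .add
      neg_mem' := .neg }
  d_mem h _ hx := .d h hx
  act_mem σ _ hx := .act σ hx
  comp_mem_left hn hm _ y hx := .comp_left hn hm y hx
  comp_mem_right hn hm x _ j hy := .comp_right hn hm x j hy
  aug_eq_zero hx := IdealClosure.aug_eq_zero hG hx

section Quotient

variable (P : Operad) (I : OperadicIdeal P.toPreOperad)

lemma Operad.comp_sub_mem {r n : ℕ+} {i : Fin r → ℕ+} {p m : ℤ} {q : Fin r → ℤ}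
    (hn : ∑ j, (i j : ℕ) = n) (hm : p + ∑ j, q j = m) {x x' : P.El r p}
    {y y' : ∀ j, P.El (i j) (q j)} (hx : x' - x ∈ I.carrier r p)
    (hy : ∀ j, y' j - y j ∈ I.carrier (i j) (q j)) :
    P.comp hn hm x' y' - P.comp hn hm x y ∈ I.carrier n m := by
  have h1 : P.comp hn hm x' y' - P.comp hn hm x y' ∈ I.carrier n m := by
    have := P.isOperad.comp_add_left hn hm (x' - x) x y'
    rw [sub_add_cancel] at this
    rw [this, add_sub_cancel_right]
    exact I.comp_mem_left hn hm y' hx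
  have h2 : ∀ s : Finset (Fin r),
      P.comp hn hm x (s.piecewise y' y) - P.comp hn hm x y ∈ I.carrier n m := by
    intro s
    induction s using Finset.induction_on with
    | empty => simp
    | insert j s hj ih =>
      have hu : s.piecewise y' y = Function.update (s.piecewise y' y) j (y j) := by
        rw [Function.eq_update_iff]; simp [hj]
      have h3 : P.comp hn hm x ((insert j s).piecewise y' y) -
          P.comp hn hm x (s.piecewise y' y) ∈ I.carrier n m := by
        have h4 := P.isOperad.comp_add_right hn hm x (s.piecewise y' y) j (y' j - y j) (y j)
        rw [sub_add_cancel, ← Finset.piecewise_insert, ← hu] at h4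
        rw [h4, add_sub_cancel_right]
        refine I.comp_mem_right hn hm x j ?_
        simpa using hy j
      simpa using add_mem h3 ih
  have h5 := h2 Finset.univ
  rw [Finset.piecewise_univ] at h5
  simpa using add_mem h1 h5

/-- The DGA-modules `P(n)/I(n)`. -/
def Operad.quotObj (n : ℕ+) : DGAModule where
  X k := P.El n k ⧸ I.carrier n k
  d h := QuotientAddGroup.map _ _ (P.d h) fun _ hx => I.d_mem h hx
  d_d h h' x := by
    obtain ⟨x, rfl⟩ := QuotientAddGroup.mk_surjective x
    exact (congrArg (QuotientAddGroup.mk' _) ((P.obj n).d_d h h' x)).trans (map_zero _)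
  aug k := QuotientAddGroup.lift _ P.aug fun _ hx => I.aug_eq_zero hx
  aug_of_ne k x hk := by
    obtain ⟨x, rfl⟩ := QuotientAddGroup.mk_surjective x
    exact (P.obj n).aug_of_ne k x hk
  aug_d h x := by
    obtain ⟨x, rfl⟩ := QuotientAddGroup.mk_surjective x
    exact (P.obj n).aug_d h x
  coaug := (QuotientAddGroup.mk' _).comp (P.obj n).coaug
  d_coaug h a :=
    (congrArg (QuotientAddGroup.mk' _) ((P.obj n).d_coaug h a)).trans (map_zero _)
  aug_coaug a := (P.obj n).aug_coaug a

/-- The class of an element in the quotient. -/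
def Operad.toQuot {n : ℕ+} {k : ℤ} : P.El n k →+ (P.quotObj I n).X k := QuotientAddGroup.mk' _

lemma Operad.toQuot_surjective {n : ℕ+} {k : ℤ} (x : (P.quotObj I n).X k) :
    ∃ y : P.El n k, P.toQuot I y = x := QuotientAddGroup.mk_surjective x

lemma Operad.toQuot_eq {n : ℕ+} {k : ℤ} {x y : P.El n k} :
    P.toQuot I x = P.toQuot I y ↔ y - x ∈ I.carrier n k := by
  rw [sub_eq_neg_add]; exact QuotientAddGroup.eq

/-- The data of the quotient: all operations are those of `P` on representatives. -/
noncomputable def Operad.quotPre : PreOperad where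
  obj := P.quotObj I
  act σ := QuotientAddGroup.map _ _ (P.act σ) fun _ hx => I.act_mem σ hx
  act_one x := by
    obtain ⟨x, rfl⟩ := QuotientAddGroup.mk_surjective x
    exact congrArg (P.toQuot I) (P.act_one x)
  act_mul σ τ x := by
    obtain ⟨x, rfl⟩ := QuotientAddGroup.mk_surjective x
    exact congrArg (P.toQuot I) (P.act_mul σ τ x)
  act_d h σ x := by
    obtain ⟨x, rfl⟩ := QuotientAddGroup.mk_surjective x
    exact congrArg (P.toQuot I) (P.act_d h σ x)
  aug_act σ x := by
    obtain ⟨x, rfl⟩ := QuotientAddGroup.mk_surjective x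
    exact P.aug_act σ x
  one := P.toQuot I P.one
  comp hn hm x y := P.toQuot I (P.comp hn hm (P.toQuot_surjective I x).choose
    fun j => (P.toQuot_surjective I (y j)).choose)

lemma Operad.toQuot_comp {r n : ℕ+} {i : Fin r → ℕ+} {p m : ℤ} {q : Fin r → ℤ}
    (hn : ∑ j, (i j : ℕ) = n) (hm : p + ∑ j, q j = m) (x : P.El r p)
    (y : ∀ j, P.El (i j) (q j)) :
    (P.quotPre I).comp hn hm (P.toQuot I x) (fun j => P.toQuot I (y j)) =
      P.toQuot I (P.comp hn hm x y) := by
  refine (P.toQuot_eq I).2 (P.comp_sub_mem I hn hm ?_ fun j => ?_)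
  · exact (P.toQuot_eq I).1 (P.toQuot_surjective I (P.toQuot I x)).choose_spec
  · exact (P.toQuot_eq I).1 (P.toQuot_surjective I (P.toQuot I (y j))).choose_spec

lemma Operad.exists_toQuot {r : ℕ+} {i : Fin r → ℕ+} {q : Fin r → ℤ}
    (y : ∀ j, (P.quotPre I).El (i j) (q j)) :
    ∃ y' : ∀ j, P.El (i j) (q j), y = fun j => P.toQuot I (y' j) := by
  choose y' h using fun j => P.toQuot_surjective I (y j)
  exact ⟨y', funext fun j => (h j).symm⟩

lemma Operad.toQuot_update {r : ℕ+} {i : Fin r → ℕ+} {q : Fin r → ℤ}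
    (y : ∀ j, P.El (i j) (q j)) (j : Fin r) (a : P.El (i j) (q j)) :
    Function.update (fun l => P.toQuot I (y l)) j (P.toQuot I a) =
      fun l => P.toQuot I (Function.update y j a l) := by
  funext l
  by_cases h : l = j
  · subst h; simp
  · simp [h]

/-- The quotient operad `P/I`. -/
noncomputable def Operad.quotient : Operad where
  toPreOperad := P.quotPre I
  isOperad := by
    have hd : ∀ {n : ℕ+} {k l : ℤ} (h : l + 1 = k) (x : P.El n k),
        (P.quotPre I).d h (P.toQuot I x) = P.toQuot I (P.d h x) := fun _ _ => rfl
    have hact : ∀ {n : ℕ+} {k : ℤ} (σ : Equiv.Perm (Fin n)) (x : P.El n k),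
        (P.quotPre I).act σ (P.toQuot I x) = P.toQuot I (P.act σ x) := fun _ _ => rfl
    have haug : ∀ {n : ℕ+} {k : ℤ} (x : P.El n k),
        (P.quotPre I).aug (P.toQuot I x) = P.aug x := fun _ => rfl
    have hone : (P.quotPre I).one = P.toQuot I P.one := rfl
    refine ⟨?_, ?_, ?_, ?_, ?_, ?_, ?_, ?_, ?_, ?_, ?_⟩
    · intro r n i p m q hn hm x x' y
      obtain ⟨x, rfl⟩ := P.toQuot_surjective I x
      obtain ⟨x', rfl⟩ := P.toQuot_surjective I x'
      obtain ⟨y, rfl⟩ := P.exists_toQuot I y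
      erw [← map_add, P.toQuot_comp, P.toQuot_comp, P.toQuot_comp, P.isOperad.comp_add_left,
        map_add]
      rfl
    · intro r n i p m q hn hm x y j a b
      obtain ⟨x, rfl⟩ := P.toQuot_surjective I x
      obtain ⟨y, rfl⟩ := P.exists_toQuot I y
      obtain ⟨a, rfl⟩ := P.toQuot_surjective I a
      obtain ⟨b, rfl⟩ := P.toQuot_surjective I b
      erw [← map_add, P.toQuot_update, P.toQuot_update, P.toQuot_update, P.toQuot_comp,
        P.toQuot_comp, P.toQuot_comp, P.isOperad.comp_add_right, map_add]
      rfl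
    · intro l h
      rw [hone, hd, P.isOperad.d_one, map_zero]
      rfl
    · intro r n i p p' m m' q hn hm hp hm' h₁ h₂ x y
      obtain ⟨x, rfl⟩ := P.toQuot_surjective I x
      obtain ⟨y, rfl⟩ := P.exists_toQuot I y
      have hD : ∀ j, diffAt (P.quotPre I).El (fun h => (P.quotPre I).d h)
          (fun l => P.toQuot I (y l)) j =
          fun l => P.toQuot I (diffAt P.El (fun h => P.d h) y j l) := fun j =>
        funext fun l => (map_diffAt (X := P.El) (Y := (P.quotPre I).El)
          (fun _ _ => P.toQuot I) (d := @fun n k l h => ⇑(P.d (n := n) h))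
          (d' := @fun n k l h => ⇑((P.quotPre I).d (n := n) h)) (fun _ _ => rfl) y j l).symm
      simp only [hD]
      simp only [hd, P.toQuot_comp]
      rw [P.isOperad.d_comp hn hm hp hm' h₁ h₂]
      simp only [map_add, map_sum, map_zsmul]
      rfl
    · rw [hone, haug, P.isOperad.aug_one]
    · intro r n i p m q hn hm x y
      obtain ⟨x, rfl⟩ := P.toQuot_surjective I x
      obtain ⟨y, rfl⟩ := P.exists_toQuot I y
      rw [P.toQuot_comp, haug, P.isOperad.aug_comp]; rfl
    · intro n k hn hk y
      obtain ⟨y, rfl⟩ := P.toQuot_surjective I y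
      rw [hone]
      exact (P.toQuot_comp I hn hk P.one fun _ => y).trans
        (congrArg _ (P.isOperad.one_comp hn hk y))
    · intro n k hn hk x
      obtain ⟨x, rfl⟩ := P.toQuot_surjective I x
      rw [hone]
      exact (P.toQuot_comp I hn hk x fun _ => P.one).trans
        (congrArg _ (P.isOperad.comp_one hn hk x))
    · intro r s n i a c p e m q b u hs he ha hb hn hm hn' hm' x y z
      obtain ⟨x, rfl⟩ := P.toQuot_surjective I x
      obtain ⟨y, rfl⟩ := P.exists_toQuot I y
      choose z' hz using fun j => P.exists_toQuot I (z j)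
      obtain rfl : z = fun j l => P.toQuot I (z' j l) := funext hz
      simp only [P.toQuot_comp]
      rw [P.isOperad.assoc hs he ha hb hn hm hn' hm', map_zsmul]
      rfl
    · intro r n i p m q hn hm σ hn' hm' x y
      obtain ⟨x, rfl⟩ := P.toQuot_surjective I x
      obtain ⟨y, rfl⟩ := P.exists_toQuot I y
      simp only [hact, P.toQuot_comp]
      rw [P.isOperad.comp_act_left hn hm σ hn' hm', map_zsmul]
      rfl
    · intro r n i p m q hn hm τ x y
      obtain ⟨x, rfl⟩ := P.toQuot_surjective I x
      obtain ⟨y, rfl⟩ := P.exists_toQuot I y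
      simp only [hact, P.toQuot_comp]
      rw [P.isOperad.comp_act_right hn hm τ]

end Quotient

/-! ### The free operad on an `𝕊`-module -/

/-- Formal expressions of arity `n` and degree `k` in the operations of an operad, with elements of
the `𝕊`-module `M` as generators. -/
inductive OpTerm (M : SModule) : ℕ+ → ℤ → Type
  | gen {n : ℕ+} {k : ℤ} (x : M.El n k) : OpTerm M n k
  | one : OpTerm M 1 0
  | zero {n : ℕ+} {k : ℤ} : OpTerm M n k
  | add {n : ℕ+} {k : ℤ} (s t : OpTerm M n k) : OpTerm M n k
  | neg {n : ℕ+} {k : ℤ} (t : OpTerm M n k) : OpTerm M n k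
  | d {n : ℕ+} {k l : ℤ} (h : l + 1 = k) (t : OpTerm M n k) : OpTerm M n l
  | act {n : ℕ+} {k : ℤ} (σ : Equiv.Perm (Fin n)) (t : OpTerm M n k) : OpTerm M n k
  | comp {r n : ℕ+} {i : Fin r → ℕ+} {p m : ℤ} {q : Fin r → ℤ}
      (hn : ∑ j, (i j : ℕ) = n) (hm : p + ∑ j, q j = m)
      (t : OpTerm M r p) (s : ∀ j, OpTerm M (i j) (q j)) : OpTerm M n m

namespace OpTerm

variable {M : SModule}

/-- The formal expression `(-1)^e t`. -/
def sgn {n : ℕ+} {k : ℤ} (e : ℤ) (t : OpTerm M n k) : OpTerm M n k :=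
  if Even e then t else neg t

/-- Formal finite sums. -/
def sum {n : ℕ+} {k : ℤ} {r : ℕ} (t : Fin r → OpTerm M n k) : OpTerm M n k :=
  (List.ofFn t).foldr add zero

/-- The congruence generated by the group axioms in each degree, the relations saying that `M` is
mapped to the expressions as an `𝕊`-module, and the laws of an operad in DGA-modules. -/
inductive Rel : ∀ {n : ℕ+} {k : ℤ}, OpTerm M n k → OpTerm M n k → Prop
  | refl {n : ℕ+} {k : ℤ} (t : OpTerm M n k) : Rel t t
  | symm {n : ℕ+} {k : ℤ} {s t : OpTerm M n k} : Rel s t → Rel t s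
  | trans {n : ℕ+} {k : ℤ} {s t u : OpTerm M n k} : Rel s t → Rel t u → Rel s u
  | add_congr {n : ℕ+} {k : ℤ} {s s' t t' : OpTerm M n k} :
      Rel s s' → Rel t t' → Rel (add s t) (add s' t')
  | neg_congr {n : ℕ+} {k : ℤ} {t t' : OpTerm M n k} : Rel t t' → Rel (neg t) (neg t')
  | d_congr {n : ℕ+} {k l : ℤ} (h : l + 1 = k) {t t' : OpTerm M n k} :
      Rel t t' → Rel (d h t) (d h t')
  | act_congr {n : ℕ+} {k : ℤ} (σ : Equiv.Perm (Fin n)) {t t' : OpTerm M n k} :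
      Rel t t' → Rel (act σ t) (act σ t')
  | comp_congr {r n : ℕ+} {i : Fin r → ℕ+} {p m : ℤ} {q : Fin r → ℤ}
      (hn : ∑ j, (i j : ℕ) = n) (hm : p + ∑ j, q j = m)
      {x x' : OpTerm M r p} {y y' : ∀ j, OpTerm M (i j) (q j)} :
      Rel x x' → (∀ j, Rel (y j) (y' j)) → Rel (comp hn hm x y) (comp hn hm x' y')
  | add_assoc {n : ℕ+} {k : ℤ} (s t u : OpTerm M n k) :
      Rel (add (add s t) u) (add s (add t u))
  | add_comm {n : ℕ+} {k : ℤ} (s t : OpTerm M n k) : Rel (add s t) (add t s)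
  | zero_add {n : ℕ+} {k : ℤ} (t : OpTerm M n k) : Rel (add zero t) t
  | neg_add {n : ℕ+} {k : ℤ} (t : OpTerm M n k) : Rel (add (neg t) t) zero
  | gen_add {n : ℕ+} {k : ℤ} (x y : M.El n k) : Rel (gen (x + y)) (add (gen x) (gen y))
  | gen_d {n : ℕ+} {k l : ℤ} (h : l + 1 = k) (x : M.El n k) : Rel (gen (M.d h x)) (d h (gen x))
  | gen_act {n : ℕ+} {k : ℤ} (σ : Equiv.Perm (Fin n)) (x : M.El n k) :
      Rel (gen (M.act σ x)) (act σ (gen x))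
  | d_add {n : ℕ+} {k l : ℤ} (h : l + 1 = k) (s t : OpTerm M n k) :
      Rel (d h (add s t)) (add (d h s) (d h t))
  | d_d {n : ℕ+} {k l m : ℤ} (h : l + 1 = k) (h' : m + 1 = l) (t : OpTerm M n k) :
      Rel (d h' (d h t)) zero
  | act_add {n : ℕ+} {k : ℤ} (σ : Equiv.Perm (Fin n)) (s t : OpTerm M n k) :
      Rel (act σ (add s t)) (add (act σ s) (act σ t))
  | act_one {n : ℕ+} {k : ℤ} (t : OpTerm M n k) : Rel (act 1 t) t
  | act_mul {n : ℕ+} {k : ℤ} (σ τ : Equiv.Perm (Fin n)) (t : OpTerm M n k) :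
      Rel (act (σ * τ) t) (act τ (act σ t))
  | act_d {n : ℕ+} {k l : ℤ} (h : l + 1 = k) (σ : Equiv.Perm (Fin n)) (t : OpTerm M n k) :
      Rel (act σ (d h t)) (d h (act σ t))
  | comp_add_left {r n : ℕ+} {i : Fin r → ℕ+} {p m : ℤ} {q : Fin r → ℤ}
      (hn : ∑ j, (i j : ℕ) = n) (hm : p + ∑ j, q j = m)
      (x x' : OpTerm M r p) (y : ∀ j, OpTerm M (i j) (q j)) :
      Rel (comp hn hm (add x x') y) (add (comp hn hm x y) (comp hn hm x' y))
  | comp_add_right {r n : ℕ+} {i : Fin r → ℕ+} {p m : ℤ} {q : Fin r → ℤ}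
      (hn : ∑ j, (i j : ℕ) = n) (hm : p + ∑ j, q j = m)
      (x : OpTerm M r p) (y : ∀ j, OpTerm M (i j) (q j)) (j : Fin r)
      (a b : OpTerm M (i j) (q j)) :
      Rel (comp hn hm x (Function.update y j (add a b)))
        (add (comp hn hm x (Function.update y j a)) (comp hn hm x (Function.update y j b)))
  | d_one {l : ℤ} (h : l + 1 = 0) : Rel (d h one) zero
  | d_comp {r n : ℕ+} {i : Fin r → ℕ+} {p p' m m' : ℤ} {q : Fin r → ℤ}
      (hn : ∑ j, (i j : ℕ) = n) (hm : p + ∑ j, q j = m) (hp : p' + 1 = p) (hm' : m' + 1 = m)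
      (h₁ : p' + ∑ j, q j = m') (h₂ : ∀ j, p + ∑ l, (q l - if l = j then 1 else 0) = m')
      (x : OpTerm M r p) (y : ∀ j, OpTerm M (i j) (q j)) :
      Rel (d hm' (comp hn hm x y))
        (add (comp hn h₁ (d hp x) y)
          (sum fun j => sgn (p + ∑ l with l < j, q l) (comp hn (h₂ j) x (diffAt (OpTerm M) d y j))))
  | one_comp {n : ℕ+} {k : ℤ} (hn : ∑ _j : Fin (1 : ℕ+), (n : ℕ) = n)
      (hk : 0 + ∑ _j : Fin (1 : ℕ+), k = k) (y : OpTerm M n k) :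
      Rel (comp (i := fun _ => n) (q := fun _ => k) hn hk one (fun _ => y)) y
  | comp_one {n : ℕ+} {k : ℤ} (hn : ∑ _j : Fin n, ((1 : ℕ+) : ℕ) = n)
      (hk : k + ∑ _j : Fin n, 0 = k) (x : OpTerm M n k) :
      Rel (comp (i := fun _ => 1) (q := fun _ => 0) hn hk x (fun _ => one)) x
  | assoc {r s n : ℕ+} {i a : Fin r → ℕ+} {c : ∀ j, Fin (i j) → ℕ+} {p e m : ℤ}
      {q b : Fin r → ℤ} {u : ∀ j, Fin (i j) → ℤ}
      (hs : ∑ j, (i j : ℕ) = s) (he : p + ∑ j, q j = e)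
      (ha : ∀ j, ∑ l, (c j l : ℕ) = a j) (hb : ∀ j, q j + ∑ l, u j l = b j)
      (hn : ∑ j, (a j : ℕ) = n) (hm : p + ∑ j, b j = m)
      (hn' : ∑ t, (c ((blockEquiv hs).symm t).1 ((blockEquiv hs).symm t).2 : ℕ) = n)
      (hm' : e + ∑ t, u ((blockEquiv hs).symm t).1 ((blockEquiv hs).symm t).2 = m)
      (x : OpTerm M r p) (y : ∀ j, OpTerm M (i j) (q j)) (z : ∀ j l, OpTerm M (c j l) (u j l)) :
      Rel (comp hn' hm' (comp hs he x y)
          (fun t => z ((blockEquiv hs).symm t).1 ((blockEquiv hs).symm t).2))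
        (sgn (assocExp q u) (comp hn hm x (fun j => comp (ha j) (hb j) (y j) (z j))))
  | comp_act_left {r n : ℕ+} {i : Fin r → ℕ+} {p m : ℤ} {q : Fin r → ℤ}
      (hn : ∑ j, (i j : ℕ) = n) (hm : p + ∑ j, q j = m) (σ : Equiv.Perm (Fin r))
      (hn' : ∑ j, (i (σ.symm j) : ℕ) = n) (hm' : p + ∑ j, q (σ.symm j) = m)
      (x : OpTerm M r p) (y : ∀ j, OpTerm M (i j) (q j)) :
      Rel (comp hn hm (act σ x) y)
        (sgn (permExp σ q) (act (blockPerm hn σ) (comp hn' hm' x (fun j => y (σ.symm j)))))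
  | comp_act_right {r n : ℕ+} {i : Fin r → ℕ+} {p m : ℤ} {q : Fin r → ℤ}
      (hn : ∑ j, (i j : ℕ) = n) (hm : p + ∑ j, q j = m) (τ : ∀ j, Equiv.Perm (Fin (i j)))
      (x : OpTerm M r p) (y : ∀ j, OpTerm M (i j) (q j)) :
      Rel (comp hn hm x (fun j => act (τ j) (y j))) (act (sumPerm hn τ) (comp hn hm x y))

/-- The augmentation of a formal expression. -/
def aug : ∀ {n : ℕ+} {k : ℤ}, OpTerm M n k → ℤ
  | _, _, gen x => M.aug x
  | _, _, one => 1
  | _, _, zero => 0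
  | _, _, add s t => aug s + aug t
  | _, _, neg t => -aug t
  | _, _, d _ _ => 0
  | _, _, act _ t => aug t
  | _, _, comp _ _ t s => aug t * ∏ j, aug (s j)

lemma aug_of_ne {n : ℕ+} {k : ℤ} (t : OpTerm M n k) (hk : k ≠ 0) : aug t = 0 := by
  induction t with
  | gen x => exact (M.obj _).aug_of_ne _ x hk
  | one => exact absurd rfl hk
  | zero => rfl
  | add s t hs ht => simp [aug, hs hk, ht hk]
  | neg t ht => simp [aug, ht hk]
  | d h t _ => rfl
  | act σ t ht => simpa [aug] using ht hk
  | @comp r n i p m q hn hm t s ht hs =>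
    by_cases hp : p = 0
    · obtain ⟨j, hj⟩ : ∃ j, q j ≠ 0 := by
        by_contra! h
        exact hk (by simp [← hm, hp, h])
      have h0 : ∏ j, aug (s j) = 0 := Finset.prod_eq_zero (Finset.mem_univ j) (hs j hj)
      simp [aug, h0]
    · simp [aug, ht hp]

lemma aug_sgn {n : ℕ+} {k : ℤ} (e : ℤ) (t : OpTerm M n k) : aug (sgn e t) = ksign e * aug t := by
  unfold sgn ksign
  split_ifs with h
  · simp [Int.negOnePow_even e h]
  · simp [Int.negOnePow_odd e (Int.not_even_iff_odd.1 h), aug]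

lemma aug_sum {n : ℕ+} {k : ℤ} {r : ℕ} (t : Fin r → OpTerm M n k) :
    aug (sum t) = ∑ j, aug (t j) := by
  rw [← List.sum_ofFn, ← Function.comp_def, ← List.map_ofFn]
  unfold sum
  induction List.ofFn t with
  | nil => rfl
  | cons a l ih => simp [aug, ih]

lemma aug_castDeg {n : ℕ+} {k k' : ℤ} (h : k = k') (t : OpTerm M n k) :
    aug (castDeg h t) = aug t := by
  subst h; rfl

lemma aug_diffAt {r : ℕ+} {i : Fin r → ℕ+} {q : Fin r → ℤ} (y : ∀ l, OpTerm M (i l) (q l))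
    (j : Fin r) : aug (diffAt (OpTerm M) d y j j) = 0 := by
  unfold diffAt
  simp [aug]

lemma Rel.aug_eq {n : ℕ+} {k : ℤ} {s t : OpTerm M n k} (h : Rel s t) : aug s = aug t := by
  induction h with
  | refl t => rfl
  | symm _ h => exact h.symm
  | trans _ _ h h' => exact h.trans h'
  | add_congr _ _ h h' => simp [aug, h, h']
  | neg_congr _ h => simp [aug, h]
  | d_congr h _ _ => rfl
  | act_congr σ _ h => simpa [aug] using h
  | comp_congr hn hm _ _ h h' => simp [aug, h, h']
  | add_assoc s t u => simp only [aug]; ring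
  | add_comm s t => simp only [aug]; ring
  | zero_add t => simp [aug]
  | neg_add t => simp [aug]
  | gen_add x y => simp [aug]
  | gen_d h x => exact (M.obj _).aug_d h x
  | gen_act σ x => exact M.aug_act σ x
  | d_add h s t => simp [aug]
  | d_d h h' t => rfl
  | act_add σ s t => simp [aug]
  | act_one t => simp [aug]
  | act_mul σ τ t => simp [aug]
  | act_d h σ t => simp [aug]
  | comp_add_left hn hm x x' y => simp only [aug]; ring
  | comp_add_right hn hm x y j a b =>
    simp only [aug, ← mul_add]
    congr 1
    rw [← Finset.mul_prod_erase _ _ (Finset.mem_univ j),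
      ← Finset.mul_prod_erase _ (fun l => aug (Function.update y j a l)) (Finset.mem_univ j),
      ← Finset.mul_prod_erase _ (fun l => aug (Function.update y j b l)) (Finset.mem_univ j)]
    have h : ∀ c, ∏ l ∈ Finset.univ.erase j, aug (Function.update y j c l) =
        ∏ l ∈ Finset.univ.erase j, aug (y l) := fun c =>
      Finset.prod_congr rfl fun l hl => by
        rw [Function.update_of_ne (Finset.ne_of_mem_erase hl)]
    simp only [h, Function.update_self, aug]
    ring
  | d_one h => rfl
  | d_comp hn hm hp hm' h₁ h₂ x y =>
    simp only [aug, aug_sum, aug_sgn, zero_mul, _root_.zero_add]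
    refine (Finset.sum_eq_zero fun j _ => ?_).symm
    rw [Finset.prod_eq_zero (Finset.mem_univ j) (aug_diffAt y j), mul_zero, mul_zero]
  | one_comp hn hk y =>
    change 1 * ∏ _j : Fin 1, aug y = aug y
    simp
  | comp_one hn hk x => simp [aug]
  | @assoc r s n i a c p e m q b u hs he ha hb hn hm hn' hm' x y z =>
    simp only [aug_sgn, aug]
    have h1 : ∏ t, aug (z ((blockEquiv hs).symm t).1 ((blockEquiv hs).symm t).2) =
        ∏ j, ∏ l, aug (z j l) := by
      rw [Equiv.prod_comp (blockEquiv hs).symm fun jl => aug (z jl.1 jl.2)]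
      exact Fintype.prod_sigma _
    rw [h1, Finset.prod_mul_distrib, mul_assoc]
    by_cases hq : ∀ j, q j = 0
    · have : assocExp q u = 0 := by simp [assocExp, hq]
      simp [this, ksign]
    · push Not at hq
      obtain ⟨j, hj⟩ := hq
      rw [Finset.prod_eq_zero (Finset.mem_univ j) (aug_of_ne (y j) hj)]
      simp
  | @comp_act_left r n i p m q hn hm σ hn' hm' x y =>
    simp only [aug_sgn, aug]
    rw [Equiv.prod_comp σ.symm fun j => aug (y j)]
    by_cases hq : ∀ j, q j = 0
    · have : permExp σ q = 0 := by simp [permExp, hq]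
      simp [this, ksign]
    · push Not at hq
      obtain ⟨j, hj⟩ := hq
      rw [Finset.prod_eq_zero (Finset.mem_univ j) (aug_of_ne (y j) hj)]
      simp
  | comp_act_right hn hm τ x y => simp [aug]

/-- Congruence of formal expressions, as a setoid. -/
def setoid (M : SModule) (n : ℕ+) (k : ℤ) : Setoid (OpTerm M n k) where
  r := Rel
  iseqv := ⟨Rel.refl, Rel.symm, Rel.trans⟩

end OpTerm

/-- The elements of arity `n` and degree `k` of the free operad on `M`. -/
def FreeEl (M : SModule) (n : ℕ+) (k : ℤ) : Type := Quotient (OpTerm.setoid M n k)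

namespace FreeEl

variable {M : SModule}

/-- The class of a formal expression. -/
def mk {n : ℕ+} {k : ℤ} (t : OpTerm M n k) : FreeEl M n k := Quotient.mk (OpTerm.setoid M n k) t

lemma mk_surjective {n : ℕ+} {k : ℤ} (x : FreeEl M n k) : ∃ t, mk t = x := Quotient.exists_rep x

lemma mk_eq {n : ℕ+} {k : ℤ} {s t : OpTerm M n k} (h : OpTerm.Rel s t) : mk s = mk t :=
  Quotient.sound (s := OpTerm.setoid M n k) h

lemma rel_of_mk_eq {n : ℕ+} {k : ℤ} {s t : OpTerm M n k} (h : mk s = mk t) : OpTerm.Rel s t :=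
  Quotient.exact (s := OpTerm.setoid M n k) h

instance (n : ℕ+) (k : ℤ) : Zero (FreeEl M n k) := ⟨mk .zero⟩

instance (n : ℕ+) (k : ℤ) : Neg (FreeEl M n k) :=
  ⟨Quotient.lift (fun t => mk t.neg) fun _ _ h => mk_eq (.neg_congr h)⟩

instance (n : ℕ+) (k : ℤ) : Add (FreeEl M n k) :=
  ⟨Quotient.lift₂ (fun s t => mk (s.add t)) fun _ _ _ _ h h' => mk_eq (.add_congr h h')⟩

instance (n : ℕ+) (k : ℤ) : AddCommGroup (FreeEl M n k) where
  add_assoc a b c := by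
    obtain ⟨a, rfl⟩ := mk_surjective a
    obtain ⟨b, rfl⟩ := mk_surjective b
    obtain ⟨c, rfl⟩ := mk_surjective c
    exact mk_eq (.add_assoc a b c)
  zero_add a := by
    obtain ⟨a, rfl⟩ := mk_surjective a
    exact mk_eq (.zero_add a)
  add_zero a := by
    obtain ⟨a, rfl⟩ := mk_surjective a
    exact mk_eq ((OpTerm.Rel.add_comm a .zero).trans (.zero_add a))
  nsmul := nsmulRec
  zsmul := zsmulRec
  neg_add_cancel a := by
    obtain ⟨a, rfl⟩ := mk_surjective a
    exact mk_eq (.neg_add a)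
  add_comm a b := by
    obtain ⟨a, rfl⟩ := mk_surjective a
    obtain ⟨b, rfl⟩ := mk_surjective b
    exact mk_eq (.add_comm a b)

lemma mk_add {n : ℕ+} {k : ℤ} (s t : OpTerm M n k) : mk (s.add t) = mk s + mk t := rfl

lemma mk_zero {n : ℕ+} {k : ℤ} : mk (.zero : OpTerm M n k) = 0 := rfl

lemma mk_neg {n : ℕ+} {k : ℤ} (t : OpTerm M n k) : mk t.neg = -mk t := rfl

lemma mk_sgn {n : ℕ+} {k : ℤ} (e : ℤ) (t : OpTerm M n k) :
    mk (OpTerm.sgn e t) = ksign e • mk t := by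
  unfold OpTerm.sgn ksign
  split_ifs with h
  · simp [Int.negOnePow_even e h]
  · simp [Int.negOnePow_odd e (Int.not_even_iff_odd.1 h), mk_neg]

lemma mk_sum {n : ℕ+} {k : ℤ} {r : ℕ} (t : Fin r → OpTerm M n k) :
    mk (OpTerm.sum t) = ∑ j, mk (t j) := by
  rw [← List.sum_ofFn, ← Function.comp_def mk t, ← List.map_ofFn]
  unfold OpTerm.sum
  induction List.ofFn t with
  | nil => rfl
  | cons a l ih => simp [mk_add, ih]

/-- The differential of the free operad. -/
def d {n : ℕ+} {k l : ℤ} (h : l + 1 = k) : FreeEl M n k →+ FreeEl M n l :=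
  AddMonoidHom.mk' (Quotient.lift (fun t => mk (t.d h)) fun _ _ hr => mk_eq (.d_congr h hr))
    fun a b => by
      obtain ⟨a, rfl⟩ := mk_surjective a
      obtain ⟨b, rfl⟩ := mk_surjective b
      exact mk_eq (.d_add h a b)

/-- The actions on the free operad. -/
def act {n : ℕ+} {k : ℤ} (σ : Equiv.Perm (Fin n)) : FreeEl M n k →+ FreeEl M n k :=
  AddMonoidHom.mk' (Quotient.lift (fun t => mk (t.act σ)) fun _ _ hr => mk_eq (.act_congr σ hr))
    fun a b => by
      obtain ⟨a, rfl⟩ := mk_surjective a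
      obtain ⟨b, rfl⟩ := mk_surjective b
      exact mk_eq (.act_add σ a b)

/-- The augmentation of the free operad. -/
def aug {n : ℕ+} {k : ℤ} : FreeEl M n k →+ ℤ :=
  AddMonoidHom.mk' (Quotient.lift OpTerm.aug fun _ _ h => h.aug_eq) fun a b => by
    obtain ⟨a, rfl⟩ := mk_surjective a
    obtain ⟨b, rfl⟩ := mk_surjective b
    rfl

/-- The inclusion of the generators. -/
def ι {n : ℕ+} {k : ℤ} : M.El n k →+ FreeEl M n k :=
  AddMonoidHom.mk' (fun x => mk (.gen x)) fun x y => mk_eq (.gen_add x y)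

/-- The composition of the free operad. -/
noncomputable def comp {r n : ℕ+} {i : Fin r → ℕ+} {p m : ℤ} {q : Fin r → ℤ}
    (hn : ∑ j, (i j : ℕ) = n) (hm : p + ∑ j, q j = m)
    (x : FreeEl M r p) (y : ∀ j, FreeEl M (i j) (q j)) : FreeEl M n m :=
  mk (.comp hn hm (mk_surjective x).choose fun j => (mk_surjective (y j)).choose)

lemma mk_comp {r n : ℕ+} {i : Fin r → ℕ+} {p m : ℤ} {q : Fin r → ℤ}
    (hn : ∑ j, (i j : ℕ) = n) (hm : p + ∑ j, q j = m)
    (x : OpTerm M r p) (y : ∀ j, OpTerm M (i j) (q j)) :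
    comp hn hm (mk x) (fun j => mk (y j)) = mk (.comp hn hm x y) :=
  mk_eq (.comp_congr hn hm (rel_of_mk_eq (mk_surjective (mk x)).choose_spec)
    fun j => rel_of_mk_eq (mk_surjective (mk (y j))).choose_spec)

lemma exists_mk {r : ℕ} {i : Fin r → ℕ+} {q : Fin r → ℤ} (y : ∀ j, FreeEl M (i j) (q j)) :
    ∃ y' : ∀ j, OpTerm M (i j) (q j), y = fun j => mk (y' j) := by
  choose y' h using fun j => mk_surjective (y j)
  exact ⟨y', funext fun j => (h j).symm⟩

lemma update_mk {r : ℕ} {i : Fin r → ℕ+} {q : Fin r → ℤ} (y : ∀ j, OpTerm M (i j) (q j))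
    (j : Fin r) (a : OpTerm M (i j) (q j)) :
    Function.update (fun l => mk (y l)) j (mk a) = fun l => mk (Function.update y j a l) := by
  funext l
  by_cases h : l = j
  · subst h; simp
  · simp [h]

end FreeEl

/-- The DGA-modules `F(M)(n)`; the coaugmentation is that of `M`. -/
def freeObj (M : SModule) (n : ℕ+) : DGAModule where
  X k := FreeEl M n k
  d h := FreeEl.d h
  d_d h h' x := by
    obtain ⟨x, rfl⟩ := FreeEl.mk_surjective x
    exact FreeEl.mk_eq (.d_d h h' x)
  aug _ := FreeEl.aug
  aug_of_ne k x hk := by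
    obtain ⟨x, rfl⟩ := FreeEl.mk_surjective x
    exact x.aug_of_ne hk
  aug_d h x := by
    obtain ⟨x, rfl⟩ := FreeEl.mk_surjective x
    rfl
  coaug := FreeEl.ι.comp (M.obj n).coaug
  d_coaug h a := by
    have h1 : FreeEl.ι (M.d h ((M.obj n).coaug a)) =
        FreeEl.d h (FreeEl.ι ((M.obj n).coaug a)) := FreeEl.mk_eq (.gen_d h _)
    rw [(M.obj n).d_coaug, map_zero] at h1
    exact h1.symm
  aug_coaug a := (M.obj n).aug_coaug a

/-- The data of the free operad. -/
noncomputable def freePre (M : SModule) : PreOperad where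
  obj := freeObj M
  act σ := FreeEl.act σ
  act_one x := by
    obtain ⟨x, rfl⟩ := FreeEl.mk_surjective x
    exact FreeEl.mk_eq (.act_one x)
  act_mul σ τ x := by
    obtain ⟨x, rfl⟩ := FreeEl.mk_surjective x
    exact FreeEl.mk_eq (.act_mul σ τ x)
  act_d h σ x := by
    obtain ⟨x, rfl⟩ := FreeEl.mk_surjective x
    exact FreeEl.mk_eq (.act_d h σ x)
  aug_act σ x := by
    obtain ⟨x, rfl⟩ := FreeEl.mk_surjective x
    rfl
  one := FreeEl.mk .one
  comp := FreeEl.comp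

/-- The free operad `F(M)` on an `𝕊`-module `M`, presented by generators and relations. -/
noncomputable def freeOperad (M : SModule) : Operad where
  toPreOperad := freePre M
  isOperad := by
    refine ⟨?_, ?_, ?_, ?_, ?_, ?_, ?_, ?_, ?_, ?_, ?_⟩
    · intro r n i p m q hn hm x x' y
      obtain ⟨x, rfl⟩ := FreeEl.mk_surjective x
      obtain ⟨x', rfl⟩ := FreeEl.mk_surjective x'
      obtain ⟨y, rfl⟩ := FreeEl.exists_mk y
      change FreeEl.comp hn hm (FreeEl.mk (x.add x')) _ =
        FreeEl.comp hn hm _ _ + FreeEl.comp hn hm _ _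
      rw [FreeEl.mk_comp, FreeEl.mk_comp, FreeEl.mk_comp]
      exact FreeEl.mk_eq (.comp_add_left hn hm x x' y)
    · intro r n i p m q hn hm x y j a b
      obtain ⟨x, rfl⟩ := FreeEl.mk_surjective x
      obtain ⟨y, rfl⟩ := FreeEl.exists_mk y
      obtain ⟨a, rfl⟩ := FreeEl.mk_surjective a
      obtain ⟨b, rfl⟩ := FreeEl.mk_surjective b
      have h : ∀ c, FreeEl.comp hn hm (FreeEl.mk x)
          (Function.update (fun l => FreeEl.mk (y l)) j (FreeEl.mk c)) =
          FreeEl.mk (.comp hn hm x (Function.update y j c)) := fun c => by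
        rw [FreeEl.update_mk, FreeEl.mk_comp]
      refine (h (a.add b)).trans ((FreeEl.mk_eq (.comp_add_right hn hm x y j a b)).trans ?_)
      exact (congrArg₂ (· + ·) (h a) (h b)).symm
    · intro l h
      exact FreeEl.mk_eq (.d_one h)
    · intro r n i p p' m m' q hn hm hp hm' h₁ h₂ x y
      obtain ⟨x, rfl⟩ := FreeEl.mk_surjective x
      obtain ⟨y, rfl⟩ := FreeEl.exists_mk y
      have hD : ∀ j, diffAt (FreeEl M) (fun h => FreeEl.d h) (fun l => FreeEl.mk (y l)) j =
          fun l => FreeEl.mk (diffAt (OpTerm M) OpTerm.d y j l) := fun j =>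
        funext fun l => (map_diffAt (X := OpTerm M) (Y := FreeEl M)
          (fun _ _ x => FreeEl.mk x) OpTerm.d (fun h => FreeEl.d h) (fun _ _ => rfl) y j l).symm
      change FreeEl.d hm' (FreeEl.comp hn hm (FreeEl.mk x) (fun l => FreeEl.mk (y l))) =
        FreeEl.comp hn h₁ (FreeEl.mk (x.d hp)) (fun l => FreeEl.mk (y l)) +
          ∑ j, ksign (p + ∑ l with l < j, q l) • FreeEl.comp hn (h₂ j) (FreeEl.mk x)
            (diffAt (FreeEl M) (fun h => FreeEl.d h) (fun l => FreeEl.mk (y l)) j)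
      simp only [hD, FreeEl.mk_comp]
      refine (FreeEl.mk_eq (.d_comp hn hm hp hm' h₁ h₂ x y)).trans ?_
      rw [FreeEl.mk_add, FreeEl.mk_sum]
      simp only [FreeEl.mk_sgn]
    · rfl
    · intro r n i p m q hn hm x y
      obtain ⟨x, rfl⟩ := FreeEl.mk_surjective x
      obtain ⟨y, rfl⟩ := FreeEl.exists_mk y
      change FreeEl.aug (FreeEl.comp hn hm _ _) = _
      rw [FreeEl.mk_comp]; rfl
    · intro n k hn hk y
      obtain ⟨y, rfl⟩ := FreeEl.mk_surjective y
      exact (FreeEl.mk_comp hn hk .one fun _ => y).trans (FreeEl.mk_eq (.one_comp hn hk y))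
    · intro n k hn hk x
      obtain ⟨x, rfl⟩ := FreeEl.mk_surjective x
      exact (FreeEl.mk_comp hn hk x fun _ => .one).trans (FreeEl.mk_eq (.comp_one hn hk x))
    · intro r s n i a c p e m q b u hs he ha hb hn hm hn' hm' x y z
      obtain ⟨x, rfl⟩ := FreeEl.mk_surjective x
      obtain ⟨y, rfl⟩ := FreeEl.exists_mk y
      choose z' hz using fun j => FreeEl.exists_mk (z j)
      obtain rfl : z = fun j l => FreeEl.mk (z' j l) := funext hz
      change FreeEl.comp hn' hm' (FreeEl.comp hs he _ _) (fun t => FreeEl.mk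
          (z' ((blockEquiv hs).symm t).1 ((blockEquiv hs).symm t).2)) =
        ksign (assocExp q u) • FreeEl.comp hn hm _ (fun j => FreeEl.comp (ha j) (hb j) _ _)
      simp only [FreeEl.mk_comp]
      rw [← FreeEl.mk_sgn]
      exact FreeEl.mk_eq (.assoc hs he ha hb hn hm hn' hm' x y z')
    · intro r n i p m q hn hm σ hn' hm' x y
      obtain ⟨x, rfl⟩ := FreeEl.mk_surjective x
      obtain ⟨y, rfl⟩ := FreeEl.exists_mk y
      change FreeEl.comp hn hm (FreeEl.mk (x.act σ)) (fun j => FreeEl.mk (y j)) =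
        ksign (permExp σ q) • FreeEl.act (blockPerm hn σ)
          (FreeEl.comp hn' hm' (FreeEl.mk x) (fun j => FreeEl.mk (y (σ.symm j))))
      rw [FreeEl.mk_comp, FreeEl.mk_comp hn' hm' x fun j => y (σ.symm j)]
      change _ = ksign (permExp σ q) • FreeEl.mk _
      rw [← FreeEl.mk_sgn]
      exact FreeEl.mk_eq (.comp_act_left hn hm σ hn' hm' x y)
    · intro r n i p m q hn hm τ x y
      obtain ⟨x, rfl⟩ := FreeEl.mk_surjective x
      obtain ⟨y, rfl⟩ := FreeEl.exists_mk y
      change FreeEl.comp hn hm (FreeEl.mk x) (fun j => FreeEl.mk ((y j).act (τ j))) =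
        FreeEl.act (sumPerm hn τ) (FreeEl.comp hn hm (FreeEl.mk x) (fun j => FreeEl.mk (y j)))
      rw [FreeEl.mk_comp hn hm x y, FreeEl.mk_comp hn hm x fun j => (y j).act (τ j)]
      exact FreeEl.mk_eq (.comp_act_right hn hm τ x y)

/-! ### The normalized bar resolution -/

namespace Bar

section Raw

variable {G : Type}

/-- The boundary `∑ (-1)^a (w₀, …, ŵ_a, …, w_m)` of a sequence, as a combination of sequences. -/
noncomputable def rawD (w : List G) : List G →₀ ℤ :=
  ∑ a ∈ Finset.range w.length, (-1 : ℤ) ^ a • Finsupp.single (w.eraseIdx a) 1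

/-- Prepending an entry. -/
noncomputable def cone (g : G) : (List G →₀ ℤ) →ₗ[ℤ] (List G →₀ ℤ) :=
  Finsupp.lmapDomain ℤ ℤ (List.cons g)

/-- The linear extension of `rawD`. -/
noncomputable def rawDL : (List G →₀ ℤ) →ₗ[ℤ] (List G →₀ ℤ) := Finsupp.linearCombination ℤ rawD

lemma rawDL_single (w : List G) : rawDL (Finsupp.single w 1) = rawD w := by
  simp [rawDL]

lemma cone_single (g : G) (w : List G) :
    cone g (Finsupp.single w 1) = Finsupp.single (g :: w) 1 := by
  simp [cone, Finsupp.lmapDomain_apply]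

lemma rawD_nil : rawD ([] : List G) = 0 := by simp [rawD]

lemma rawD_cons (g : G) (w : List G) :
    rawD (g :: w) = Finsupp.single w 1 - cone g (rawD w) := by
  unfold rawD
  rw [List.length_cons, Finset.sum_range_succ', map_sum, sub_eq_add_neg, ← Finset.sum_neg_distrib,
    add_comm]
  congr 1
  · simp
  · refine Finset.sum_congr rfl fun a _ => ?_
    rw [List.eraseIdx_cons_succ, map_zsmul, cone_single, pow_succ]
    simp

lemma rawDL_cone (g : G) (c : List G →₀ ℤ) : rawDL (cone g c) = c - cone g (rawDL c) := by
  induction c using Finsupp.induction_linear with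
  | zero => simp
  | add a b ha hb => rw [map_add, map_add, ha, hb, map_add, map_add]; abel
  | single w a =>
    have : (Finsupp.single w a : List G →₀ ℤ) = a • Finsupp.single w 1 := by simp
    rw [this, map_zsmul, map_zsmul, map_zsmul, map_zsmul, cone_single, rawDL_single, rawDL_single,
      rawD_cons, smul_sub]

lemma rawDL_rawD (w : List G) : rawDL (rawD w) = 0 := by
  induction w with
  | nil => rw [rawD_nil, map_zero]
  | cons g w ih =>
    rw [rawD_cons, map_sub, rawDL_cone, rawDL_single, ih, map_zero, sub_zero, sub_self]

/-- The combinations of degenerate sequences. -/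
noncomputable def degen (G : Type) : Submodule ℤ (List G →₀ ℤ) :=
  Submodule.span ℤ {c | ∃ w : List G, ¬ w.IsChain (· ≠ ·) ∧ c = Finsupp.single w 1}

lemma single_mem_degen {w : List G} (h : ¬ w.IsChain (· ≠ ·)) :
    Finsupp.single w 1 ∈ degen G := Submodule.subset_span ⟨w, h, rfl⟩

lemma not_chain_cons {g : G} {w : List G} (h : ¬ w.IsChain (· ≠ ·)) :
    ¬ (g :: w).IsChain (· ≠ ·) := fun h' => h h'.tail

lemma cone_mem_degen (g : G) {c : List G →₀ ℤ} (hc : c ∈ degen G) : cone g c ∈ degen G := by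
  induction hc using Submodule.span_induction with
  | mem c hc =>
    obtain ⟨w, hw, rfl⟩ := hc
    rw [cone_single]
    exact single_mem_degen (not_chain_cons hw)
  | zero => rw [map_zero]; exact Submodule.zero_mem _
  | add a b _ _ ha hb => rw [map_add]; exact Submodule.add_mem _ ha hb
  | smul n a _ ha => rw [map_smul]; exact Submodule.smul_mem _ _ ha

lemma cone_cone_mem_degen (g : G) (c : List G →₀ ℤ) : cone g (cone g c) ∈ degen G := by
  induction c using Finsupp.induction_linear with
  | zero => simp
  | add a b ha hb => rw [map_add, map_add]; exact Submodule.add_mem _ ha hb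
  | single w a =>
    have : (Finsupp.single w a : List G →₀ ℤ) = a • Finsupp.single w 1 := by simp
    rw [this, map_zsmul, map_zsmul, cone_single, cone_single]
    refine Submodule.smul_mem _ _ (single_mem_degen fun h => ?_)
    rw [List.isChain_cons_cons] at h
    exact h.1 rfl

lemma rawD_mem_degen {w : List G} (h : ¬ w.IsChain (· ≠ ·)) : rawD w ∈ degen G := by
  induction w with
  | nil => exact absurd .nil h
  | cons g w ih =>
    by_cases hw : w.IsChain (· ≠ ·)
    · cases w with
      | nil => exact absurd (.singleton _) h
      | cons g' w =>
        obtain rfl : g = g' := by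
          by_contra hg
          exact h (List.isChain_cons_cons.2 ⟨hg, hw⟩)
        rw [rawD_cons, rawD_cons, map_sub, cone_single, sub_sub_cancel]
        exact cone_cone_mem_degen _ _
    · rw [rawD_cons]
      exact Submodule.sub_mem _ (single_mem_degen hw) (cone_mem_degen _ (ih hw))

end Raw

/-- The `ℤ`-basis of the normalized bar resolution `RΣ_n` in degree `k`: sequences
`(w₀, …, w_k)` in `Σ_n` with distinct neighbours. The bar symbol `σ[σ₁/…/σ_k]` is the sequence
`(σ, σσ₁, σσ₁σ₂, …, σσ₁⋯σ_k)`; it is degenerate, that is zero, if some `σ_j` is `1`. -/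
abbrev Basis (n : ℕ+) (k : ℤ) : Type :=
  {w : List (Equiv.Perm (Fin n)) // w ≠ [] ∧ (w.length : ℤ) = k + 1 ∧ w.IsChain (· ≠ ·)}

/-- The group `(RΣ_n)_k`. -/
abbrev Chain (n : ℕ+) (k : ℤ) : Type := Basis n k →₀ ℤ

open Classical in
/-- The element of `(RΣ_n)_k` given by a sequence of length `k + 1`, which is zero for degenerate
sequences. -/
noncomputable def simplex (n : ℕ+) (k : ℤ) (w : List (Equiv.Perm (Fin n))) : Chain n k :=
  if h : w ≠ [] ∧ (w.length : ℤ) = k + 1 ∧ w.IsChain (· ≠ ·) then Finsupp.single ⟨w, h⟩ 1 else 0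

/-- The bar symbol `σ[σ₁/…/σ_k]`. -/
noncomputable def symbol (n : ℕ+) (k : ℤ) (σ : Equiv.Perm (Fin n))
    (l : List (Equiv.Perm (Fin n))) : Chain n k :=
  simplex n k (l.scanl (· * ·) σ)

/-- The differential of `RΣ_n`: the alternating sum of the faces that omit one entry. -/
noncomputable def d {n : ℕ+} {k l : ℤ} (_h : l + 1 = k) : Chain n k →+ Chain n l :=
  (Finsupp.linearCombination ℤ fun w : Basis n k =>
    ∑ a ∈ Finset.range w.1.length, (-1 : ℤ) ^ a • simplex n l (w.1.eraseIdx a)).toAddMonoidHom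

/-- The augmentation: every basis element of degree `0` goes to `1`. -/
noncomputable def aug {n : ℕ+} (k : ℤ) : Chain n k →+ ℤ :=
  (Finsupp.linearCombination ℤ fun _ : Basis n k => if k = 0 then (1 : ℤ) else 0).toAddMonoidHom

/-- Left multiplication of all entries, `σ[σ₁/…/σ_k] ↦ (gσ)[σ₁/…/σ_k]`. -/
def Basis.lmul {n : ℕ+} {k : ℤ} (g : Equiv.Perm (Fin n)) (w : Basis n k) : Basis n k :=
  ⟨w.1.map (g * ·), by
    obtain ⟨w, h1, h2, h3⟩ := w
    refine ⟨by simpa using h1, by simpa using h2, ?_⟩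
    rw [List.isChain_map]
    simpa using h3⟩

/-- The right action `x · τ = τ⁻¹ x` of `Σ_n` on `RΣ_n`. -/
noncomputable def act {n : ℕ+} {k : ℤ} (τ : Equiv.Perm (Fin n)) : Chain n k →+ Chain n k :=
  Finsupp.mapDomain.addMonoidHom (Basis.lmul τ⁻¹)

/-- The normalization map from combinations of sequences. -/
noncomputable def proj (n : ℕ+) (l : ℤ) : (List (Equiv.Perm (Fin n)) →₀ ℤ) →ₗ[ℤ] Chain n l :=
  Finsupp.linearCombination ℤ (simplex n l)

lemma proj_single (n : ℕ+) (l : ℤ) (w : List (Equiv.Perm (Fin n))) :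
    proj n l (Finsupp.single w 1) = simplex n l w := by simp [proj]

lemma proj_degen {n : ℕ+} {l : ℤ} {c : List (Equiv.Perm (Fin n)) →₀ ℤ} (hc : c ∈ degen _) :
    proj n l c = 0 := by
  induction hc using Submodule.span_induction with
  | mem c hc =>
    obtain ⟨w, hw, rfl⟩ := hc
    rw [proj_single, simplex, dif_neg fun h => hw h.2.2]
  | zero => exact map_zero _
  | add a b _ _ ha hb => rw [map_add, ha, hb, add_zero]
  | smul n a _ ha => rw [map_smul, ha, smul_zero]

lemma d_basis {n : ℕ+} {k l : ℤ} (h : l + 1 = k) (w : Basis n k) :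
    d h (Finsupp.single w 1) = proj n l (rawD w.1) := by
  rw [rawD]
  simp only [map_sum, map_zsmul, proj_single]
  simp [d]

lemma d_simplex {n : ℕ+} {k l : ℤ} (h : l + 1 = k) (w : List (Equiv.Perm (Fin n)))
    (hw : (w.length : ℤ) = k + 1) : d h (simplex n k w) = proj n l (rawD w) := by
  unfold simplex
  split_ifs with h1
  · exact d_basis h ⟨w, h1⟩
  · rw [map_zero]
    by_cases h2 : w = []
    · rw [h2, rawD_nil, map_zero]
    · exact (proj_degen (rawD_mem_degen fun h3 => h1 ⟨h2, hw, h3⟩)).symm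

lemma hom_ext {n : ℕ+} {k : ℤ} {A : Type} [AddCommGroup A] {f g : Chain n k →+ A}
    (h : ∀ w, f (Finsupp.single w 1) = g (Finsupp.single w 1)) (x : Chain n k) : f x = g x := by
  induction x using Finsupp.induction_linear with
  | zero => rw [map_zero, map_zero]
  | add a b ha hb => rw [map_add, map_add, ha, hb]
  | single w a =>
    have : (Finsupp.single w a : Chain n k) = a • Finsupp.single w 1 := by simp
    rw [this, map_zsmul, map_zsmul, h]

lemma d_proj_rawD {n : ℕ+} {k l m : ℤ} (h : l + 1 = k) (h' : m + 1 = l)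
    (w : List (Equiv.Perm (Fin n))) (hw : (w.length : ℤ) = k + 1) :
    d h' (proj n l (rawD w)) = proj n m (rawDL (rawD w)) := by
  conv_lhs => rw [rawD]
  conv_rhs => arg 2; rw [rawD]
  simp only [map_sum, map_zsmul, proj_single, rawDL_single]
  refine Finset.sum_congr rfl fun a ha => ?_
  rw [d_simplex h']
  have ha := Finset.mem_range.1 ha
  rw [List.length_eraseIdx_of_lt ha]
  omega

lemma d_d {n : ℕ+} {k l m : ℤ} (h : l + 1 = k) (h' : m + 1 = l) (x : Chain n k) :
    d h' (d h x) = 0 :=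
  hom_ext (f := (d h').comp (d h)) (g := 0) (fun w => by
    change d h' (d h _) = 0
    rw [d_basis, d_proj_rawD h h' w.1 w.2.2.1, rawDL_rawD, map_zero]) x

lemma aug_simplex {n : ℕ+} (w : List (Equiv.Perm (Fin n))) (hw : w.length = 1) :
    aug 0 (simplex n 0 w) = 1 := by
  obtain ⟨g, rfl⟩ := List.length_eq_one_iff.1 hw
  rw [simplex, dif_pos ⟨by simp, by simp, .singleton g⟩]
  rw [aug, LinearMap.toAddMonoidHom_coe, Finsupp.linearCombination_single]
  simp

lemma aug_of_ne {n : ℕ+} {k : ℤ} (hk : k ≠ 0) (x : Chain n k) : aug k x = 0 := by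
  simp [aug, hk, Finsupp.linearCombination_apply, Finsupp.sum]

lemma aug_d {n : ℕ+} {k l : ℤ} (h : l + 1 = k) (x : Chain n k) : aug l (d h x) = 0 := by
  by_cases hl : l = 0
  · subst hl
    refine hom_ext (f := (aug 0).comp (d h)) (g := 0) (fun w => ?_) x
    change aug 0 (d h _) = 0
    have hw : w.1.length = 2 := by have := w.2.2.1; omega
    rw [d_basis, rawD, hw]
    simp only [map_sum, map_zsmul, proj_single]
    rw [Finset.sum_range_succ, Finset.sum_range_one, aug_simplex, aug_simplex]
    · simp
    all_goals rw [List.length_eraseIdx_of_lt (by omega)]; omega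
  · exact aug_of_ne hl _

lemma act_basis {n : ℕ+} {k : ℤ} (τ : Equiv.Perm (Fin n)) (w : Basis n k) :
    act τ (Finsupp.single w 1) = Finsupp.single (w.lmul τ⁻¹) 1 := by
  simp [act]

lemma act_simplex {n : ℕ+} {k : ℤ} (τ : Equiv.Perm (Fin n)) (w : List (Equiv.Perm (Fin n))) :
    act τ (simplex n k w) = simplex n k (w.map (τ⁻¹ * ·)) := by
  have hiff : (w ≠ [] ∧ (w.length : ℤ) = k + 1 ∧ w.IsChain (· ≠ ·)) ↔
      (w.map (τ⁻¹ * ·) ≠ [] ∧ ((w.map (τ⁻¹ * ·)).length : ℤ) = k + 1 ∧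
        (w.map (τ⁻¹ * ·)).IsChain (· ≠ ·)) := by
    rw [List.isChain_map]
    simp
  unfold simplex
  by_cases h : w ≠ [] ∧ (w.length : ℤ) = k + 1 ∧ w.IsChain (· ≠ ·)
  · rw [dif_pos h, dif_pos (hiff.1 h), act_basis]; rfl
  · rw [dif_neg h, dif_neg fun h' => h (hiff.2 h'), map_zero]

lemma act_d {n : ℕ+} {k l : ℤ} (h : l + 1 = k) (τ : Equiv.Perm (Fin n)) (x : Chain n k) :
    act τ (d h x) = d h (act τ x) := by
  refine hom_ext (f := (act τ).comp (d h)) (g := (d h).comp (act τ)) (fun w => ?_) x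
  change act τ (d h _) = d h (act τ _)
  rw [act_basis, d_basis, d_basis, rawD, rawD]
  simp only [map_sum, map_zsmul, proj_single, act_simplex, Basis.lmul, List.length_map,
    List.eraseIdx_map]

lemma aug_act {n : ℕ+} {k : ℤ} (τ : Equiv.Perm (Fin n)) (x : Chain n k) :
    aug k (act τ x) = aug k x := by
  refine hom_ext (f := (aug k).comp (act τ)) (g := aug k) (fun w => ?_) x
  change aug k (act τ _) = _
  rw [act_basis]
  simp [aug]

lemma eraseIdx_scanl {G : Type} [Monoid G] (g : G) (w : List G) (a : ℕ) (ha : a + 1 < w.length) :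
    (w.scanl (· * ·) g).eraseIdx (a + 1) =
      (w.take a ++ (w.getD a 1 * w.getD (a + 1) 1) :: w.drop (a + 2)).scanl (· * ·) g := by
  induction a generalizing g w with
  | zero =>
    match w, ha with
    | x :: y :: w, _ => simp [List.scanl_cons, mul_assoc]
  | succ a ih =>
    match w, ha with
    | x :: w, ha =>
      have := ih (g * x) w (by simpa using ha)
      simpa [List.scanl_cons] using this

lemma eraseIdx_scanl_length {G : Type} [Monoid G] (g : G) (w : List G) (hw : w ≠ []) :
    (w.scanl (· * ·) g).eraseIdx w.length = w.dropLast.scanl (· * ·) g := by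
  induction w generalizing g with
  | nil => exact absurd rfl hw
  | cons x w ih =>
    cases w with
    | nil => simp [List.scanl_cons]
    | cons y w =>
      have := ih (g * x) (by simp)
      simpa [List.scanl_cons] using this

/-- The boundary of a bar symbol: `∂₀ σ[σ₁/…/σ_m] = σσ₁[σ₂/…/σ_m]`, `∂_m` omits `σ_m`, and
`∂_a σ[σ₁/…/σ_m] = σ[σ₁/…/σ_aσ_{a+1}/…/σ_m]` for `0 < a < m`. -/
lemma d_symbol {n : ℕ+} {k l : ℤ} (h : l + 1 = k) (σ τ : Equiv.Perm (Fin n))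
    (w : List (Equiv.Perm (Fin n))) (hw : (w.length : ℤ) + 1 = k) :
    d h (symbol n k σ (τ :: w)) = symbol n l (σ * τ) w +
      ∑ a ∈ Finset.range w.length, (-1 : ℤ) ^ (a + 1) • symbol n l σ
        ((τ :: w).take a ++ ((τ :: w).getD a 1 * (τ :: w).getD (a + 1) 1) ::
          (τ :: w).drop (a + 2)) +
      (-1 : ℤ) ^ (w.length + 1) • symbol n l σ ((τ :: w).dropLast) := by
  have hk : ((τ :: w).length : ℤ) = k := by simpa using hw
  rw [symbol, d_simplex h _ (by rw [List.length_scanl]; push_cast; rw [hk]), rawD,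
    List.length_scanl, List.length_cons, Finset.sum_range_succ, Finset.sum_range_succ',
    map_add, map_add, add_comm (proj n l (∑ _ ∈ _, _))]
  simp only [map_sum, map_zsmul, proj_single]
  congr 1
  · congr 1
    · simp [symbol, List.scanl_cons]
    · refine Finset.sum_congr rfl fun a ha => ?_
      rw [eraseIdx_scanl _ _ _ (by simpa using ha)]
      rfl
  · rw [← List.length_cons (a := τ), eraseIdx_scanl_length _ _ (by simp)]
    rfl

end Bar
/-- The DGA-module `RΣ_n`, the normalized `Σ_n`-free bar resolution of `ℤ`, with coaugmentation
`1 ↦ [ ]`. -/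
noncomputable def barObj (n : ℕ+) : DGAModule where
  X k := Bar.Chain n k
  d h := Bar.d h
  d_d h h' x := Bar.d_d h h' x
  aug k := Bar.aug k
  aug_of_ne _ x hk := Bar.aug_of_ne hk x
  aug_d h x := Bar.aug_d h x
  coaug := zmultiplesHom _ (Bar.symbol n 0 1 [])
  d_coaug := by
    intro l h a
    have h0 : Bar.d h (Bar.symbol n 0 1 []) = 0 := by
      have : l = -1 := by omega
      subst this
      rw [Bar.symbol, Bar.d_simplex h _ (by simp)]
      simp [Bar.rawD, Bar.proj, Bar.simplex]
    change Bar.d h (a • Bar.symbol n 0 1 []) = 0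
    rw [map_zsmul, h0, smul_zero]
  aug_coaug a := by
    change Bar.aug 0 (a • Bar.symbol n 0 1 []) = a
    rw [map_zsmul, Bar.symbol, Bar.aug_simplex _ (by simp)]
    simp

/-- The `𝕊`-module `S` with `S(n) = RΣ_n`. -/
noncomputable def barModule : SModule where
  obj := barObj
  act σ := Bar.act σ
  act_one x := by
    refine Bar.hom_ext (f := Bar.act 1) (g := AddMonoidHom.id _) (fun w => ?_) x
    rw [Bar.act_basis]
    simp [Bar.Basis.lmul]
  act_mul σ τ x := by
    refine Bar.hom_ext (f := Bar.act (σ * τ)) (g := (Bar.act τ).comp (Bar.act σ)) (fun w => ?_) x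
    change _ = Bar.act τ (Bar.act σ _)
    rw [Bar.act_basis, Bar.act_basis, Bar.act_basis]
    simp [Bar.Basis.lmul, Function.comp_def, mul_assoc]
  act_d h σ x := Bar.act_d h σ x
  aug_act σ x := Bar.aug_act σ x

/-! ### Smith's operad `𝔖` -/

/-- The composition of permutations: if a permutation `w` of `n` letters is read as the word
`w(1) … w(n)`, then `permComp w v` is the word obtained from that of `w` by putting the word of
`v j`, shifted to the letters of the `j`-th block, in place of each letter `j`. -/
def permComp {r n : ℕ+} {i : Fin r → ℕ+} (hn : ∑ j, (i j : ℕ) = n) (w : Equiv.Perm (Fin r))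
    (v : ∀ j, Equiv.Perm (Fin (i j))) : Equiv.Perm (Fin n) :=
  (((blockEquiv (i := fun l => i (w l)) (sum_comp_perm hn w)).symm.trans
    (Equiv.sigmaCongrLeft (β := fun j => Fin (i j)) w)).trans
    (Equiv.sigmaCongrRight v)).trans (blockEquiv hn)

namespace Smith

/-- The number of steps in direction `c` among the first `t` steps of the lattice path `s`. -/
def count {N r : ℕ} (s : Fin N → Fin r) (c : Fin r) (t : ℕ) : ℕ :=
  (Finset.univ.filter fun u : Fin N => (u : ℕ) < t ∧ s u = c).card

/-- The number of inversions of `s`; its parity is the sign of the shuffle given by `s`. -/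
def inversions {N r : ℕ} (s : Fin N → Fin r) : ℕ :=
  (Finset.univ.filter fun u : Fin N × Fin N => u.1 < u.2 ∧ s u.2 < s u.1).card

/-- The composition of the basis elements `w` and `v₁, …, v_r`, of degrees `d₀` and
`d₁, …, d_r`: the Eilenberg–Zilber shuffle map, followed by the composition of permutations in
each vertex. The sum is over the shuffles, that is, over the lattice paths `s` with `d_c` steps in
each direction `c`; the `t`-th vertex of the resulting sequence composes the vertices of
`w, v₁, …, v_r` reached after `t` steps. -/
noncomputable def basisComp {r n : ℕ+} {i : Fin r → ℕ+} {p m : ℤ} {q : Fin r → ℤ}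
    (hn : ∑ j, (i j : ℕ) = n) (w : Bar.Basis r p) (v : ∀ j, Bar.Basis (i j) (q j)) :
    Bar.Chain n m :=
  let N : ℕ := m.toNat
  let deg : Fin ((r : ℕ) + 1) → ℕ := Fin.cons p.toNat fun j => (q j).toNat
  ∑ s : Fin N → Fin ((r : ℕ) + 1) with ∀ c, count s c N = deg c,
    (-1 : ℤ) ^ inversions s • Bar.simplex n m
      ((List.range (N + 1)).map fun t =>
        permComp hn (w.1.getD (count s 0 t) 1) fun j => (v j).1.getD (count s j.succ t) 1)

/-- The composition of `𝔖`: the multilinear extension of `basisComp`. -/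
noncomputable def comp {r n : ℕ+} {i : Fin r → ℕ+} {p m : ℤ} {q : Fin r → ℤ}
    (hn : ∑ j, (i j : ℕ) = n) (x : Bar.Chain r p) (y : ∀ j, Bar.Chain (i j) (q j)) :
    Bar.Chain n m :=
  ∑ w ∈ x.support, ∑ v ∈ Fintype.piFinset fun j => (y j).support,
    (x w * ∏ j, y j (v j)) • basisComp hn w v

end Smith

/-- Smith's operad `𝔖` (its underlying data): the `𝕊`-module `S`, the unit `[ ]` of arity `1` and
the shuffle compositions. -/
noncomputable def smithOperad : PreOperad where
  toSModule := barModule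
  one := Bar.symbol 1 0 1 []
  comp hn _ x y := Smith.comp hn x y

/-! ### The operad `𝓡` -/

/-- The generator `[ ]_n` of `F(S)`. -/
noncomputable def bracket (n : ℕ+) : (freeOperad barModule).El n 0 :=
  FreeEl.ι (M := barModule) (Bar.symbol n 0 1 [])

/-- The iterated compositions of the elements `[ ]_n`, including the empty one, the unit. -/
inductive IsBracketComposite : ∀ n : ℕ+, (freeOperad barModule).El n 0 → Prop
  | one : IsBracketComposite 1 (freeOperad barModule).one
  | bracket (n : ℕ+) : IsBracketComposite n (bracket n)
  | comp {r n : ℕ+} {i : Fin r → ℕ+} (hn : ∑ j, (i j : ℕ) = n)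
      (hm : (0 : ℤ) + ∑ _j : Fin r, (0 : ℤ) = 0)
      {x : (freeOperad barModule).El r 0} {y : ∀ j, (freeOperad barModule).El (i j) 0} :
      IsBracketComposite r x → (∀ j, IsBracketComposite (i j) (y j)) →
      IsBracketComposite n ((freeOperad barModule).comp (q := fun _ => 0) hn hm x y)

lemma IsBracketComposite.aug_eq_one {n : ℕ+} {x : (freeOperad barModule).El n 0}
    (h : IsBracketComposite n x) : (freeOperad barModule).aug x = 1 := by
  induction h with
  | one => exact (freeOperad barModule).isOperad.aug_one
  | bracket n => exact Bar.aug_simplex _ (by simp)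
  | comp hn hm _ _ hx hy => rw [(freeOperad barModule).isOperad.aug_comp, hx]; simp [hy]

/-- The generators `x - y` of the ideal `𝓙`, in degree `0`. -/
inductive IsJGenerator : ∀ (n : ℕ+) (k : ℤ), (freeOperad barModule).El n k → Prop
  | sub {n : ℕ+} {x y : (freeOperad barModule).El n 0} :
      IsBracketComposite n x → IsBracketComposite n y → IsJGenerator n 0 (x - y)

/-- The operadic ideal `𝓙` of `F(S)`. -/
noncomputable def idealJ : OperadicIdeal (freeOperad barModule).toPreOperad :=
  OperadicIdeal.span (freeOperad barModule) IsJGenerator fun _ _ _ h => by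
    obtain ⟨hx, hy⟩ := h
    rw [map_sub, hx.aug_eq_one, hy.aug_eq_one, sub_self]

/-- The operad `𝓡 = F(S)/𝓙`. -/
noncomputable def operadR : Operad := (freeOperad barModule).quotient idealJ

/-- The canonical map of `𝕊`-modules `S → 𝓡`. -/
noncomputable def toR {n : ℕ+} {k : ℤ} : barModule.El n k →+ operadR.El n k :=
  ((freeOperad barModule).toQuot idealJ).comp (FreeEl.ι (M := barModule))

/-- The identifications made by the compositions of `𝔖`: the differences between the class in `𝓡`
of a composition `γ(x; y₁, …, y_r)` taken in `𝔖` and the composition in `𝓡` of the classes of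
`x, y₁, …, y_r`. -/
inductive IsIdentification : ∀ (n : ℕ+) (k : ℤ), operadR.El n k → Prop
  | comp {r n : ℕ+} {i : Fin r → ℕ+} {p m : ℤ} {q : Fin r → ℤ}
      (hn : ∑ j, (i j : ℕ) = n) (hm : p + ∑ j, q j = m)
      (x : barModule.El r p) (y : ∀ j, barModule.El (i j) (q j)) :
      IsIdentification n m (toR (smithOperad.comp hn hm x y) -
        operadR.comp hn hm (toR x) fun j => toR (y j))

/-!
The work is in showing that `smithOperad` satisfies the laws of an operad; the presentation as a
quotient of `𝓡` is then formal.

*Shuffle products.* The Eilenberg–Zilber shuffle map of a family of lists `w c`, indexed by a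
finite set `C`, is defined without an order on `C`: a matrix `ρ : C → C → ℤ` of exponents says
which signs occur when steps in the directions `c` and `c'` are exchanged, and `ez ρ w` is given
by the recursion on the first step,
`ez ρ w = g ∗ (∑ c, ± ez ρ (pop w c))`,
where `g` is the tuple of first entries, `∗` puts it in front of lists, and `pop w c` omits the
first entry of `w c` (there is an extra term when all lists are points). For `C` linearly ordered
and `ρ = ltMatrix` this is the signed sum over lattice paths (`ez_eq_sum_paths`). The recursion
gives, by induction on the total length, everything that is needed: naturality (`ez_map`),
preservation of degenerate lists (`ez_mem_degen`), the behaviour under a change of the order of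
the factors with its Koszul sign (`ez_reindex`), the boundary formula (`rawDL_ez`), and the
iteration of shuffle products over a disjoint union (`ez_sigma`).

*Smith's operad.* By `Smith.comp_proj`, a composition `γ(x; y₁, …, y_r)` is the shuffle product of
`x, y₁, …, y_r`, indexed by `Fin (r + 1)`, followed by the composition of permutations in each
vertex and by normalization. Hence each law of an operad splits into a law of shuffle products and
a law of the composition of permutations. For associativity, both iterated compositions are
shuffle products over the set `Smith.Pos` of all the arguments, for two orders of it; the orders
differ by the Koszul sign `assocExp` (`dgForm_posInv`), and the vertices agree by
`permComp_assoc`. Since all operations are additive in each argument (`MultiAdd`), it is enough to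
treat basis elements.

*The quotient.* As `smithOperad` is an operad, the formal expressions in `S` can be evaluated in
it (`OpTerm.eval`). All iterated compositions of the elements `[ ]` have the value `[ ]`, so that
the evaluation vanishes on `𝓙`; it also vanishes on the identifications, since the value of `κ x`
is `x`. So the evaluation is a left inverse of the map `x ↦ [κ x]` from `𝔖` to `𝓡 / 𝓘`. This map
is surjective, because its image contains the generators and the unit, which is identified with
`[ ]` of arity `1` in `𝓡`, and is closed under all operations, the compositions thanks to the
identifications.
-/

set_option linter.unusedSectionVars false

/-! ### Signs -/

lemma ksign_zero : ksign 0 = 1 := by simp [ksign]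

lemma ksign_one : ksign 1 = -1 := by simp [ksign]

lemma ksign_add (a b : ℤ) : ksign (a + b) = ksign a * ksign b := by
  simp [ksign, Int.negOnePow_add]

lemma ksign_eq_of_even_add {a b : ℤ} (h : Even (a + b)) : ksign a = ksign b := by
  unfold ksign
  rw [(Int.negOnePow_eq_iff a b).2 (by rcases h with ⟨c, hc⟩; exact ⟨c - b, by omega⟩)]

lemma ksign_mul_self (a : ℤ) : ksign a * ksign a = 1 := by
  rw [← ksign_add, ksign_eq_of_even_add (b := 0) (by simp), ksign_zero]

lemma ksign_natCast (a : ℕ) : ksign a = (-1) ^ a := by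
  induction a with
  | zero => simp [ksign_zero]
  | succ a ih => rw [Nat.cast_succ, ksign_add, ih, ksign_one, pow_succ]

/-! ### Multiadditive maps -/

/-- A map on tuples is multiadditive if it is additive in each entry. The tuples are related by
equations between entries instead of `Function.update`, so that the notion is stable under
reindexing of dependent families. -/
def MultiAdd {ι : Type} {A : ι → Type} {B : Type} [∀ c, AddCommGroup (A c)] [AddCommGroup B]
    (f : (∀ c, A c) → B) : Prop :=
  ∀ (c : ι) (y y' y'' : ∀ c, A c), (∀ a, a ≠ c → y' a = y a) → (∀ a, a ≠ c → y'' a = y a) →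
    y c = y' c + y'' c → f y = f y' + f y''

namespace MultiAdd

variable {ι : Type} {A : ι → Type} {B : Type} [∀ c, AddCommGroup (A c)] [AddCommGroup B]
  {f g : (∀ c, A c) → B}

lemma add (hf : MultiAdd f) (hg : MultiAdd g) : MultiAdd fun y => f y + g y :=
  fun c y y' y'' h' h'' h => by
    simp only [hf c y y' y'' h' h'' h, hg c y y' y'' h' h'' h]; abel

lemma smul (n : ℤ) (hf : MultiAdd f) : MultiAdd fun y => n • f y :=
  fun c y y' y'' h' h'' h => by simp only [hf c y y' y'' h' h'' h, smul_add]

lemma sum {κ : Type} (s : Finset κ) {F : κ → (∀ c, A c) → B} (hF : ∀ k ∈ s, MultiAdd (F k)) :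
    MultiAdd fun y => ∑ k ∈ s, F k y := fun c y y' y'' h' h'' h => by
  rw [← Finset.sum_add_distrib]
  exact Finset.sum_congr rfl fun k hk => hF k hk c y y' y'' h' h'' h

lemma map {B' : Type} [AddCommGroup B'] (hf : MultiAdd f) (φ : B →+ B') :
    MultiAdd fun y => φ (f y) := fun c y y' y'' h' h'' h => by
  simp only [hf c y y' y'' h' h'' h, map_add]

lemma comp_map {A' : ι → Type} [∀ c, AddCommGroup (A' c)] (hf : MultiAdd f)
    (φ : ∀ c, A' c →+ A c) : MultiAdd fun y => f fun c => φ c (y c) :=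
  fun c y y' y'' h' h'' h =>
    hf c _ _ _ (fun a ha => by simp only [h' a ha]) (fun a ha => by simp only [h'' a ha])
      (by simp only [h, map_add])

lemma map_eq_zero (hf : MultiAdd f) {y : ∀ c, A c} (c : ι) (hc : y c = 0) : f y = 0 := by
  have := hf c y y y (fun _ _ => rfl) (fun _ _ => rfl) (by simp [hc])
  simpa using this

lemma map_update_add [DecidableEq ι] (hf : MultiAdd f) (y : ∀ c, A c) (c : ι) (a b : A c) :
    f (Function.update y c (a + b)) = f (Function.update y c a) + f (Function.update y c b) :=
  hf c _ _ _ (fun d hd => by simp [hd]) (fun d hd => by simp [hd]) (by simp)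

/-- The additive map obtained by varying one entry. -/
def slot [DecidableEq ι] (hf : MultiAdd f) (y : ∀ c, A c) (c : ι) : A c →+ B :=
  AddMonoidHom.mk' (fun a => f (Function.update y c a)) (hf.map_update_add y c)

@[simp]
lemma slot_apply [DecidableEq ι] (hf : MultiAdd f) (y : ∀ c, A c) (c : ι) (a : A c) :
    hf.slot y c a = f (Function.update y c a) := rfl

/-- A multiadditive map as a multilinear map over `ℤ`. -/
def toMultilinear [DecidableEq ι] (hf : MultiAdd f) : MultilinearMap ℤ A B where
  toFun := f
  map_update_add' y c a b := by
    convert hf.map_update_add y c a b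
  map_update_smul' y c n a := by
    have := map_zsmul (hf.slot y c) n a
    simp only [slot_apply] at this
    convert this

lemma prod [Fintype ι] (φ : ∀ c, A c →+ ℤ) : MultiAdd fun y => ∏ c, φ c (y c) := by
  classical
  intro c y y' y'' h' h'' h
  beta_reduce
  rw [← Finset.mul_prod_erase _ _ (Finset.mem_univ c),
    ← Finset.mul_prod_erase _ (fun a => φ a (y' a)) (Finset.mem_univ c),
    ← Finset.mul_prod_erase _ (fun a => φ a (y'' a)) (Finset.mem_univ c),
    Finset.prod_congr rfl fun a ha => by rw [← h' a (Finset.ne_of_mem_erase ha)],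
    Finset.prod_congr (f := fun a => φ a (y'' a)) rfl fun a ha => by
      rw [h'' a (Finset.ne_of_mem_erase ha), ← h' a (Finset.ne_of_mem_erase ha)], h, map_add,
    add_mul]

end MultiAdd

section MultiExt

variable {ι : Type} [Fintype ι] [DecidableEq ι] {K : ι → Type} {B : Type} [AddCommGroup B]

/-- A multiadditive map on combinations is determined by its values on basis elements. -/
lemma MultiAdd.eq_sum {f : (∀ c, K c →₀ ℤ) → B} (hf : MultiAdd f) (y : ∀ c, K c →₀ ℤ) :
    f y = ∑ v ∈ Fintype.piFinset fun c => (y c).support,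
      (∏ c, y c (v c)) • f fun c => Finsupp.single (v c) 1 := by
  have h : y = fun c => ∑ v ∈ (y c).support, y c v • Finsupp.single v (1 : ℤ) := by
    funext c
    conv_lhs => rw [← Finsupp.sum_single (y c)]
    simp [Finsupp.sum]
  conv_lhs => rw [h]
  have := hf.toMultilinear.map_sum_finset (fun c v => y c v • Finsupp.single v (1 : ℤ))
    fun c => (y c).support
  refine this.trans (Finset.sum_congr rfl fun v _ => ?_)
  exact hf.toMultilinear.map_smul_univ (fun c => y c (v c)) fun c => Finsupp.single (v c) 1

/-- Multiadditive maps that agree on the basis elements which occur in a tuple of combinations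
agree on it. -/
lemma MultiAdd.ext_on {f g : (∀ c, K c →₀ ℤ) → B} (hf : MultiAdd f) (hg : MultiAdd g)
    (y : ∀ c, K c →₀ ℤ) (h : ∀ v : ∀ c, K c, (∀ c, v c ∈ (y c).support) →
      f (fun c => Finsupp.single (v c) 1) = g fun c => Finsupp.single (v c) 1) : f y = g y := by
  rw [hf.eq_sum, hg.eq_sum]
  refine Finset.sum_congr rfl fun v hv => ?_
  rw [h v fun c => Fintype.mem_piFinset.1 hv c]

/-- The multiadditive extension of a map on tuples of basis elements. -/
noncomputable def multiExt (f : (∀ c, K c) → B) (y : ∀ c, K c →₀ ℤ) : B :=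
  ∑ v ∈ Fintype.piFinset fun c => (y c).support, (∏ c, y c (v c)) • f v

lemma multiExt_eq_sum (f : (∀ c, K c) → B) (y : ∀ c, K c →₀ ℤ) (s : ∀ c, Finset (K c))
    (hs : ∀ c, (y c).support ⊆ s c) :
    multiExt f y = ∑ v ∈ Fintype.piFinset s, (∏ c, y c (v c)) • f v := by
  refine Finset.sum_subset (Fintype.piFinset_subset _ _ hs) fun v _ hv => ?_
  rw [Fintype.mem_piFinset, not_forall] at hv
  obtain ⟨c, hc⟩ := hv
  have h0 : ∏ c, y c (v c) = 0 :=
    Finset.prod_eq_zero (Finset.mem_univ c) (Finsupp.notMem_support_iff.1 hc)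
  rw [h0, zero_smul]

lemma multiExt_single (f : (∀ c, K c) → B) (v : ∀ c, K c) :
    multiExt f (fun c => Finsupp.single (v c) 1) = f v := by
  rw [multiExt_eq_sum f _ (fun c => {v c}) fun c => Finsupp.support_single_subset,
    Fintype.piFinset_singleton, Finset.sum_singleton]
  simp

lemma multiExt_multiAdd (f : (∀ c, K c) → B) : MultiAdd (multiExt f) := by
  classical
  intro c y y' y'' h' h'' h
  let s : ∀ c, Finset (K c) := fun c => (y c).support ∪ (y' c).support ∪ (y'' c).support
  rw [multiExt_eq_sum f y s, multiExt_eq_sum f y' s, multiExt_eq_sum f y'' s,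
    ← Finset.sum_add_distrib]
  · refine Finset.sum_congr rfl fun v _ => ?_
    rw [← add_smul]
    exact congrArg (· • f v)
      (MultiAdd.prod (fun c => Finsupp.applyAddHom (v c)) c y y' y'' h' h'' h)
  all_goals
    intro c v hv
    simp only [s, Finset.mem_union]
    tauto

end MultiExt

/-! ### Shuffle products of lists -/

/-- The linear map on combinations of lists which applies `f` to every entry. -/
noncomputable def mapL {X Y : Type} (f : X → Y) : (List X →₀ ℤ) →ₗ[ℤ] (List Y →₀ ℤ) :=
  Finsupp.lmapDomain ℤ ℤ (List.map f)

/-- The combinations of lists of length `k + 1`. -/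
noncomputable def homog (X : Type) (k : ℤ) : Submodule ℤ (List X →₀ ℤ) :=
  Finsupp.supported ℤ ℤ {l | (l.length : ℤ) = k + 1}

section MapL

variable {X Y Z : Type}

lemma mapL_single (f : X → Y) (l : List X) :
    mapL f (Finsupp.single l 1) = Finsupp.single (l.map f) 1 := by
  simp [mapL, Finsupp.lmapDomain_apply]

lemma mapL_mapL (f : X → Y) (g : Y → Z) (y : List X →₀ ℤ) :
    mapL g (mapL f y) = mapL (fun x => g (f x)) y := by
  simp only [mapL, Finsupp.lmapDomain_apply, ← Finsupp.mapDomain_comp]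
  congr 1
  funext l
  simp

lemma single_eq_smul {α : Type} (a : α) (n : ℤ) :
    (Finsupp.single a n : α →₀ ℤ) = n • Finsupp.single a 1 := by simp

/-- Additive maps on combinations which agree on basis elements are equal. -/
lemma finsupp_ext {α A : Type} [AddCommGroup A] {f g : (α →₀ ℤ) →+ A}
    (h : ∀ w, f (Finsupp.single w 1) = g (Finsupp.single w 1)) (x : α →₀ ℤ) : f x = g x := by
  induction x using Finsupp.induction_linear with
  | zero => rw [map_zero, map_zero]
  | add a b ha hb => rw [map_add, map_add, ha, hb]
  | single w a => rw [single_eq_smul, map_zsmul, map_zsmul, h]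

lemma mapL_cone (f : X → Y) (g : X) (y : List X →₀ ℤ) :
    mapL f (Bar.cone g y) = Bar.cone (f g) (mapL f y) := by
  simp only [mapL, Bar.cone, Finsupp.lmapDomain_apply, ← Finsupp.mapDomain_comp]
  congr 1

lemma mapL_mem_degen {f : X → Y} {y : List X →₀ ℤ} (hy : y ∈ Bar.degen X) :
    mapL f y ∈ Bar.degen Y := by
  induction hy using Submodule.span_induction with
  | mem c hc =>
    obtain ⟨w, hw, rfl⟩ := hc
    rw [mapL_single]
    refine Bar.single_mem_degen fun h => hw ?_
    rw [List.isChain_map] at h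
    exact h.imp fun _ _ h' => fun h'' => h' (by rw [h''])
  | zero => rw [map_zero]; exact Submodule.zero_mem _
  | add a b _ _ ha hb => rw [map_add]; exact Submodule.add_mem _ ha hb
  | smul n a _ ha => rw [map_smul]; exact Submodule.smul_mem _ _ ha

lemma rawDL_mapL (f : X → Y) (y : List X →₀ ℤ) :
    Bar.rawDL (mapL f y) = mapL f (Bar.rawDL y) := by
  refine finsupp_ext (f := (Bar.rawDL.comp (mapL f)).toAddMonoidHom)
    (g := ((mapL f).comp Bar.rawDL).toAddMonoidHom) (fun w => ?_) y
  change Bar.rawDL (mapL f _) = mapL f (Bar.rawDL _)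
  rw [mapL_single, Bar.rawDL_single, Bar.rawDL_single, Bar.rawD, Bar.rawD]
  simp only [map_sum, map_zsmul, mapL_single, List.length_map, List.eraseIdx_map]

lemma single_mem_homog {k : ℤ} {l : List X} (h : (l.length : ℤ) = k + 1) :
    Finsupp.single l 1 ∈ homog X k := Finsupp.single_mem_supported ℤ 1 h

lemma length_of_mem_homog {k : ℤ} {y : List X →₀ ℤ} (hy : y ∈ homog X k) {l : List X}
    (hl : l ∈ y.support) : (l.length : ℤ) = k + 1 := hy hl

lemma mapL_mem_homog {f : X → Y} {k : ℤ} {y : List X →₀ ℤ} (hy : y ∈ homog X k) :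
    mapL f y ∈ homog Y k := by
  classical
  intro l hl
  obtain ⟨l', hl', rfl⟩ := Finset.mem_image.1 (Finsupp.mapDomain_support hl)
  have := hy hl'
  simpa using this

lemma cone_mem_homog {g : X} {k : ℤ} {y : List X →₀ ℤ} (hy : y ∈ homog X (k - 1)) :
    Bar.cone g y ∈ homog X k := by
  classical
  intro l hl
  obtain ⟨l', hl', rfl⟩ := Finset.mem_image.1 (Finsupp.mapDomain_support hl)
  have : (l'.length : ℤ) = k - 1 + 1 := hy hl'
  change ((g :: l').length : ℤ) = k + 1
  rw [List.length_cons]; push_cast; omega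

end MapL

section Shuffle

variable {C : Type} [Fintype C] [DecidableEq C] {X : C → Type} [∀ c, Inhabited (X c)]

/-- The dimension of the simplex with the list of vertices `w c`. -/
def dg (w : ∀ c, List (X c)) (c : C) : ℤ := (w c).length - 1

/-- The tuple of first vertices. -/
def heads (w : ∀ c, List (X c)) : ∀ c, X c := fun c => (w c).headI

/-- Deleting the first vertex of the `c`-th simplex. -/
def pop (w : ∀ c, List (X c)) (c : C) : ∀ c, List (X c) := Function.update w c (w c).tail

/-- The sign of a first step in direction `c`: the step passes the vertices of those simplices `a`
with `ρ a c = 1`. -/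
def stepSign (ρ : C → C → ℤ) (w : ∀ c, List (X c)) (c : C) : ℤ := ksign (∑ a, ρ a c * dg w a)

open Classical in
/-- The recursion that defines `ez`; the first argument bounds the number of steps. -/
noncomputable def ezAux (ρ : C → C → ℤ) : ℕ → (∀ c, List (X c)) → (List (∀ c, X c) →₀ ℤ)
  | 0, w => if ∃ c, w c = [] then 0 else Finsupp.single [heads w] 1
  | N + 1, w => if ∃ c, w c = [] then 0 else
      Bar.cone (heads w) (∑ c, stepSign ρ w c • ezAux ρ N (pop w c))

/-- The Eilenberg–Zilber shuffle product of simplices `w c`, given by their lists of vertices, as a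
combination of lists of vertices of the product. The factors are ordered by the matrix `ρ`, with
`ρ a c = 1` if `a` precedes `c` and `ρ a c = 0` otherwise. The product is `0` if one of the lists is
empty. -/
noncomputable def ez (ρ : C → C → ℤ) (w : ∀ c, List (X c)) : List (∀ c, X c) →₀ ℤ :=
  ezAux ρ (∑ c, ((w c).length - 1)) w

/-- The combination `[ ]` if all factors are points, and `0` otherwise. -/
noncomputable def ptTerm (w : ∀ c, List (X c)) : List (∀ c, X c) →₀ ℤ :=
  if ∀ c, (w c).length = 1 then Finsupp.single [] 1 else 0

lemma pop_self (w : ∀ c, List (X c)) (c : C) : pop w c c = (w c).tail := by simp [pop]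

lemma pop_of_ne (w : ∀ c, List (X c)) {a c : C} (h : a ≠ c) : pop w c a = w a := by simp [pop, h]

lemma ez_of_nil (ρ : C → C → ℤ) {w : ∀ c, List (X c)} (c : C) (h : w c = []) : ez ρ w = 0 := by
  unfold ez
  cases ∑ c, ((w c).length - 1) <;> rw [ezAux, if_pos ⟨c, h⟩]

/-- Induction on the number of vertices, by deletion of first vertices. -/
lemma pop_induction {P : (∀ c, List (X c)) → Prop} (nil : ∀ w c, w c = [] → P w)
    (step : ∀ w, (∀ c, w c ≠ []) → (∀ c, P (pop w c)) → P w) (w : ∀ c, List (X c)) : P w := by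
  induction hN : ∑ c, (w c).length using Nat.strong_induction_on generalizing w with
  | _ N ih =>
    by_cases h : ∃ c, w c = []
    · obtain ⟨c, hc⟩ := h
      exact nil w c hc
    · push Not at h
      refine step w h fun c => ih _ ?_ _ rfl
      rw [← hN]
      refine Finset.sum_lt_sum (fun a _ => ?_) ⟨c, Finset.mem_univ c, ?_⟩
      · by_cases hac : a = c
        · subst hac; rw [pop_self, List.length_tail]; omega
        · rw [pop_of_ne w hac]
      · have := List.length_pos_iff.2 (h c)
        rw [pop_self, List.length_tail]; omega

/-- The recursion for shuffle products: every path starts at the tuple of first vertices and goes on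
with a step in one of the directions. -/
lemma ez_eq (ρ : C → C → ℤ) {w : ∀ c, List (X c)} (h : ∀ c, w c ≠ []) :
    ez ρ w = Bar.cone (heads w) (ptTerm w + ∑ c, stepSign ρ w c • ez ρ (pop w c)) := by
  have hlen : ∀ c, 0 < (w c).length := fun c => List.length_pos_iff.2 (h c)
  have hne : ¬ ∃ c, w c = [] := by push Not; exact h
  by_cases hpt : ∀ c, (w c).length = 1
  · have h0 : ∀ c, ez ρ (pop w c) = 0 := fun c => ez_of_nil ρ c (by
      rw [pop_self, ← List.length_eq_zero_iff, List.length_tail, hpt c])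
    simp only [h0, smul_zero, Finset.sum_const_zero, add_zero, ptTerm, if_pos hpt, Bar.cone_single]
    unfold ez
    rw [Finset.sum_eq_zero fun c _ => by rw [hpt c, Nat.sub_self], ezAux, if_neg hne]
  · rw [ptTerm, if_neg hpt, zero_add]
    obtain ⟨N, hN⟩ : ∃ N, ∑ c, ((w c).length - 1) = N + 1 := by
      refine Nat.exists_eq_succ_of_ne_zero fun h0 => hpt fun c => ?_
      have := Finset.sum_eq_zero_iff.1 h0 c (Finset.mem_univ c)
      have := hlen c
      omega
    conv_lhs => rw [ez, hN, ezAux, if_neg hne]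
    congr 1
    refine Finset.sum_congr rfl fun c _ => ?_
    congr 1
    by_cases hc : (w c).tail = []
    · rw [ez_of_nil ρ c (by rw [pop_self, hc])]
      cases N <;> rw [ezAux, if_pos ⟨c, by rw [pop_self, hc]⟩]
    · rw [ez]
      congr 1
      have hc' : 0 < (w c).tail.length := List.length_pos_iff.2 hc
      rw [← Finset.add_sum_erase _ _ (Finset.mem_univ c)] at hN ⊢
      rw [Finset.sum_congr rfl fun a ha => by rw [pop_of_ne w (Finset.ne_of_mem_erase ha)],
        pop_self]
      rw [List.length_tail] at hc' ⊢
      omega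

lemma dg_pop {w : ∀ c, List (X c)} {c : C} (h : w c ≠ []) (a : C) :
    dg (pop w c) a = dg w a - if a = c then 1 else 0 := by
  unfold dg
  split_ifs with hac
  · subst hac
    have := List.length_pos_iff.2 h
    rw [pop_self, List.length_tail]; omega
  · rw [pop_of_ne w hac]; ring

lemma dg_eq_zero_of_pt {w : ∀ c, List (X c)} (h : ∀ c, (w c).length = 1) (c : C) : dg w c = 0 := by
  rw [dg, h c]; rfl

lemma ptTerm_mem_homog (w : ∀ c, List (X c)) : ptTerm w ∈ homog (∀ c, X c) (∑ c, dg w c - 1) := by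
  unfold ptTerm
  split_ifs with h
  · refine single_mem_homog ?_
    rw [Finset.sum_eq_zero fun c _ => dg_eq_zero_of_pt h c]; rfl
  · exact Submodule.zero_mem _

lemma sum_dg_pop {w : ∀ c, List (X c)} {c : C} (h : w c ≠ []) :
    ∑ a, dg (pop w c) a = ∑ a, dg w a - 1 := by
  simp only [dg_pop h, Finset.sum_sub_distrib, Finset.sum_ite_eq', Finset.mem_univ, if_true]

lemma ez_mem_homog (ρ : C → C → ℤ) (w : ∀ c, List (X c)) :
    ez ρ w ∈ homog (∀ c, X c) (∑ c, dg w c) := by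
  induction w using pop_induction with
  | nil w c h => rw [ez_of_nil ρ c h]; exact Submodule.zero_mem _
  | step w h ih =>
    rw [ez_eq ρ h]
    refine cone_mem_homog (Submodule.add_mem _ (ptTerm_mem_homog w)
      (Submodule.sum_mem _ fun c _ => Submodule.smul_mem _ _ ?_))
    rw [← sum_dg_pop (h c)]
    exact ih c

lemma mapL_ptTerm {Y : C → Type} (φ : ∀ c, X c → Y c) (w : ∀ c, List (X c)) :
    mapL (fun x c => φ c (x c)) (ptTerm w) = ptTerm fun c => (w c).map (φ c) := by
  unfold ptTerm
  simp only [List.length_map]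
  split_ifs
  · exact mapL_single _ _
  · exact map_zero _

/-- Shuffle products are natural in the factors. -/
lemma ez_map {Y : C → Type} [∀ c, Inhabited (Y c)] (ρ : C → C → ℤ) (φ : ∀ c, X c → Y c)
    (w : ∀ c, List (X c)) :
    ez ρ (fun c => (w c).map (φ c)) = mapL (fun x c => φ c (x c)) (ez ρ w) := by
  induction w using pop_induction with
  | nil w c h => rw [ez_of_nil ρ c h, ez_of_nil ρ c (by rw [h]; rfl), map_zero]
  | step w h ih =>
    rw [ez_eq ρ h, ez_eq ρ fun c => by simpa using h c, mapL_cone]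
    congr 1
    · congr 1
      funext c
      obtain ⟨g, l, hl⟩ := List.exists_cons_of_ne_nil (h c)
      simp [heads, hl]
    · rw [map_add, map_sum, mapL_ptTerm]
      congr 1
      refine Finset.sum_congr rfl fun c _ => ?_
      rw [map_zsmul, ← ih c]
      congr 1
      · simp [stepSign, dg]
      · congr 1
        funext a
        by_cases hac : a = c
        · subst hac; rw [pop_self, pop_self, List.map_tail]
        · rw [pop_of_ne _ hac, pop_of_ne _ hac]

lemma cone_sum_smul_mem_degen {G ι : Type} {s : Finset ι} {n : ι → ℤ} {y : ι → List G →₀ ℤ} (g : G)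
    (h : ∀ c ∈ s, Bar.cone g (y c) ∈ Bar.degen G) :
    Bar.cone g (∑ c ∈ s, n c • y c) ∈ Bar.degen G := by
  rw [map_sum]
  refine Submodule.sum_mem _ fun c hc => ?_
  rw [map_zsmul]
  exact Submodule.smul_mem _ _ (h c hc)

/-- Shuffle products with a degenerate factor are combinations of degenerate lists. -/
lemma ez_mem_degen (ρ : C → C → ℤ) (w : ∀ c, List (X c)) (c : C)
    (hc : ¬ (w c).IsChain (· ≠ ·)) : ez ρ w ∈ Bar.degen (∀ c, X c) := by
  induction w using pop_induction with
  | nil w a h => rw [ez_of_nil ρ a h]; exact Submodule.zero_mem _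
  | step w h ih =>
    have hpt : ptTerm w = 0 := by
      rw [ptTerm, if_neg fun h1 => ?_]
      obtain ⟨g, hg⟩ := List.length_eq_one_iff.1 (h1 c)
      exact hc (by rw [hg]; exact .singleton g)
    rw [ez_eq ρ h, hpt, zero_add]
    refine cone_sum_smul_mem_degen _ fun a _ => ?_
    by_cases hac : a = c
    · subst hac
      by_cases hp : (pop w a a).IsChain (· ≠ ·)
      · -- The repetition is at the start of the list, hence so is that of the path.
        obtain ⟨g, l, hl⟩ := List.exists_cons_of_ne_nil (h a)
        rw [pop_self, hl, List.tail_cons] at hp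
        rw [hl] at hc
        cases l with
        | nil => exact absurd (.singleton _) hc
        | cons g' l =>
          obtain rfl : g = g' := by
            by_contra hg
            exact hc (List.isChain_cons_cons.2 ⟨hg, hp⟩)
          have hne : ∀ b, pop w a b ≠ [] := fun b => by
            by_cases hb : b = a
            · subst hb; rw [pop_self, hl]; simp
            · rw [pop_of_ne w hb]; exact h b
          have hh : heads (pop w a) = heads w := by
            funext b
            by_cases hb : b = a
            · subst hb; simp only [heads]; rw [pop_self, hl]; rfl
            · simp only [heads]; rw [pop_of_ne w hb]
          rw [ez_eq ρ hne, hh]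
          exact Bar.cone_cone_mem_degen _ _
      · exact Bar.cone_mem_degen _ (ih a hp)
    · exact Bar.cone_mem_degen _ (ih a (by rwa [pop_of_ne w (Ne.symm hac)]))

/-- A shuffle product all of whose factors but one are points. -/
lemma ez_update_pt (ρ : C → C → ℤ) (c : C) (hρ : ρ c c = 0) (g : ∀ c, X c) {l : List (X c)}
    (hl : l ≠ []) : ez ρ (Function.update (fun a => [g a]) c l) =
      Finsupp.single (l.map (Function.update g c)) 1 := by
  induction l with
  | nil => exact absurd rfl hl
  | cons x l ih =>
    have hne : ∀ a, Function.update (fun a => [g a]) c (x :: l) a ≠ [] := fun a => by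
      by_cases hac : a = c
      · subst hac; simp
      · simp [hac]
    have hh : heads (Function.update (fun a => [g a]) c (x :: l)) = Function.update g c x := by
      funext a
      by_cases hac : a = c
      · subst hac; simp [heads]
      · simp [heads, hac]
    have hpop : pop (Function.update (fun a => [g a]) c (x :: l)) c =
        Function.update (fun a => [g a]) c l := by simp [pop]
    have hs : stepSign ρ (Function.update (fun a => [g a]) c (x :: l)) c = 1 := by
      unfold stepSign
      rw [Finset.sum_eq_zero, ksign_zero]
      intro a _
      by_cases hac : a = c
      · subst hac; rw [hρ, zero_mul]
      · simp [dg, hac]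
    rw [ez_eq ρ hne, hh, Finset.sum_eq_single c, hpop, hs, one_smul]
    · by_cases hl : l = []
      · subst hl
        rw [ez_of_nil ρ c (by simp), ptTerm, if_pos, add_zero, Bar.cone_single]
        · simp
        · intro a
          by_cases hac : a = c
          · subst hac; simp
          · simp [hac]
      · rw [ih hl, ptTerm, if_neg, zero_add, Bar.cone_single]
        · simp
        · intro h
          have := h c
          simp [hl] at this
    · intro a _ hac
      rw [ez_of_nil ρ a (by simp [pop, hac]), smul_zero]
    · simp

lemma ez_pt (ρ : C → C → ℤ) (g : ∀ c, X c) [Nonempty C] (hρ : ∀ c, ρ c c = 0) :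
    ez ρ (fun a => [g a]) = Finsupp.single [g] 1 := by
  obtain ⟨c⟩ := ‹Nonempty C›
  have := ez_update_pt ρ c (hρ c) g (l := [g c]) (by simp)
  simpa using this

end Shuffle

/-! ### Reordering the factors of a shuffle product -/

section Reindex

variable {C C' : Type} [Fintype C] [DecidableEq C] [Fintype C'] [DecidableEq C'] {X : C → Type}
  [∀ c, Inhabited (X c)]

/-- The value at the dimensions of `w` of the quadratic form with matrix `θ`. -/
def dgForm (θ : C → C → ℤ) (w : ∀ c, List (X c)) : ℤ := ∑ a, ∑ b, θ a b * (dg w a * dg w b)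

lemma dgForm_pop (θ : C → C → ℤ) (hθ : ∀ a, θ a a = 0) {w : ∀ c, List (X c)} {c : C}
    (h : w c ≠ []) :
    dgForm θ (pop w c) = dgForm θ w - ∑ a, (θ c a + θ a c) * dg w a := by
  have key : ∀ a b, θ a b * (dg (pop w c) a * dg (pop w c) b) = θ a b * (dg w a * dg w b) -
      (if b = c then θ a c * dg w a else 0) - (if a = c then θ c b * dg w b else 0) := by
    intro a b
    rw [dg_pop h, dg_pop h]
    by_cases ha : a = c
    · by_cases hb : b = c
      · subst ha; subst hb; simp [hθ]
      · subst ha; simp [hb]; ring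
    · by_cases hb : b = c
      · subst hb; simp [ha]; ring
      · simp [ha, hb]
  unfold dgForm
  simp only [key, Finset.sum_sub_distrib, Finset.sum_ite_eq', Finset.mem_univ, if_true]
  have : ∑ a, ∑ b, (if a = c then θ c b * dg w b else 0) = ∑ b, θ c b * dg w b := by
    rw [Finset.sum_comm]
    simp
  rw [this]
  simp only [add_mul, Finset.sum_add_distrib]
  ring

/-- Changing the order of the factors changes a shuffle product by a Koszul sign: `θ` is the matrix
of the pairs of factors on whose order `ρ` and `ρ'` disagree. -/
lemma ez_reindex (e : C' ≃ C) {ρ' : C' → C' → ℤ} {ρ θ : C → C → ℤ} (hθ : ∀ a, θ a a = 0)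
    (h : ∀ a b, Even (θ (e a) (e b) + θ (e b) (e a) + ρ' a b + ρ (e a) (e b)))
    (w : ∀ c, List (X c)) :
    ez ρ' (fun c => w (e c)) =
      ksign (dgForm θ w) • mapL (fun x c => x (e c)) (ez ρ w) := by
  induction w using pop_induction with
  | nil w c hc =>
    rw [ez_of_nil ρ c hc, ez_of_nil ρ' (e.symm c) (by rw [e.apply_symm_apply]; exact hc), map_zero,
      smul_zero]
  | step w hw ih =>
    rw [ez_eq ρ hw, ez_eq ρ' fun c => hw (e c), mapL_cone, ← map_zsmul]
    congr 1
    rw [map_add, smul_add]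
    congr 1
    · unfold ptTerm
      have hiff : (∀ c, (w (e c)).length = 1) ↔ ∀ c, (w c).length = 1 :=
        ⟨fun h1 c => by rw [← e.apply_symm_apply c]; exact h1 _, fun h1 c => h1 (e c)⟩
      by_cases h1 : ∀ c, (w c).length = 1
      · rw [if_pos h1, if_pos (hiff.2 h1), mapL_single]
        have : dgForm θ w = 0 := by simp [dgForm, dg_eq_zero_of_pt h1]
        rw [this, ksign_zero, one_smul]
        rfl
      · rw [if_neg h1, if_neg fun h2 => h1 (hiff.1 h2), map_zero, smul_zero]
    · rw [map_sum, Finset.smul_sum, ← Equiv.sum_comp e]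
      refine Finset.sum_congr rfl fun c _ => ?_
      have hpop : pop (fun c => w (e c)) c = fun a => pop w (e c) (e a) := by
        unfold pop
        exact (Function.update_comp_eq_of_injective' w e.injective c _).symm
      rw [hpop, ih (e c), map_zsmul, smul_smul, smul_smul]
      congr 1
      rw [stepSign, stepSign, ← ksign_add, ← ksign_add]
      refine ksign_eq_of_even_add ?_
      rw [dgForm_pop θ hθ (hw (e c)), ← Equiv.sum_comp e, ← Equiv.sum_comp e fun a => ρ a (e c) * _]
      have hev : Even (∑ a, (θ (e a) (e c) + θ (e c) (e a) + ρ' a c + ρ (e a) (e c)) *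
          dg w (e a)) := Finset.even_sum _ fun a _ => (h a c).mul_right _
      obtain ⟨m, hm⟩ := hev
      simp only [add_mul, Finset.sum_add_distrib] at hm ⊢
      refine ⟨dgForm θ w + m - ∑ a, θ (e c) (e a) * dg w (e a)
        - ∑ a, θ (e a) (e c) * dg w (e a), ?_⟩
      change ∑ a, ρ' a c * dg w (e a) + _ + _ = _
      linarith

end Reindex

/-! ### The boundary of a shuffle product -/

section Boundary

variable {C : Type} [Fintype C] [DecidableEq C] {X : C → Type} [∀ c, Inhabited (X c)]

/-- The alternating sum of the shuffle products with a face of the `c`-th factor. -/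
noncomputable def faceSum (ρ : C → C → ℤ) (w : ∀ c, List (X c)) (c : C) : List (∀ c, X c) →₀ ℤ :=
  ∑ k ∈ Finset.range (w c).length,
    (-1 : ℤ) ^ k • ez ρ (Function.update w c ((w c).eraseIdx k))

lemma faceSum_of_nil (ρ : C → C → ℤ) {w : ∀ c, List (X c)} {a : C} (h : w a = []) (c : C) :
    faceSum ρ w c = 0 := by
  refine Finset.sum_eq_zero fun k hk => ?_
  by_cases hac : a = c
  · subst hac; simp [h] at hk
  · rw [ez_of_nil ρ a (by simp [hac, h]), smul_zero]

/-- The alternating sum of the shuffle products with a face of the `c`-th factor other than the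
first one. -/
noncomputable def restSum (ρ : C → C → ℤ) (w : ∀ c, List (X c)) (c : C) : List (∀ c, X c) →₀ ℤ :=
  ∑ k ∈ Finset.range (w c).tail.length,
    (-1 : ℤ) ^ k • ez ρ (Function.update w c ((w c).eraseIdx (k + 1)))

lemma faceSum_eq (ρ : C → C → ℤ) {w : ∀ c, List (X c)} {c : C} (h : w c ≠ []) :
    faceSum ρ w c = ez ρ (pop w c) - restSum ρ w c := by
  obtain ⟨g, l, hl⟩ := List.exists_cons_of_ne_nil h
  rw [faceSum, restSum, List.length_tail, hl, List.length_cons, Nat.add_sub_cancel,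
    Finset.sum_range_succ', add_comm, sub_eq_add_neg, ← Finset.sum_neg_distrib]
  congr 1
  · rw [pow_zero, one_smul, pop, hl]; rfl
  · refine Finset.sum_congr rfl fun k _ => ?_
    rw [pow_succ]; simp

lemma pop_pop_comm (w : ∀ c, List (X c)) {a c : C} (h : a ≠ c) :
    pop (pop w a) c = pop (pop w c) a := by
  rw [pop, pop_of_ne w (Ne.symm h), pop, pop, pop_of_ne w h, pop]
  exact Function.update_comm h _ _ _

lemma stepSign_congr {ρ : C → C → ℤ} {w w' : ∀ c, List (X c)} {c : C} (hρ : ρ c c = 0)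
    (h : ∀ a, a ≠ c → (w a).length = (w' a).length) : stepSign ρ w c = stepSign ρ w' c := by
  unfold stepSign
  congr 1
  refine Finset.sum_congr rfl fun a _ => ?_
  by_cases hac : a = c
  · subst hac; rw [hρ, zero_mul, zero_mul]
  · rw [dg, dg, h a hac]

lemma stepSign_pop {ρ : C → C → ℤ} {w : ∀ c, List (X c)} {a c : C} (h : w a ≠ []) :
    stepSign ρ (pop w a) c = ksign (ρ a c) * stepSign ρ w c := by
  unfold stepSign
  rw [← ksign_add]
  refine ksign_eq_of_even_add ⟨∑ b, ρ b c * dg w b, ?_⟩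
  have : ∀ b, ρ b c * dg (pop w a) b = ρ b c * dg w b - if b = a then ρ a c else 0 := fun b => by
    rw [dg_pop h]
    split_ifs with hb
    · subst hb; ring
    · ring
  simp only [this, Finset.sum_sub_distrib, Finset.sum_ite_eq', Finset.mem_univ, if_true]
  ring

lemma ptTerm_congr {w w' : ∀ c, List (X c)} (h : ∀ c, (w c).length = (w' c).length) :
    ptTerm w = ptTerm w' := by
  unfold ptTerm
  simp only [h]

/-- The recursion for the faces of the `c`-th factor which keep the first vertex. -/
lemma restSum_eq (ρ : C → C → ℤ) (hρ : ∀ c, ρ c c = 0) {w : ∀ c, List (X c)} (h : ∀ c, w c ≠ [])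
    (c : C) : restSum ρ w c = Bar.cone (heads w) (ptTerm (pop w c) +
      stepSign ρ w c • faceSum ρ (pop w c) c +
      ∑ a with a ≠ c, stepSign ρ (pop w c) a • restSum ρ (pop w a) c) := by
  obtain ⟨g, l, hl⟩ := List.exists_cons_of_ne_nil (h c)
  set u : ℕ → ∀ c, List (X c) := fun k => Function.update w c (g :: l.eraseIdx k) with hu
  have hk : ∀ k ∈ Finset.range l.length, ez ρ (u k) = Bar.cone (heads w) (ptTerm (pop w c) +
      stepSign ρ w c • ez ρ (Function.update (pop w c) c (l.eraseIdx k)) +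
      ∑ a with a ≠ c, stepSign ρ (pop w c) a •
        ez ρ (Function.update (pop w a) c ((g :: l).eraseIdx (k + 1)))) := by
    intro k hk
    have hk := Finset.mem_range.1 hk
    have hlen : ∀ a, (u k a).length = (pop w c a).length := fun a => by
      by_cases hac : a = c
      · subst hac
        rw [pop_self, hl, hu]
        simp only [Function.update_self, List.length_cons, List.tail_cons]
        rw [List.length_eraseIdx_of_lt hk]
        omega
      · simp [hu, pop, hac]
    rw [ez_eq ρ fun a => ?_]
    · congr 1
      · congr 1
        funext a
        by_cases hac : a = c
        · subst hac; simp [heads, hu, hl]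
        · simp [heads, hu, hac]
      · rw [ptTerm_congr hlen, add_assoc, ← Finset.sum_erase_add _ _ (Finset.mem_univ c)]
        rw [add_comm (Finset.sum _ _)]
        congr 2
        · congr 1
          · refine stepSign_congr (hρ c) fun a hac => ?_
            rw [hlen, pop_of_ne w hac]
          · congr 1
            simp [hu, pop]
        · refine Finset.sum_congr (by ext; simp) fun a ha => ?_
          have hac : a ≠ c := by simpa using ha
          congr 1
          · exact stepSign_congr (hρ a) fun b _ => hlen b
          · congr 1
            rw [hu]
            simp only [pop]
            rw [Function.update_of_ne hac, Function.update_comm hac.symm]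
            rfl
    · by_cases hac : a = c
      · subst hac; simp [hu]
      · simp [hu, hac, h a]
  have h1 : restSum ρ w c = ∑ k ∈ Finset.range l.length, (-1 : ℤ) ^ k • ez ρ (u k) := by
    rw [restSum, hl]; rfl
  have h2 : ∑ k ∈ Finset.range l.length, (-1 : ℤ) ^ k • ptTerm (pop w c) = ptTerm (pop w c) := by
    unfold ptTerm
    split_ifs with hpt
    · have := hpt c
      rw [pop_self, hl, List.tail_cons] at this
      rw [this]; simp
    · simp
  have h3 : faceSum ρ (pop w c) c = ∑ k ∈ Finset.range l.length,
      (-1 : ℤ) ^ k • ez ρ (Function.update (pop w c) c (l.eraseIdx k)) := by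
    rw [faceSum, pop_self, hl]; rfl
  have h4 : ∀ a, a ≠ c → restSum ρ (pop w a) c = ∑ k ∈ Finset.range l.length,
      (-1 : ℤ) ^ k • ez ρ (Function.update (pop w a) c ((g :: l).eraseIdx (k + 1))) := by
    intro a ha
    rw [restSum, pop_of_ne w ha.symm, hl]; rfl
  rw [h1, Finset.sum_congr rfl fun k hk' => by rw [hk k hk'], h3,
    Finset.sum_congr (s₁ := Finset.univ.filter (· ≠ c)) rfl fun a ha => by
      rw [h4 a (Finset.mem_filter.1 ha).2]]
  simp only [← map_zsmul, ← map_sum]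
  congr 1
  simp only [smul_add, Finset.sum_add_distrib, h2, Finset.smul_sum]
  congr 1
  · congr 1
    exact Finset.sum_congr rfl fun k _ => smul_comm _ _ _
  · rw [Finset.sum_comm]
    exact Finset.sum_congr rfl fun a _ => Finset.sum_congr rfl fun k _ => smul_comm _ _ _

/-- The cancellation of the twofold deletions `T` in the boundary of a shuffle product. -/
lemma leibniz_cancel {K : Type} (s : C → ℤ) (t : C → C → ℤ) (F R T : C → C → K →₀ ℤ)
    (hF : ∀ c a, a ≠ c → F c a = T c a - R c a) (hT : ∀ c a, a ≠ c → T c a = T a c)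
    (hs : ∀ c, t c c = s c) (hst : ∀ c a, a ≠ c → s a * t a c = -(s c * t c a)) :
    ∑ c, s c • ∑ a, t c a • F c a =
      ∑ c, s c • (s c • F c c + ∑ a with a ≠ c, t c a • R a c) := by
  have hS : ∑ c, ∑ a, (if a ≠ c then (s c * t c a) • T c a else 0) = 0 := by
    have h1 : ∑ c, ∑ a, (if a ≠ c then (s c * t c a) • T c a else 0) =
        -∑ c, ∑ a, (if a ≠ c then (s c * t c a) • T c a else 0) := by
      conv_lhs => rw [Finset.sum_comm]
      simp only [← Finset.sum_neg_distrib]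
      refine Finset.sum_congr rfl fun c _ => Finset.sum_congr rfl fun a _ => ?_
      by_cases hac : a = c
      · simp [hac]
      · rw [if_pos (Ne.symm hac), if_pos hac, hst c a hac, neg_smul, hT c a hac]
    ext k
    have h2 := DFunLike.congr_fun h1 k
    rw [Finsupp.neg_apply] at h2
    rw [Finsupp.zero_apply]
    omega
  have hR : ∑ c, s c • ∑ a with a ≠ c, t c a • R a c =
      ∑ c, ∑ a, (if a ≠ c then -((s c * t c a) • R c a) else 0) := by
    simp only [Finset.smul_sum, Finset.sum_filter]
    rw [Finset.sum_comm]
    refine Finset.sum_congr rfl fun c _ => Finset.sum_congr rfl fun a _ => ?_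
    by_cases hac : a = c
    · simp [hac]
    · rw [if_pos (Ne.symm hac), if_pos hac, smul_smul, hst c a hac, neg_smul]
  simp only [smul_add, Finset.sum_add_distrib]
  rw [hR]
  refine Eq.trans ?_ ((congrArg (_ + ·) hS).trans (add_zero _))
  rw [add_assoc, ← Finset.sum_add_distrib, ← Finset.sum_add_distrib]
  refine Finset.sum_congr rfl fun c _ => ?_
  rw [← Finset.sum_add_distrib, Finset.smul_sum, ← Finset.add_sum_erase _ _ (Finset.mem_univ c),
    hs c, ← Finset.add_sum_erase Finset.univ
      (fun a => (if a ≠ c then -((s c * t c a) • R c a) else 0) +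
        if a ≠ c then (s c * t c a) • T c a else 0) (Finset.mem_univ c)]
  simp only [ne_eq, not_true, if_false, zero_add, add_zero]
  congr 1
  refine Finset.sum_congr rfl fun a ha => ?_
  have hac := Finset.ne_of_mem_erase ha
  rw [if_pos hac, if_pos hac, hF c a hac, smul_smul, smul_sub]
  abel

/-- The boundary of a shuffle product is the Leibniz sum of the shuffle products with the boundary
of one factor. The term `ptTerm w` is due to `Bar.rawD` being augmented: it sends a list of length
one to the empty list. -/
lemma rawDL_ez (ρ : C → C → ℤ) (hρ : ∀ c, ρ c c = 0)
    (hρ' : ∀ a c, a ≠ c → ksign (ρ a c) = -ksign (ρ c a)) (w : ∀ c, List (X c)) :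
    Bar.rawDL (ez ρ w) = ptTerm w + ∑ c, stepSign ρ w c • faceSum ρ w c := by
  induction w using pop_induction with
  | nil w a h =>
    rw [ez_of_nil ρ a h, map_zero, ptTerm, if_neg fun h1 => by simpa [h] using h1 a,
      Finset.sum_eq_zero fun c _ => by rw [faceSum_of_nil ρ h, smul_zero], add_zero]
  | step w h ih =>
    have hpt : Bar.rawDL (ptTerm w) = 0 := by
      unfold ptTerm
      split_ifs
      · rw [Bar.rawDL_single, Bar.rawD_nil]
      · exact map_zero _
    rw [ez_eq ρ h, Bar.rawDL_cone, map_add, hpt, zero_add, add_sub_assoc, add_right_inj]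
    simp only [map_sum Bar.rawDL, map_zsmul, ih, faceSum_eq ρ (h _), smul_sub,
      Finset.sum_sub_distrib, restSum_eq ρ hρ h]
    congr 1
    have key := leibniz_cancel (stepSign ρ w) (fun c a => stepSign ρ (pop w c) a)
      (fun c a => faceSum ρ (pop w c) a) (fun c a => restSum ρ (pop w c) a)
      (fun c a => ez ρ (pop (pop w c) a))
      (fun c a hac => faceSum_eq ρ (by rw [pop_of_ne w hac]; exact h a))
      (fun c a hac => by rw [pop_pop_comm w hac])
      (fun c => stepSign_congr (hρ c) fun a hac => by rw [pop_of_ne w hac])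
      (fun c a hac => by
        simp only [stepSign_pop (h _), hρ' a c hac]
        ring)
    simp only [← map_zsmul (Bar.cone (heads w)), ← map_sum (Bar.cone (heads w))]
    congr 1
    simp only [smul_add, Finset.sum_add_distrib] at key ⊢
    rw [key, add_assoc]

end Boundary

/-! ### Multilinear extension and iteration of shuffle products -/

section Linear

variable {C : Type} [Fintype C] [DecidableEq C] {X : C → Type} [∀ c, Inhabited (X c)]

/-- The multilinear extension of the shuffle product. -/
noncomputable def ezL (ρ : C → C → ℤ) (y : ∀ c, List (X c) →₀ ℤ) : List (∀ c, X c) →₀ ℤ :=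
  multiExt (ez ρ) y

lemma ezL_single (ρ : C → C → ℤ) (w : ∀ c, List (X c)) :
    ezL ρ (fun c => Finsupp.single (w c) 1) = ez ρ w := multiExt_single _ w

lemma ezL_multiAdd (ρ : C → C → ℤ) : MultiAdd (ezL (X := X) ρ) := multiExt_multiAdd _

lemma ezL_mapL {Y : C → Type} [∀ c, Inhabited (Y c)] (ρ : C → C → ℤ) (φ : ∀ c, X c → Y c)
    (y : ∀ c, List (X c) →₀ ℤ) :
    ezL ρ (fun c => mapL (φ c) (y c)) = mapL (fun x c => φ c (x c)) (ezL ρ y) := by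
  refine MultiAdd.ext_on ((ezL_multiAdd ρ).comp_map fun c => (mapL (φ c)).toAddMonoidHom)
    ((ezL_multiAdd ρ).map (mapL fun x c => φ c (x c)).toAddMonoidHom) y fun v _ => ?_
  change ezL ρ (fun c => mapL (φ c) _) = mapL _ _
  simp only [mapL_single]
  rw [ezL_single, ezL_single, ez_map]

/-- A shuffle product vanishes if one of its factors is a combination of empty lists. -/
lemma ezL_eq_zero (ρ : C → C → ℤ) (y : ∀ c, List (X c) →₀ ℤ) (c : C) (h : y c ∈ homog (X c) (-1)) :
    ezL ρ y = 0 := by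
  have h0 : MultiAdd fun _ : ∀ c, List (X c) →₀ ℤ => (0 : List (∀ c, X c) →₀ ℤ) :=
    fun _ _ _ _ _ _ _ => (add_zero 0).symm
  refine (ezL_multiAdd ρ).ext_on h0 y fun v hv => ?_
  rw [ezL_single, ez_of_nil ρ c]
  have := length_of_mem_homog h (hv c)
  rw [← List.length_eq_zero_iff]
  omega

lemma ezL_cone (ρ : C → C → ℤ) (g : ∀ c, X c) (D : C → ℤ) (y : ∀ c, List (X c) →₀ ℤ)
    (hy : ∀ c, y c ∈ homog (X c) (D c - 1)) :
    ezL ρ (fun c => Bar.cone (g c) (y c)) = Bar.cone g ((∏ c, y c []) • Finsupp.single [] 1 +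
      ∑ c, ksign (∑ a, ρ a c * D a) •
        ezL ρ (Function.update (fun c => Bar.cone (g c) (y c)) c (y c))) := by
  refine MultiAdd.ext_on ((ezL_multiAdd ρ).comp_map fun c => (Bar.cone (g c)).toAddMonoidHom)
    (g := fun y => Bar.cone g ((∏ c, y c []) • Finsupp.single [] 1 +
      ∑ c, ksign (∑ a, ρ a c * D a) •
        ezL ρ (Function.update (fun c => Bar.cone (g c) (y c)) c (y c)))) ?_ y fun v hv => ?_
  · refine MultiAdd.map (MultiAdd.add ?_ (MultiAdd.sum _ fun c _ => MultiAdd.smul _ ?_))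
      (Bar.cone g).toAddMonoidHom
    · exact (MultiAdd.prod fun c => Finsupp.applyAddHom ([] : List (X c))).map
        ((zmultiplesHom _) (Finsupp.single [] (1 : ℤ)))
    · have := (ezL_multiAdd (X := X) ρ).comp_map (A' := fun c => List (X c) →₀ ℤ) fun a =>
        if a = c then AddMonoidHom.id _ else (Bar.cone (g a)).toAddMonoidHom
      convert this using 3 with y
      funext a
      by_cases hac : a = c
      · subst hac; simp
      · simp [hac]
  · have hlen : ∀ c, ((v c).length : ℤ) = D c := fun c => by
      have := length_of_mem_homog (hy c) (hv c)
      omega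
    change ezL ρ (fun c => Bar.cone (g c) (Finsupp.single (v c) 1)) = _
    simp only [Bar.cone_single]
    rw [ezL_single, ez_eq ρ fun c => by simp]
    congr 1
    congr 1
    · unfold ptTerm
      by_cases h : ∀ c, (v c) = []
      · rw [if_pos fun c => by simp [h c], Finset.prod_eq_one fun c _ => by rw [h c]; simp,
          one_smul]
      · rw [if_neg fun h' => h fun c => by simpa using h' c]
        push Not at h
        obtain ⟨c, hc⟩ := h
        rw [Finset.prod_eq_zero (Finset.mem_univ c) (by simp [hc]), zero_smul]
    · refine Finset.sum_congr rfl fun c _ => ?_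
      congr 1
      · unfold stepSign dg
        congr 1
        refine Finset.sum_congr rfl fun a _ => ?_
        rw [List.length_cons, ← hlen a]
        push_cast
        ring
      · rw [← ezL_single]
        congr 1
        funext a
        by_cases hac : a = c
        · subst hac; simp [pop]
        · simp [pop, hac]

lemma cone_apply_nil {G : Type} (g : G) (y : List G →₀ ℤ) : Bar.cone g y [] = 0 := by
  rw [Bar.cone, Finsupp.lmapDomain_apply]
  exact Finsupp.mapDomain_of_notMem_range _ _ (by simp)

lemma ez_apply_nil (ρ : C → C → ℤ) (w : ∀ c, List (X c)) : ez ρ w [] = 0 := by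
  by_cases h : ∀ c, w c ≠ []
  · rw [ez_eq ρ h, cone_apply_nil]
  · push Not at h
    obtain ⟨c, hc⟩ := h
    rw [ez_of_nil ρ c hc]; rfl

end Linear

/-- Shuffle products of shuffle products are shuffle products over the disjoint union of the index
sets, ordered lexicographically. -/
lemma ez_sigma {B : Type} [Fintype B] [DecidableEq B] {F : B → Type} [∀ b, Fintype (F b)]
    [∀ b, DecidableEq (F b)] {X : (Σ b, F b) → Type} [∀ p, Inhabited (X p)] {ρB : B → B → ℤ}
    {ρF : ∀ b, F b → F b → ℤ} {ρ : (Σ b, F b) → (Σ b, F b) → ℤ} (hB : ∀ b, ρB b b = 0)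
    (hsame : ∀ b f f', ρ ⟨b, f⟩ ⟨b, f'⟩ = ρF b f f')
    (hdiff : ∀ b b' f f', b ≠ b' → ρ ⟨b, f⟩ ⟨b', f'⟩ = ρB b b') (w : ∀ p, List (X p)) :
    ezL ρB (fun b => ez (ρF b) fun f => w ⟨b, f⟩) =
      mapL (fun x b f => x ⟨b, f⟩) (ez ρ w) := by
  induction w using pop_induction with
  | nil w p h =>
    rw [ez_of_nil ρ p h, map_zero]
    exact (ezL_multiAdd ρB).map_eq_zero p.1 (ez_of_nil _ p.2 h)
  | step w h ih =>
    set E : ∀ b, List (∀ f, X ⟨b, f⟩) →₀ ℤ := fun b => ez (ρF b) fun f => w ⟨b, f⟩ with hE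
    set Y : ∀ b, List (∀ f, X ⟨b, f⟩) →₀ ℤ := fun b => ptTerm (fun f => w ⟨b, f⟩) +
      ∑ f, stepSign (ρF b) (fun f => w ⟨b, f⟩) f • ez (ρF b) (pop (fun f => w ⟨b, f⟩) f) with hY
    have hEY : E = fun b => Bar.cone (heads fun f => w ⟨b, f⟩) (Y b) := by
      funext b
      exact ez_eq (ρF b) fun f => h ⟨b, f⟩
    have hYh : ∀ b, Y b ∈ homog (∀ f, X ⟨b, f⟩) (∑ f, dg w ⟨b, f⟩ - 1) := fun b => by
      refine Submodule.add_mem _ (ptTerm_mem_homog _)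
        (Submodule.sum_mem _ fun f _ => Submodule.smul_mem _ _ ?_)
      have := ez_mem_homog (ρF b) (pop (fun f => w ⟨b, f⟩) f)
      rwa [sum_dg_pop (w := fun f => w ⟨b, f⟩) (h ⟨b, f⟩)] at this
    have hpop : ∀ b f, Function.update E b (ez (ρF b) (pop (fun f => w ⟨b, f⟩) f)) =
        fun b' => ez (ρF b') fun f' => pop w ⟨b, f⟩ ⟨b', f'⟩ := by
      intro b f
      funext b'
      by_cases hb : b' = b
      · subst hb
        rw [Function.update_self]
        congr 1
        exact (Function.update_comp_eq_of_injective' w sigma_mk_injective f _).symm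
      · rw [Function.update_of_ne hb]
        refine congrArg (ez (ρF b')) (funext fun f' => ?_)
        rw [pop_of_ne w fun h' => hb (congrArg Sigma.fst h')]
    have hstep : ∀ b, ezL ρB (Function.update E b (Y b)) =
        ∑ f, stepSign (ρF b) (fun f => w ⟨b, f⟩) f •
          mapL (fun x b f => x ⟨b, f⟩) (ez ρ (pop w ⟨b, f⟩)) := by
      intro b
      have h1 : ezL ρB (Function.update E b (ptTerm fun f => w ⟨b, f⟩)) = 0 := by
        refine ezL_eq_zero ρB _ b ?_
        rw [Function.update_self]
        unfold ptTerm
        split_ifs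
        · exact single_mem_homog (by simp)
        · exact Submodule.zero_mem _
      rw [← (ezL_multiAdd ρB).slot_apply, hY, map_add, map_sum, (ezL_multiAdd ρB).slot_apply, h1,
        zero_add]
      refine Finset.sum_congr rfl fun f _ => ?_
      rw [map_zsmul, (ezL_multiAdd ρB).slot_apply, hpop, ih]
    rw [ez_eq ρ h, mapL_cone]
    have h2 := ezL_cone ρB (fun b => heads fun f => w ⟨b, f⟩) _ Y hYh
    rw [← hEY] at h2
    rw [h2]
    congr 1
    rw [map_add, map_sum, Fintype.sum_sigma]
    congr 1
    · have hYnil : ∀ b, Y b [] = if ∀ f, (w ⟨b, f⟩).length = 1 then 1 else 0 := fun b => by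
        rw [hY]
        simp only [Finsupp.add_apply, Finsupp.finsetSum_apply, Finsupp.smul_apply, ez_apply_nil,
          smul_zero, Finset.sum_const_zero, add_zero]
        unfold ptTerm
        split_ifs <;> simp
      unfold ptTerm
      by_cases h1 : ∀ p, (w p).length = 1
      · rw [if_pos h1, mapL_single, Finset.prod_eq_one fun b _ => by
          rw [hYnil, if_pos fun f => h1 ⟨b, f⟩], one_smul]
        rfl
      · rw [if_neg h1, map_zero]
        push Not at h1
        obtain ⟨⟨b, f⟩, hbf⟩ := h1
        rw [Finset.prod_eq_zero (Finset.mem_univ b) (by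
          rw [hYnil, if_neg fun h' => hbf (h' f)]), zero_smul]
    · refine Finset.sum_congr rfl fun b _ => ?_
      rw [hstep, Finset.smul_sum]
      refine Finset.sum_congr rfl fun f _ => ?_
      rw [map_zsmul, smul_smul]
      congr 1
      rw [stepSign, stepSign, ← ksign_add]
      congr 1
      rw [Fintype.sum_sigma, ← Finset.add_sum_erase _ _ (Finset.mem_univ b),
        ← Finset.add_sum_erase (a := b) _ (fun a => ∑ f', ρ ⟨a, f'⟩ ⟨b, f⟩ * dg w ⟨a, f'⟩)
          (Finset.mem_univ b), hB, zero_mul, zero_add, add_comm]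
      congr 1
      · exact Finset.sum_congr rfl fun f' _ => by rw [hsame]; rfl
      · refine Finset.sum_congr rfl fun a ha => ?_
        rw [Finset.mul_sum]
        exact Finset.sum_congr rfl fun f' _ => by rw [hdiff _ _ _ _ (Finset.ne_of_mem_erase ha)]

/-! ### Shuffle products as sums over lattice paths -/

namespace Smith

lemma count_eq_sum {N r : ℕ} (s : Fin N → Fin r) (c : Fin r) (t : ℕ) :
    count s c t = ∑ u : Fin N, if (u : ℕ) < t ∧ s u = c then 1 else 0 := by
  rw [count, Finset.card_filter]

lemma count_zero {N r : ℕ} (s : Fin N → Fin r) (c : Fin r) : count s c 0 = 0 := by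
  simp [count_eq_sum]

lemma count_cons {N r : ℕ} (s : Fin N → Fin r) (a c : Fin r) (t : ℕ) :
    count (Fin.cons a s : Fin (N + 1) → Fin r) c (t + 1) =
      count s c t + if c = a then 1 else 0 := by
  rw [count_eq_sum, Fin.sum_univ_succ, count_eq_sum, add_comm]
  simp [eq_comm]

lemma inversions_cons {N r : ℕ} (s : Fin N → Fin r) (a : Fin r) :
    inversions (Fin.cons a s : Fin (N + 1) → Fin r) =
      inversions s + ∑ c with c < a, count s c N := by
  have h : ∑ c with c < a, count s c N = ∑ u : Fin N, if s u < a then 1 else 0 := by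
    simp only [count_eq_sum, Fin.is_lt, true_and]
    rw [Finset.sum_comm]
    refine Finset.sum_congr rfl fun u _ => ?_
    rw [Finset.sum_ite_eq]
    simp
  rw [h, inversions, inversions, Finset.card_filter, Finset.card_filter, Fintype.sum_prod_type,
    Fintype.sum_prod_type, Fin.sum_univ_succ, add_comm]
  congr 1
  · refine Finset.sum_congr rfl fun u _ => ?_
    rw [Fin.sum_univ_succ]
    simp
  · rw [Fin.sum_univ_succ]
    simp [Fin.succ_pos]

end Smith

/-- The matrix of a strict order. -/
def ltMatrix {C : Type} [LT C] [DecidableLT C] (a c : C) : ℤ := if a < c then 1 else 0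

section Path

variable {k : ℕ} {X : Fin k → Type} [∀ c, Inhabited (X c)]

/-- The shuffle product as a sum over lattice paths. -/
lemma ez_eq_sum_paths (g : ∀ c, X c) (N : ℕ) (w : ∀ c, List (X c)) (hN : ∑ c, dg w c = N) :
    ez ltMatrix w = ∑ s : Fin N → Fin k with ∀ c, Smith.count s c N + 1 = (w c).length,
      (-1 : ℤ) ^ Smith.inversions s • Finsupp.single
        ((List.range (N + 1)).map fun t c => (w c).getD (Smith.count s c t) (g c)) 1 := by
  by_cases h : ∀ c, w c ≠ []
  swap
  · push Not at h
    obtain ⟨c, hc⟩ := h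
    rw [ez_of_nil _ c hc, Finset.filter_false_of_mem fun s _ hs => ?_, Finset.sum_empty]
    have := hs c
    simp [hc] at this
  induction N generalizing w with
  | zero =>
    have hlen : ∀ c, 0 < (w c).length := fun c => List.length_pos_iff.2 (h c)
    have hpt : ∀ c, (w c).length = 1 := fun c => by
      have hnn : ∀ a ∈ Finset.univ, 0 ≤ dg w a := fun a _ => by
        have := hlen a
        simp only [dg]; omega
      have h0 : ((w c).length : ℤ) - 1 = 0 :=
        (Finset.sum_eq_zero_iff_of_nonneg hnn).1 hN c (Finset.mem_univ c)
      omega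
    rw [ez_eq _ h, ptTerm, if_pos hpt, Finset.sum_eq_zero, add_zero, Bar.cone_single,
      Finset.filter_true_of_mem]
    · rw [Fintype.sum_unique, Smith.inversions]
      simp only [Finset.univ_eq_empty, Finset.filter_empty, Finset.card_empty, pow_zero, one_smul]
      congr 1
      simp only [zero_add, List.range_one, List.map_cons, List.map_nil, List.cons.injEq, and_true]
      funext c
      obtain ⟨x, hx⟩ := List.length_eq_one_iff.1 (hpt c)
      simp [heads, hx, Smith.count_zero]
    · intro s _ c
      rw [Smith.count_zero, hpt c]
    · intro c _
      rw [ez_of_nil _ c, smul_zero]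
      rw [pop_self, ← List.length_eq_zero_iff, List.length_tail, hpt c]
  | succ N ih =>
    have hpt : ptTerm w = 0 := by
      rw [ptTerm, if_neg fun h1 => ?_]
      rw [Finset.sum_eq_zero fun c _ => dg_eq_zero_of_pt h1 c] at hN
      omega
    have hcond : ∀ (a : Fin k) (s : Fin N → Fin k),
        (∀ c, Smith.count (Fin.cons a s : Fin (N + 1) → Fin k) c (N + 1) + 1 = (w c).length) ↔
          ∀ c, Smith.count s c N + 1 = (pop w a c).length := by
      intro a s
      refine forall_congr' fun c => ?_
      have := List.length_pos_iff.2 (h c)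
      rw [Smith.count_cons]
      by_cases hc : c = a
      · subst hc; rw [pop_self, List.length_tail, if_pos rfl]; omega
      · rw [pop_of_ne w hc, if_neg hc]
    have hterm : ∀ a, ez ltMatrix (pop w a) = ∑ s : Fin N → Fin k with
        ∀ c, Smith.count s c N + 1 = (pop w a c).length,
          (-1 : ℤ) ^ Smith.inversions s • Finsupp.single ((List.range (N + 1)).map fun t c =>
            (pop w a c).getD (Smith.count s c t) (g c)) 1 := by
      intro a
      have hN' : ∑ c, dg (pop w a) c = N := by
        rw [sum_dg_pop (h a), hN]; push_cast; ring
      by_cases ha : (w a).tail = []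
      · rw [ez_of_nil _ a (by rw [pop_self, ha]), Finset.filter_false_of_mem fun s _ hs => ?_,
          Finset.sum_empty]
        have := hs a
        rw [pop_self, ha] at this
        simp at this
      · refine ih _ hN' fun c => ?_
        by_cases hc : c = a
        · subst hc; rwa [pop_self]
        · rw [pop_of_ne w hc]; exact h c
    rw [ez_eq _ h, hpt, zero_add, map_sum, Finset.sum_filter,
      ← Equiv.sum_comp (Fin.consEquiv fun _ : Fin (N + 1) => Fin k), Fintype.sum_prod_type]
    refine Finset.sum_congr rfl fun a _ => ?_
    rw [hterm, map_zsmul, map_sum, Finset.smul_sum, Finset.sum_filter]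
    refine Finset.sum_congr rfl fun s _ => ?_
    change _ = if ∀ c, Smith.count (Fin.cons a s : Fin (N + 1) → Fin k) c (N + 1) + 1 =
      (w c).length then (-1 : ℤ) ^ Smith.inversions (Fin.cons a s : Fin (N + 1) → Fin k) • _ else 0
    simp only [hcond]
    by_cases hs : ∀ c, Smith.count s c N + 1 = (pop w a c).length
    · rw [if_pos hs, if_pos hs, map_zsmul, Bar.cone_single, smul_smul]
      congr 1
      · rw [Smith.inversions_cons, pow_add, mul_comm, stepSign]
        congr 1
        rw [← ksign_natCast]
        congr 1
        push_cast
        rw [Finset.sum_filter]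
        refine Finset.sum_congr rfl fun c _ => ?_
        unfold ltMatrix
        split_ifs with hca
        · have := hs c
          rw [pop_of_ne w hca.ne] at this
          rw [dg, ← this]; push_cast; ring
        · ring
      · congr 1
        rw [List.range_succ_eq_map (n := N + 1), List.map_cons, List.map_map]
        congr 1
        · funext c
          obtain ⟨x, l, hl⟩ := List.exists_cons_of_ne_nil (h c)
          simp [heads, hl, Smith.count_zero]
        · refine List.map_congr_left fun t _ => ?_
          funext c
          change _ = (w c).getD (Smith.count (Fin.cons a s : Fin (N + 1) → Fin k) c (t + 1)) (g c)
          rw [Smith.count_cons]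
          by_cases hc : c = a
          · subst hc
            obtain ⟨x, l, hl⟩ := List.exists_cons_of_ne_nil (h c)
            rw [pop_self, if_pos rfl, hl]; simp
          · rw [pop_of_ne w hc, if_neg hc, add_zero]
    · rw [if_neg hs, if_neg hs]

end Path

/-! ### Block permutations and the composition of permutations -/

section Blocks

variable {r n : ℕ+} {i : Fin r → ℕ+}

lemma blockEquiv_val (hn : ∑ j, (i j : ℕ) = n) (j : Fin r) (t : Fin (i j)) :
    (blockEquiv hn ⟨j, t⟩ : ℕ) = ∑ a with a < j, (i a : ℕ) + t := by
  change (finSigmaFinEquiv (n := fun j => (i j : ℕ)) ⟨j, t⟩ : ℕ) = _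
  rw [finSigmaFinEquiv_apply]
  congr 1
  refine Finset.sum_bij' (fun a _ => Fin.castLE j.2.le a) (fun a ha => ⟨a, ?_⟩) ?_ ?_ ?_ ?_ ?_
  · exact (Finset.mem_filter.1 ha).2
  all_goals simp
  intro a
  exact a.2

lemma blockEquiv_lt_iff (hn : ∑ j, (i j : ℕ) = n) (j j' : Fin r) (t : Fin (i j))
    (t' : Fin (i j')) : blockEquiv hn ⟨j', t'⟩ < blockEquiv hn ⟨j, t⟩ ↔
      j' < j ∨ j' = j ∧ (t' : ℕ) < t := by
  have hlt : ∀ (j j' : Fin r) (t : Fin (i j)) (t' : Fin (i j')), j' < j →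
      blockEquiv hn ⟨j', t'⟩ < blockEquiv hn ⟨j, t⟩ := by
    intro j j' t t' h
    rw [Fin.lt_def, blockEquiv_val, blockEquiv_val]
    have h1 : ∑ a with a < j', (i a : ℕ) + i j' ≤ ∑ a with a < j, (i a : ℕ) := by
      rw [add_comm, ← Finset.sum_insert (f := fun a => (i a : ℕ))
        (s := Finset.univ.filter (· < j')) (by simp)]
      refine Finset.sum_le_sum_of_subset fun a ha => ?_
      simp only [Finset.mem_insert, Finset.mem_filter, Finset.mem_univ, true_and] at ha ⊢
      rcases ha with rfl | ha
      · exact h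
      · exact ha.trans h
    have := t'.2
    omega
  rcases lt_trichotomy j' j with h | h | h
  · simp [h, hlt j j' t t' h]
  · subst h
    rw [Fin.lt_def, blockEquiv_val, blockEquiv_val]
    simp
  · have := (hlt j' j t' t h).not_gt
    simp only [this, h.not_gt, h.ne', false_and, or_self]

lemma sum_lt_blockEquiv (hn : ∑ j, (i j : ℕ) = n) (f : Fin n → ℕ) (j : Fin r) (t : Fin (i j)) :
    ∑ a with a < blockEquiv hn ⟨j, t⟩, f a =
      ∑ a with a < j, ∑ l, f (blockEquiv hn ⟨a, l⟩) +
        ∑ l with l < t, f (blockEquiv hn ⟨j, l⟩) := by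
  rw [Finset.sum_filter, ← Equiv.sum_comp (blockEquiv hn), Fintype.sum_sigma]
  have h : ∀ a l, (if blockEquiv hn ⟨a, l⟩ < blockEquiv hn ⟨j, t⟩ then f (blockEquiv hn ⟨a, l⟩)
      else 0) = (if a < j then f (blockEquiv hn ⟨a, l⟩) else 0) +
        if a = j ∧ (l : ℕ) < t then f (blockEquiv hn ⟨a, l⟩) else 0 := by
    intro a l
    simp only [blockEquiv_lt_iff]
    by_cases h1 : a < j
    · simp [h1, h1.ne]
    · simp [h1]
  simp only [h, Finset.sum_add_distrib]
  congr 1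
  · rw [Finset.sum_filter]
    refine Finset.sum_congr rfl fun a _ => ?_
    split_ifs <;> simp
  · rw [Finset.sum_eq_single j]
    · simp [Finset.sum_filter]
    · intro a _ ha
      simp [ha]
    · simp

lemma permComp_blockEquiv (hn : ∑ j, (i j : ℕ) = n) (w : Equiv.Perm (Fin r))
    (v : ∀ j, Equiv.Perm (Fin (i j))) (l : Fin r) (t : Fin (i (w l))) :
    permComp hn w v (blockEquiv (i := fun l => i (w l)) (sum_comp_perm hn w) ⟨l, t⟩) =
      blockEquiv hn ⟨w l, v (w l) t⟩ := by
  simp only [permComp, Equiv.trans_apply, Equiv.symm_apply_apply]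
  rfl

lemma permComp_val (hn : ∑ j, (i j : ℕ) = n) (w : Equiv.Perm (Fin r))
    (v : ∀ j, Equiv.Perm (Fin (i j))) (a : Fin n) (l : Fin r) (t : Fin (i (w l)))
    (h : (a : ℕ) = ∑ b with b < l, (i (w b) : ℕ) + t) :
    (permComp hn w v a : ℕ) = ∑ b with b < w l, (i b : ℕ) + v (w l) t := by
  rw [← blockEquiv_val (i := i) hn, ← permComp_blockEquiv]
  congr 2
  refine Fin.ext ?_
  rw [h, blockEquiv_val]

lemma permComp_one (hn : ∑ j, (i j : ℕ) = n) : permComp hn 1 (fun _ => 1) = 1 := by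
  refine Equiv.ext fun a => ?_
  obtain ⟨⟨l, t⟩, rfl⟩ := (blockEquiv hn).surjective a
  exact permComp_blockEquiv hn 1 (fun _ => 1) l t

lemma permComp_act_right (hn : ∑ j, (i j : ℕ) = n) (w : Equiv.Perm (Fin r))
    (τ v : ∀ j, Equiv.Perm (Fin (i j))) :
    permComp hn w (fun j => (τ j)⁻¹ * v j) = (sumPerm hn τ)⁻¹ * permComp hn w v := by
  rw [eq_inv_mul_iff_mul_eq]
  refine Equiv.ext fun a => ?_
  obtain ⟨⟨l, t⟩, rfl⟩ :=
    (blockEquiv (i := fun l => i (w l)) (sum_comp_perm hn w)).surjective a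
  rw [Equiv.Perm.mul_apply, permComp_blockEquiv, permComp_blockEquiv]
  simp [sumPerm]

lemma permComp_act_left (hn : ∑ j, (i j : ℕ) = n) (σ w : Equiv.Perm (Fin r))
    (hn' : ∑ j, (i (σ.symm j) : ℕ) = n) (v : ∀ j, Equiv.Perm (Fin (i j))) :
    permComp hn (σ⁻¹ * w) v =
      (blockPerm hn σ)⁻¹ * permComp hn' w (fun j => v (σ.symm j)) := by
  rw [eq_inv_mul_iff_mul_eq]
  refine Equiv.ext fun a => ?_
  obtain ⟨⟨l, t⟩, rfl⟩ :=
    (blockEquiv (i := fun l => i (σ.symm (w l))) (sum_comp_perm hn' w)).surjective a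
  rw [Equiv.Perm.mul_apply]
  refine (congrArg (blockPerm hn σ) (permComp_blockEquiv hn (σ⁻¹ * w) v l t)).trans
    (Eq.trans ?_ (permComp_blockEquiv hn' w (fun j => v (σ.symm j)) l t).symm)
  simp only [blockPerm, Equiv.trans_apply, Equiv.symm_apply_apply]
  congr 1
  rw [Equiv.symm_apply_eq]
  rfl

/-- The composition of permutations is associative. -/
lemma permComp_assoc {s : ℕ+} {a : Fin r → ℕ+} {c : ∀ j, Fin (i j) → ℕ+}
    (hs : ∑ j, (i j : ℕ) = s) (ha : ∀ j, ∑ l, (c j l : ℕ) = a j) (hn : ∑ j, (a j : ℕ) = n)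
    (hn' : ∑ t, (c ((blockEquiv hs).symm t).1 ((blockEquiv hs).symm t).2 : ℕ) = n)
    (x : Equiv.Perm (Fin r)) (y : ∀ j, Equiv.Perm (Fin (i j)))
    (z : ∀ j l, Equiv.Perm (Fin (c j l))) :
    permComp hn' (permComp hs x y)
        (fun t => z ((blockEquiv hs).symm t).1 ((blockEquiv hs).symm t).2) =
      permComp hn x (fun j => permComp (ha j) (y j) (z j)) := by
  have hval : ∀ (b : Fin n) (l : Fin s) (q : Σ j, Fin (i j))
      (_ : (blockEquiv hs).symm (permComp hs x y l) = q) (t : Fin (c q.1 q.2))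
      (_ : (b : ℕ) = ∑ d with d < l, (c ((blockEquiv hs).symm (permComp hs x y d)).1
        ((blockEquiv hs).symm (permComp hs x y d)).2 : ℕ) + t),
      (permComp hn' (permComp hs x y)
        (fun t => z ((blockEquiv hs).symm t).1 ((blockEquiv hs).symm t).2) b : ℕ) =
      ∑ d with d < permComp hs x y l,
        (c ((blockEquiv hs).symm d).1 ((blockEquiv hs).symm d).2 : ℕ) + z q.1 q.2 t := by
    rintro b l q rfl t h
    exact permComp_val hn' (permComp hs x y) _ b l t h
  refine Equiv.ext fun b => ?_
  obtain ⟨⟨l, d⟩, rfl⟩ := (blockEquiv (i := fun l => a (x l)) (sum_comp_perm hn x)).surjective b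
  obtain ⟨⟨t', t⟩, rfl⟩ := (blockEquiv (i := fun t => c (x l) (y (x l) t))
    (sum_comp_perm (ha (x l)) (y (x l)))).surjective d
  rw [permComp_blockEquiv, permComp_blockEquiv]
  refine Fin.ext ?_
  have hP : ∀ l t', permComp hs x y (blockEquiv (i := fun l => i (x l)) (sum_comp_perm hs x)
      ⟨l, t'⟩) = blockEquiv hs ⟨x l, y (x l) t'⟩ := permComp_blockEquiv hs x y
  have hP' : ∀ l t', (blockEquiv hs).symm (permComp hs x y (blockEquiv (i := fun l => i (x l))
      (sum_comp_perm hs x) ⟨l, t'⟩)) = ⟨x l, y (x l) t'⟩ := fun l t' => by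
    rw [hP, Equiv.symm_apply_apply]
  have hc : ∀ (d : Σ j, Fin (i j)) q, d = q → (c d.1 d.2 : ℕ) = c q.1 q.2 := by
    rintro d _ rfl; rfl
  rw [hval _ (blockEquiv (i := fun l => i (x l)) (sum_comp_perm hs x) ⟨l, t'⟩)
    ⟨x l, y (x l) t'⟩ (hP' _ _) t]
  · rw [hP, sum_lt_blockEquiv, blockEquiv_val, blockEquiv_val]
    simp only [hc _ _ (Equiv.symm_apply_apply (blockEquiv hs) _), ha]
    rw [add_assoc]
  · rw [sum_lt_blockEquiv, blockEquiv_val, blockEquiv_val]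
    simp only [hc _ _ (hP' _ _)]
    rw [← add_assoc]
    congr 2
    refine Finset.sum_congr rfl fun l' _ => ?_
    rw [← ha (x l')]
    exact (Equiv.sum_comp (y (x l')) fun t => (c (x l') t : ℕ)).symm

end Blocks

/-! ### The normalization of lists of permutations -/

section Normalization

variable {n : ℕ+} {k l : ℤ}

lemma rawDL_mem_homog {X : Type} {y : List X →₀ ℤ} (hy : y ∈ homog X k) (h : l + 1 = k) :
    Bar.rawDL y ∈ homog X l := by
  rw [Bar.rawDL, Finsupp.linearCombination_apply]
  refine Submodule.sum_mem _ fun w hw => Submodule.smul_mem _ _ (Submodule.sum_mem _ fun a ha =>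
    Submodule.smul_mem _ _ (single_mem_homog ?_))
  have := length_of_mem_homog hy hw
  rw [List.length_eraseIdx_of_lt (Finset.mem_range.1 ha)]
  have := Finset.mem_range.1 ha
  omega

lemma proj_apply (y : List (Equiv.Perm (Fin n)) →₀ ℤ) :
    Bar.proj n k y = ∑ w ∈ y.support, y w • Bar.simplex n k w := by
  rw [Bar.proj, Finsupp.linearCombination_apply, Finsupp.sum]

lemma proj_of_homog_neg_one {y : List (Equiv.Perm (Fin n)) →₀ ℤ}
    (hy : y ∈ homog (Equiv.Perm (Fin n)) (-1)) : Bar.proj n k y = 0 := by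
  rw [proj_apply]
  refine Finset.sum_eq_zero fun w hw => ?_
  have := length_of_mem_homog hy hw
  rw [Bar.simplex, dif_neg, smul_zero]
  rintro ⟨h, -⟩
  have := List.length_pos_iff.2 h
  omega

lemma d_proj (h : l + 1 = k) {y : List (Equiv.Perm (Fin n)) →₀ ℤ}
    (hy : y ∈ homog (Equiv.Perm (Fin n)) k) :
    Bar.d h (Bar.proj n k y) = Bar.proj n l (Bar.rawDL y) := by
  rw [proj_apply, Bar.rawDL, Finsupp.linearCombination_apply, Finsupp.sum]
  simp only [map_sum, map_zsmul]
  exact Finset.sum_congr rfl fun w hw => by rw [Bar.d_simplex h w (length_of_mem_homog hy hw)]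

lemma act_proj (τ : Equiv.Perm (Fin n)) (y : List (Equiv.Perm (Fin n)) →₀ ℤ) :
    Bar.act τ (Bar.proj n k y) = Bar.proj n k (mapL (τ⁻¹ * ·) y) := by
  refine finsupp_ext (f := (Bar.act τ).comp (Bar.proj n k).toAddMonoidHom)
    (g := (Bar.proj n k).toAddMonoidHom.comp (mapL (τ⁻¹ * ·)).toAddMonoidHom) (fun w => ?_) y
  change Bar.act τ (Bar.proj n k _) = Bar.proj n k (mapL _ _)
  rw [mapL_single, Bar.proj_single, Bar.proj_single, Bar.act_simplex]

lemma simplex_basis (w : Bar.Basis n k) : Bar.simplex n k w.1 = Finsupp.single w 1 := by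
  rw [Bar.simplex, dif_pos w.2]

lemma simplex_castDeg {k' : ℤ} (h : k = k') (w : List (Equiv.Perm (Fin n))) :
    castDeg (X := Bar.Chain) h (Bar.simplex n k w) = Bar.simplex n k' w := by
  subst h; rfl

end Normalization

/-! ### The composition of Smith's operad as a shuffle product -/

/-- The arities of the arguments of a composition `γ(x; y₁, …, y_r)`. -/
abbrev slotArity (r : ℕ+) (i : Fin r → ℕ+) : Fin ((r : ℕ) + 1) → ℕ+ := Fin.cons r i

/-- The vertices of the factors in a composition `γ(x; y₁, …, y_r)`. -/
abbrev Slot (r : ℕ+) (i : Fin r → ℕ+) (c : Fin ((r : ℕ) + 1)) : Type :=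
  Equiv.Perm (Fin (slotArity r i c))

/-- The composition of permutations as a map on tuples of vertices. -/
def vertexComp {r n : ℕ+} {i : Fin r → ℕ+} (hn : ∑ j, (i j : ℕ) = n) (x : ∀ c, Slot r i c) :
    Equiv.Perm (Fin n) :=
  permComp hn (x 0) fun j => x j.succ

namespace Smith

section Comp

variable {r n : ℕ+} {i : Fin r → ℕ+} {p m : ℤ} {q : Fin r → ℤ}

lemma basisComp_eq (hn : ∑ j, (i j : ℕ) = n) (hm : p + ∑ j, q j = m) (w : Bar.Basis r p)
    (v : ∀ j, Bar.Basis (i j) (q j)) :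
    basisComp hn w v = Bar.proj n m (mapL (vertexComp hn)
      (ez ltMatrix (X := Slot r i) (Fin.cons w.1 fun j => (v j).1))) := by
  have hp : 0 ≤ p := by
    have := List.length_pos_iff.2 w.2.1
    have := w.2.2.1
    omega
  have hq : ∀ j, 0 ≤ q j := fun j => by
    have := List.length_pos_iff.2 (v j).2.1
    have := (v j).2.2.1
    omega
  have hN : ∑ c, dg (X := Slot r i) (Fin.cons w.1 fun j => (v j).1) c = (m.toNat : ℤ) := by
    rw [Int.toNat_of_nonneg (by rw [← hm]; exact add_nonneg hp (Finset.sum_nonneg fun j _ => hq j)),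
      ← hm, Fin.sum_univ_succ]
    congr 1
    · change (w.1.length : ℤ) - 1 = p
      rw [w.2.2.1]; ring
    · refine Finset.sum_congr rfl fun j _ => ?_
      change ((v j).1.length : ℤ) - 1 = q j
      rw [(v j).2.2.1]; ring
  rw [ez_eq_sum_paths (fun _ => 1) m.toNat _ hN]
  simp only [map_sum, map_zsmul, mapL_single, Bar.proj_single, List.map_map]
  refine Finset.sum_congr ?_ fun s _ => rfl
  refine Finset.filter_congr fun s _ => forall_congr' fun c => ?_
  refine Fin.cases ?_ (fun j => ?_) c
  · have := w.2.2.1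
    change count s 0 m.toNat = p.toNat ↔ count s 0 m.toNat + 1 = w.1.length
    omega
  · have := (v j).2.2.1
    have := hq j
    change count s j.succ m.toNat = (q j).toNat ↔ count s j.succ m.toNat + 1 = (v j).1.length
    omega

lemma comp_eq_sum (hn : ∑ j, (i j : ℕ) = n) (x : Bar.Chain r p)
    (y : ∀ j, Bar.Chain (i j) (q j)) :
    (comp hn x y : Bar.Chain n m) = x.sum fun w a => a • multiExt (basisComp hn w) y := by
  unfold comp multiExt
  refine Finset.sum_congr rfl fun w _ => ?_
  refine Eq.trans ?_ Finset.smul_sum.symm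
  exact Finset.sum_congr rfl fun v _ => mul_smul _ _ _

lemma comp_single (hn : ∑ j, (i j : ℕ) = n) (w : Bar.Basis r p)
    (v : ∀ j, Bar.Basis (i j) (q j)) :
    (comp hn (Finsupp.single w 1) (fun j => Finsupp.single (v j) 1) : Bar.Chain n m) =
      basisComp hn w v := by
  rw [comp_eq_sum, Finsupp.sum_single_index (by rw [zero_smul]), one_smul, multiExt_single]

lemma comp_add_left (hn : ∑ j, (i j : ℕ) = n) {x x' x'' : Bar.Chain r p}
    {y y' y'' : ∀ j, Bar.Chain (i j) (q j)} (hx : x = x' + x'') (hy' : ∀ j, y' j = y j)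
    (hy'' : ∀ j, y'' j = y j) :
    (comp hn x y : Bar.Chain n m) = comp hn x' y' + comp hn x'' y'' := by
  obtain rfl := funext hy'
  obtain rfl := funext hy''
  rw [hx, comp_eq_sum, comp_eq_sum, comp_eq_sum]
  exact Finsupp.sum_add_index' (fun w => zero_smul _ _) fun w a b => add_smul _ _ _

lemma comp_multiAdd_right (hn : ∑ j, (i j : ℕ) = n) (x : Bar.Chain r p) :
    MultiAdd fun y : ∀ j, Bar.Chain (i j) (q j) => (comp hn x y : Bar.Chain n m) := by
  simp only [comp_eq_sum]
  exact MultiAdd.sum _ fun w _ => (multiExt_multiAdd _).smul _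

/-- The composition is additive in each of its arguments. -/
lemma comp_multiAdd (hn : ∑ j, (i j : ℕ) = n) :
    MultiAdd fun U : ∀ c, Bar.Chain (slotArity r i c) (Fin.cons (α := fun _ => ℤ) p q c) =>
      (comp hn (p := p) (q := q) (U 0) (fun j => U j.succ) : Bar.Chain n m) := by
  intro c
  refine Fin.cases ?_ (fun j => ?_) c
  · intro U U' U'' h' h'' h
    exact comp_add_left hn h (fun j => h' _ (Fin.succ_ne_zero j))
      fun j => h'' _ (Fin.succ_ne_zero j)
  · intro U U' U'' h' h'' h
    beta_reduce
    rw [h' 0 (Fin.succ_ne_zero j).symm, h'' 0 (Fin.succ_ne_zero j).symm]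
    exact comp_multiAdd_right hn (U 0) j _ _ _
      (fun a ha => h' _ fun h => ha (Fin.succ_injective _ h))
      (fun a ha => h'' _ fun h => ha (Fin.succ_injective _ h)) h

/-- The composition of normalizations of combinations of lists is the normalization of the image of
their shuffle product. -/
lemma comp_proj (hn : ∑ j, (i j : ℕ) = n) (hm : p + ∑ j, q j = m)
    (Z : ∀ c, List (Slot r i c) →₀ ℤ) (h0 : Z 0 ∈ homog (Equiv.Perm (Fin r)) p)
    (hZ : ∀ j : Fin r, Z j.succ ∈ homog (Equiv.Perm (Fin (i j))) (q j)) :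
    comp hn (Bar.proj r p (Z 0)) (fun j => Bar.proj (i j) (q j) (Z j.succ)) =
      Bar.proj n m (mapL (vertexComp hn) (ezL ltMatrix Z)) := by
  refine MultiAdd.ext_on
    (f := fun Z : ∀ c, List (Slot r i c) →₀ ℤ =>
      comp hn (Bar.proj r p (Z 0)) (fun j => Bar.proj (i j) (q j) (Z j.succ)))
    (g := fun Z => Bar.proj n m (mapL (vertexComp hn) (ezL ltMatrix Z)))
    ((comp_multiAdd hn).comp_map (A' := fun c => List (Slot r i c) →₀ ℤ)
      fun c => (Bar.proj (slotArity r i c) (Fin.cons (α := fun _ => ℤ) p q c)).toAddMonoidHom)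
    ((ezL_multiAdd _).map ((Bar.proj n m).comp (mapL (vertexComp hn))).toAddMonoidHom) Z
    fun w hw => ?_
  have hl0 : ((w 0).length : ℤ) = p + 1 := length_of_mem_homog h0 (hw 0)
  have hl : ∀ j : Fin r, ((w j.succ).length : ℤ) = q j + 1 :=
    fun j => length_of_mem_homog (hZ j) (hw j.succ)
  have hleft : (comp hn (Bar.proj r p (Finsupp.single (w 0) 1))
      (fun j : Fin r => Bar.proj (i j) (q j) (Finsupp.single (w j.succ) 1)) : Bar.Chain n m) =
      comp hn (Bar.simplex r p (w 0)) (fun j => Bar.simplex (i j) (q j) (w j.succ)) := by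
    congr 1
    · exact Bar.proj_single r p (w 0)
    · exact funext fun j => Bar.proj_single (i j) (q j) (w j.succ)
  refine hleft.trans ?_
  rw [ezL_single]
  by_cases hnil : ∃ c, w c = []
  · obtain ⟨c, hc⟩ := hnil
    rw [ez_of_nil _ c hc, map_zero, map_zero]
    revert hc
    refine Fin.cases (fun hc => ?_) (fun j hc => ?_) c
    · refine (comp_multiAdd hn).map_eq_zero (0 : Fin ((r : ℕ) + 1))
        (y := fun c => Bar.simplex (slotArity r i c) (Fin.cons (α := fun _ => ℤ) p q c) (w c)) ?_
      exact dif_neg fun h => h.1 hc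
    · refine (comp_multiAdd hn).map_eq_zero j.succ
        (y := fun c => Bar.simplex (slotArity r i c) (Fin.cons (α := fun _ => ℤ) p q c) (w c)) ?_
      exact dif_neg fun h => h.1 hc
  push Not at hnil
  by_cases hdeg : ∃ c, ¬ (w c).IsChain (· ≠ ·)
  · obtain ⟨c, hc⟩ := hdeg
    rw [Bar.proj_degen (mapL_mem_degen (ez_mem_degen _ w c hc))]
    refine (comp_multiAdd hn).map_eq_zero c
      (y := fun c => Bar.simplex (slotArity r i c) (Fin.cons (α := fun _ => ℤ) p q c) (w c)) ?_
    exact dif_neg fun h => hc h.2.2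
  · push Not at hdeg
    have hw : w = Fin.cons (w 0) fun j => w j.succ := (Fin.cons_self_tail w).symm
    have := basisComp_eq hn hm ⟨w 0, hnil 0, hl0, hdeg 0⟩
      fun j => ⟨w j.succ, hnil j.succ, hl j, hdeg j.succ⟩
    refine Eq.trans ?_ (this.trans (by rw [← hw]))
    rw [← comp_single]
    congr 1
    · exact simplex_basis ⟨w 0, hnil 0, hl0, hdeg 0⟩
    · funext j
      exact simplex_basis ⟨w j.succ, hnil j.succ, hl j, hdeg j.succ⟩

end Comp

end Smith

/-! ### The laws of Smith's operad, except associativity -/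

/-- The order of the factors of a shuffle product is changed by a bijection of linear orders at the
cost of the Koszul sign. -/
lemma ez_reindex_lt {C C' : Type} [Fintype C] [LinearOrder C] [Fintype C'] [LinearOrder C']
    {X : C → Type} [∀ c, Inhabited (X c)] (e : C' ≃ C) (w : ∀ c, List (X c)) :
    ez ltMatrix (fun c => w (e c)) =
      ksign (∑ a, ∑ b, if a < b ∧ e.symm b < e.symm a then dg w a * dg w b else 0) •
        mapL (fun x c => x (e c)) (ez ltMatrix w) := by
  have h := ez_reindex (X := X) e (ρ' := ltMatrix) (ρ := ltMatrix)
    (θ := fun a b => if a < b ∧ e.symm b < e.symm a then 1 else 0) (fun a => by simp)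
    (fun a b => ?_) w
  · rw [h]
    simp only [dgForm, ite_mul, one_mul, zero_mul]
  · simp only [Equiv.symm_apply_apply, ltMatrix]
    rcases lt_trichotomy a b with h | rfl | h
    · rcases lt_trichotomy (e a) (e b) with h' | h' | h'
      · simp [h, h', h.not_gt, h'.not_gt]
      · exact absurd (e.injective h') h.ne
      · simp [h, h', h.not_gt, h'.not_gt]
    · simp
    · rcases lt_trichotomy (e a) (e b) with h' | h' | h'
      · simp [h, h', h.not_gt, h'.not_gt]
      · exact absurd (e.injective h') h.ne'
      · simp [h, h', h.not_gt, h'.not_gt]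

lemma faceSum_eq_ezL {C : Type} [Fintype C] [DecidableEq C] {X : C → Type} [∀ c, Inhabited (X c)]
    (ρ : C → C → ℤ) (w : ∀ c, List (X c)) (c : C) :
    faceSum ρ w c =
      ezL ρ (Function.update (fun c => Finsupp.single (w c) 1) c (Bar.rawD (w c))) := by
  rw [← (ezL_multiAdd ρ).slot_apply, Bar.rawD, map_sum, faceSum]
  refine Finset.sum_congr rfl fun a _ => ?_
  rw [map_zsmul, MultiAdd.slot_apply, ← ezL_single]
  congr 2
  funext b
  by_cases hb : b = c
  · subst hb; simp
  · simp [hb]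

lemma ltMatrix_self {C : Type} [Preorder C] [DecidableLT C] (c : C) : ltMatrix c c = 0 := by
  simp [ltMatrix]

lemma ksign_ltMatrix {C : Type} [LinearOrder C] (a c : C) (h : a ≠ c) :
    ksign (ltMatrix a c) = -ksign (ltMatrix c a) := by
  unfold ltMatrix
  rcases lt_or_gt_of_ne h with h | h <;> simp [h, h.not_gt, ksign_zero, ksign_one]

namespace Smith

section Laws

variable {r n : ℕ+} {i : Fin r → ℕ+} {p m : ℤ} {q : Fin r → ℤ}

/-- The tuple of lists with entries `w` and `v j`. -/
def slotLists (w : List (Equiv.Perm (Fin r))) (v : ∀ j, List (Equiv.Perm (Fin (i j)))) :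
    ∀ c, List (Slot r i c) := Fin.cons w v

lemma dg_slotLists_zero {w : List (Equiv.Perm (Fin r))} (v : ∀ j, List (Equiv.Perm (Fin (i j))))
    (hw : (w.length : ℤ) = p + 1) : dg (slotLists w v) 0 = p := by
  change (w.length : ℤ) - 1 = p
  rw [hw]; ring

lemma dg_slotLists_succ (w : List (Equiv.Perm (Fin r))) {v : ∀ j, List (Equiv.Perm (Fin (i j)))}
    (hv : ∀ j, ((v j).length : ℤ) = q j + 1) (j : Fin r) : dg (slotLists w v) j.succ = q j := by
  change ((v j).length : ℤ) - 1 = q j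
  rw [hv]; ring

lemma mapL_ez_slotLists_mem_homog (hn : ∑ j, (i j : ℕ) = n) (hm : p + ∑ j, q j = m)
    {w : List (Equiv.Perm (Fin r))} {v : ∀ j, List (Equiv.Perm (Fin (i j)))}
    (hw : (w.length : ℤ) = p + 1) (hv : ∀ j, ((v j).length : ℤ) = q j + 1) :
    mapL (vertexComp hn) (ez ltMatrix (slotLists w v)) ∈ homog (Equiv.Perm (Fin n)) m := by
  refine mapL_mem_homog ?_
  have h := ez_mem_homog ltMatrix (slotLists w v)
  rw [Fin.sum_univ_succ, dg_slotLists_zero v hw,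
    Finset.sum_congr rfl fun j _ => dg_slotLists_succ w hv j, hm] at h
  exact h

lemma comp_simplex (hn : ∑ j, (i j : ℕ) = n) (hm : p + ∑ j, q j = m)
    {w : List (Equiv.Perm (Fin r))} {v : ∀ j, List (Equiv.Perm (Fin (i j)))}
    (hw : (w.length : ℤ) = p + 1) (hv : ∀ j, ((v j).length : ℤ) = q j + 1) :
    comp hn (Bar.simplex r p w) (fun j => Bar.simplex (i j) (q j) (v j)) =
      Bar.proj n m (mapL (vertexComp hn) (ez ltMatrix (slotLists w v))) := by
  have h := comp_proj hn hm (fun c => Finsupp.single (slotLists w v c) 1) (single_mem_homog hw)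
    fun j => single_mem_homog (hv j)
  rw [ezL_single] at h
  rw [← h]
  congr 1
  · exact (Bar.proj_single r p w).symm
  · exact funext fun j => (Bar.proj_single (i j) (q j) (v j)).symm

/-- The tuples of arguments of a composition. -/
abbrev Args (r : ℕ+) (i : Fin r → ℕ+) (p : ℤ) (q : Fin r → ℤ) : Type :=
  ∀ c : Fin ((r : ℕ) + 1), Bar.Chain (slotArity r i c) (Fin.cons (α := fun _ => ℤ) p q c)

lemma comp_multiAdd_map (hn : ∑ j, (i j : ℕ) = n) {p' : ℤ} {q' : Fin r → ℤ}
    {α : Bar.Chain r p → Bar.Chain r p'} {β : ∀ j, Bar.Chain (i j) (q j) → Bar.Chain (i j) (q' j)}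
    (hα : ∀ a b, α (a + b) = α a + α b) (hβ : ∀ j a b, β j (a + b) = β j a + β j b) :
    MultiAdd fun U : Args r i p q =>
      (comp hn (α (U 0)) (fun j => β j (U j.succ)) : Bar.Chain n m) := by
  intro c
  refine Fin.cases (fun U U' U'' h' h'' h => ?_) (fun j U U' U'' h' h'' h => ?_) c
  · refine comp_add_left hn ((congrArg α h).trans (hα _ _)) (fun j => ?_) fun j => ?_
    · rw [h' _ (Fin.succ_ne_zero j)]
    · rw [h'' _ (Fin.succ_ne_zero j)]
  · beta_reduce
    rw [h' 0 (Fin.succ_ne_zero j).symm, h'' 0 (Fin.succ_ne_zero j).symm]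
    refine comp_multiAdd_right hn (α (U 0)) j _ _ _ (fun a ha => ?_) (fun a ha => ?_)
      ((congrArg (β j) h).trans (hβ j _ _))
    · rw [h' _ fun h => ha (Fin.succ_injective _ h)]
    · rw [h'' _ fun h => ha (Fin.succ_injective _ h)]

/-- Multiadditive functions of the arguments of a composition which agree on basis elements are
equal. -/
lemma args_ext {A : Type} [AddCommGroup A]
    {f g : Bar.Chain r p → (∀ j, Bar.Chain (i j) (q j)) → A}
    (hf : MultiAdd fun U : Args r i p q => f (U 0) fun j => U j.succ)
    (hg : MultiAdd fun U : Args r i p q => g (U 0) fun j => U j.succ)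
    (h : ∀ (w : List (Equiv.Perm (Fin r))) (v : ∀ j, List (Equiv.Perm (Fin (i j)))),
      w ≠ [] → (∀ j, v j ≠ []) → (w.length : ℤ) = p + 1 → (∀ j, ((v j).length : ℤ) = q j + 1) →
      f (Bar.simplex r p w) (fun j => Bar.simplex (i j) (q j) (v j)) =
        g (Bar.simplex r p w) fun j => Bar.simplex (i j) (q j) (v j))
    (x : Bar.Chain r p) (y : ∀ j, Bar.Chain (i j) (q j)) : f x y = g x y := by
  refine hf.ext_on hg (Fin.cons x y : Args r i p q) fun v _ => ?_
  have key := h (v 0).1 (fun j => (v j.succ).1) (v 0).2.1 (fun j => (v j.succ).2.1)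
    (v 0).2.2.1 fun j => (v j.succ).2.2.1
  have h0 : Bar.simplex r p (v 0).1 = Finsupp.single (v 0) 1 := simplex_basis (v 0)
  have hs : (fun j : Fin r => Bar.simplex (i j) (q j) (v j.succ).1) =
      fun j : Fin r => Finsupp.single (v j.succ) 1 := funext fun j => simplex_basis (v j.succ)
  rw [h0, hs] at key
  exact key

lemma smith_aug_comp (hn : ∑ j, (i j : ℕ) = n) (hm : p + ∑ j, q j = m)
    (x : Bar.Chain r p) (y : ∀ j, Bar.Chain (i j) (q j)) :
    Bar.aug m (comp hn x y) = Bar.aug p x * ∏ j, Bar.aug (q j) (y j) := by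
  refine args_ext (f := fun x y => Bar.aug m (comp hn x y))
    (g := fun x y => Bar.aug p x * ∏ j, Bar.aug (q j) (y j))
    ((comp_multiAdd hn).map (Bar.aug m)) ?_ (fun w v hw0 hv0 hw hv => ?_) x y
  · have := MultiAdd.prod (A := fun c => Bar.Chain (slotArity r i c)
      (Fin.cons (α := fun _ => ℤ) p q c)) fun c => Bar.aug (Fin.cons (α := fun _ => ℤ) p q c)
    simp only [Fin.prod_univ_succ] at this
    exact this
  · beta_reduce
    have hp : 0 ≤ p := by
      have := List.length_pos_iff.2 hw0
      omega
    have hq : ∀ j, 0 ≤ q j := fun j => by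
      have := List.length_pos_iff.2 (hv0 j)
      have := hv j
      omega
    have hq' := Finset.sum_nonneg fun j (_ : j ∈ Finset.univ) => hq j
    by_cases hm0 : m = 0
    · subst hm0
      obtain rfl : p = 0 := by omega
      have hq0 : ∀ j, q j = 0 := fun j =>
        (Finset.sum_eq_zero_iff_of_nonneg fun j _ => hq j).1 (by omega) j (Finset.mem_univ j)
      obtain rfl : q = fun _ => 0 := funext hq0
      have hlen : ∀ c, (slotLists w v c).length = 1 :=
        Fin.cases (Nat.cast_injective hw) fun j => Nat.cast_injective (hv j)
      choose g hg using fun c => List.length_eq_one_iff.1 (hlen c)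
      have hprod : ∏ j, Bar.aug ((fun _ => 0 : Fin r → ℤ) j)
          (Bar.simplex (i j) ((fun _ => 0 : Fin r → ℤ) j) (v j)) = 1 :=
        Finset.prod_eq_one fun j _ => Bar.aug_simplex (v j) (hlen j.succ)
      rw [comp_simplex hn hm hw hv, Bar.aug_simplex w (hlen 0), hprod, funext hg,
        ez_pt _ _ ltMatrix_self, mapL_single, Bar.proj_single, Bar.aug_simplex _ (by simp), one_mul]
    · rw [Bar.aug_of_ne hm0]
      by_cases hp0 : p = 0
      · obtain ⟨j, hj⟩ : ∃ j, q j ≠ 0 := by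
          by_contra! h
          exact hm0 (by simp [← hm, hp0, h])
        rw [Finset.prod_eq_zero (Finset.mem_univ j) (Bar.aug_of_ne hj _), mul_zero]
      · rw [Bar.aug_of_ne hp0, zero_mul]

lemma smith_comp_act_right (hn : ∑ j, (i j : ℕ) = n) (hm : p + ∑ j, q j = m)
    (τ : ∀ j, Equiv.Perm (Fin (i j))) (x : Bar.Chain r p) (y : ∀ j, Bar.Chain (i j) (q j)) :
    (comp hn x (fun j => Bar.act (τ j) (y j)) : Bar.Chain n m) =
      Bar.act (sumPerm hn τ) (comp hn x y) := by
  refine args_ext (f := fun x y => (comp hn x (fun j => Bar.act (τ j) (y j)) : Bar.Chain n m))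
    (g := fun x y => Bar.act (sumPerm hn τ) (comp hn x y))
    (comp_multiAdd_map hn (α := fun x => x) (β := fun j => Bar.act (τ j)) (fun _ _ => rfl)
      fun j => map_add _)
    ((comp_multiAdd hn).map (Bar.act (sumPerm hn τ))) (fun w v _ _ hw hv => ?_) x y
  let φ : ∀ c, Slot r i c → Slot r i c :=
    Fin.cons (α := fun c => Slot r i c → Slot r i c) (fun u => u)
      fun j (u : Equiv.Perm (Fin (i j))) => (τ j)⁻¹ * u
  have h1 : slotLists w (fun j => (v j).map ((τ j)⁻¹ * ·)) =
      fun c => (slotLists w v c).map (φ c) :=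
    funext (Fin.cases (List.map_id _).symm fun j => rfl)
  simp only [Bar.act_simplex]
  rw [comp_simplex hn hm hw hv, comp_simplex hn hm hw fun j => by simpa using hv j, act_proj,
    mapL_mapL, h1, ez_map, mapL_mapL]
  exact congrArg (Bar.proj n m) (congrArg (fun f => mapL f _)
    (funext fun u => permComp_act_right hn (u 0) τ fun j => u j.succ))

lemma smith_comp_act_left (hn : ∑ j, (i j : ℕ) = n) (hm : p + ∑ j, q j = m)
    (σ : Equiv.Perm (Fin r)) (hn' : ∑ j, (i (σ.symm j) : ℕ) = n)
    (hm' : p + ∑ j, q (σ.symm j) = m) (x : Bar.Chain r p) (y : ∀ j, Bar.Chain (i j) (q j)) :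
    (comp hn (Bar.act σ x) y : Bar.Chain n m) = ksign (permExp σ q) •
      Bar.act (blockPerm hn σ) (comp hn' x (fun j => y (σ.symm j))) := by
  have hadd : MultiAdd fun U : Args r i p q =>
      (comp hn' (U 0) (fun j : Fin r => U (σ.symm j).succ) : Bar.Chain n m) := by
    intro c
    refine Fin.cases (fun U U' U'' h' h'' h => ?_) (fun j U U' U'' h' h'' h => ?_) c
    · exact comp_add_left hn' h (fun j => h' _ (Fin.succ_ne_zero _))
        fun j => h'' _ (Fin.succ_ne_zero _)
    · obtain ⟨j, rfl⟩ := σ.symm.surjective j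
      beta_reduce
      rw [h' 0 (Fin.succ_ne_zero _).symm, h'' 0 (Fin.succ_ne_zero _).symm]
      exact comp_multiAdd_right hn' (U 0) j _ _ _
        (fun a ha => h' _ fun h => ha (σ.symm.injective (Fin.succ_injective _ h)))
        (fun a ha => h'' _ fun h => ha (σ.symm.injective (Fin.succ_injective _ h))) h
  refine args_ext (f := fun x y => (comp hn (Bar.act σ x) y : Bar.Chain n m))
    (g := fun x y => ksign (permExp σ q) •
      Bar.act (blockPerm hn σ) (comp hn' x (fun j => y (σ.symm j))))
    (comp_multiAdd_map hn (α := Bar.act σ) (β := fun j y => y) (map_add _) fun _ _ _ => rfl)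
    ((hadd.map (Bar.act (blockPerm hn σ))).smul _) (fun w v _ _ hw hv => ?_) x y
  let φ : ∀ c, Slot r i c → Slot r i c :=
    Fin.cons (α := fun c => Slot r i c → Slot r i c) (fun u : Equiv.Perm (Fin r) => σ⁻¹ * u)
      fun j u => u
  have h1 : slotLists (w.map (σ⁻¹ * ·)) v = fun c => (slotLists w v c).map (φ c) :=
    funext (Fin.cases rfl fun j => (List.map_id _).symm)
  -- The factors of the right-hand side are those of the left-hand side, reindexed by `e`.
  let e : Fin ((r : ℕ) + 1) ≃ Fin ((r : ℕ) + 1) :=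
    { toFun := Fin.cons 0 fun j => (σ.symm j).succ
      invFun := Fin.cons 0 fun j => (σ j).succ
      left_inv := Fin.cases rfl fun j => by simp
      right_inv := Fin.cases rfl fun j => by simp }
  let ψ : ∀ c, Slot r i (e c) → Slot r (fun j => i (σ.symm j)) c :=
    Fin.cons (α := fun c => Slot r i (e c) → Slot r (fun j => i (σ.symm j)) c) (fun u => u)
      fun j u => u
  have h2 : slotLists w (fun j => v (σ.symm j)) = fun c => (slotLists w v (e c)).map (ψ c) :=
    funext (Fin.cases (List.map_id _).symm fun j => (List.map_id _).symm)
  have hsign : (∑ a, ∑ b, if a < b ∧ e.symm b < e.symm a then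
      dg (slotLists w v) a * dg (slotLists w v) b else 0) = permExp σ q := by
    have hes : ∀ j : Fin r, e.symm j.succ = (σ j).succ := fun j => rfl
    have he0 : e.symm 0 = 0 := rfl
    simp only [Fin.sum_univ_succ, he0, hes, dg_slotLists_succ w hv, false_and, if_false,
      Fin.not_lt_zero, and_false, Finset.sum_const_zero, zero_add, Fin.succ_lt_succ_iff]
    rfl
  simp only [Bar.act_simplex]
  rw [comp_simplex hn hm (by simpa using hw) hv, comp_simplex hn' hm' hw fun j => hv (σ.symm j),
    act_proj, mapL_mapL, h1, h2, ez_map, ez_map, ez_reindex_lt e (slotLists w v), hsign, map_zsmul,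
    map_zsmul, map_zsmul, smul_smul, ksign_mul_self, one_smul, mapL_mapL, mapL_mapL, mapL_mapL]
  exact congrArg (Bar.proj n m) (congrArg (fun f => mapL f _)
    (funext fun u => permComp_act_left hn σ (u 0) hn' fun j => u j.succ))

/-- The composition with a face of the first factor. -/
lemma proj_faceSum_zero (hn : ∑ j, (i j : ℕ) = n) {p' m' : ℤ} (hp : p' + 1 = p)
    (hm' : p' + ∑ j, q j = m') {w : List (Equiv.Perm (Fin r))}
    {v : ∀ j, List (Equiv.Perm (Fin (i j)))} (hw : (w.length : ℤ) = p + 1)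
    (hv : ∀ j, ((v j).length : ℤ) = q j + 1) :
    Bar.proj n m' (mapL (vertexComp hn) (faceSum ltMatrix (slotLists w v) 0)) =
      comp hn (Bar.d hp (Bar.simplex r p w)) (fun j => Bar.simplex (i j) (q j) (v j)) := by
  rw [faceSum_eq_ezL]
  refine (comp_proj hn hm' _ ?_ fun j => single_mem_homog (hv j)).symm.trans ?_
  · rw [← Bar.rawDL_single]
    exact rawDL_mem_homog (single_mem_homog hw) hp
  · congr 1
    · exact (Bar.d_simplex hp w hw).symm
    · exact funext fun j => Bar.proj_single (i j) (q j) (v j)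

/-- The composition with a face of one of the later factors. -/
lemma proj_faceSum_succ (hn : ∑ j, (i j : ℕ) = n) {m' : ℤ} (j : Fin r)
    (hm' : p + ∑ l, (q l - if l = j then 1 else 0) = m') {w : List (Equiv.Perm (Fin r))}
    {v : ∀ j, List (Equiv.Perm (Fin (i j)))} (hw : (w.length : ℤ) = p + 1)
    (hv : ∀ j, ((v j).length : ℤ) = q j + 1) :
    Bar.proj n m' (mapL (vertexComp hn) (faceSum ltMatrix (slotLists w v) j.succ)) =
      comp hn (Bar.simplex r p w)
        (diffAt Bar.Chain (fun h => Bar.d h) (fun j => Bar.simplex (i j) (q j) (v j)) j) := by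
  rw [faceSum_eq_ezL]
  set Z := Function.update (fun c => Finsupp.single (slotLists w v c) (1 : ℤ)) j.succ
    (Bar.rawD (slotLists w v j.succ)) with hZ
  have hZ0 : Z 0 = Finsupp.single w 1 :=
    Function.update_of_ne (Fin.succ_ne_zero j).symm _ _
  have hZj : Z j.succ = Bar.rawD (v j) := Function.update_self _ _ _
  have hZl : ∀ l, l ≠ j → Z l.succ = Finsupp.single (v l) 1 := fun l hl =>
    Function.update_of_ne (fun h => hl (Fin.succ_injective _ h)) _ _
  refine (comp_proj (p := p) (q := fun l => q l - if l = j then 1 else 0) hn hm' Z ?_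
    fun l => ?_).symm.trans ?_
  · rw [hZ0]; exact single_mem_homog hw
  · by_cases hl : l = j
    · subst hl
      rw [hZj, ← Bar.rawDL_single, if_pos rfl]
      exact rawDL_mem_homog (single_mem_homog (hv l)) (by ring)
    · rw [hZl l hl, if_neg hl, sub_zero]
      exact single_mem_homog (hv l)
  · congr 1
    · exact (congrArg (Bar.proj r p) hZ0).trans (Bar.proj_single r p w)
    · funext l
      unfold diffAt
      by_cases hl : l = j
      · subst hl
        rw [dif_pos rfl]
        exact (congrArg (Bar.proj (i l) _) hZj).trans (Bar.d_simplex _ (v l) (hv l)).symm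
      · rw [dif_neg hl]
        exact (congrArg (Bar.proj (i l) _) (hZl l hl)).trans
          ((Bar.proj_single _ _ _).trans (simplex_castDeg _ (v l)).symm)

lemma stepSign_slotLists_zero (w : List (Equiv.Perm (Fin r)))
    (v : ∀ j, List (Equiv.Perm (Fin (i j)))) : stepSign ltMatrix (slotLists w v) 0 = 1 := by
  simp [stepSign, ltMatrix, ksign_zero]

lemma stepSign_slotLists_succ {w : List (Equiv.Perm (Fin r))}
    {v : ∀ j, List (Equiv.Perm (Fin (i j)))} (hw : (w.length : ℤ) = p + 1)
    (hv : ∀ j, ((v j).length : ℤ) = q j + 1) (j : Fin r) :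
    stepSign ltMatrix (slotLists w v) j.succ = ksign (p + ∑ l with l < j, q l) := by
  rw [stepSign, Fin.sum_univ_succ, dg_slotLists_zero v hw, Finset.sum_filter]
  congr 1
  congr 1
  · simp [ltMatrix]
  · refine Finset.sum_congr rfl fun l _ => ?_
    rw [dg_slotLists_succ w hv]
    simp [ltMatrix, Fin.succ_lt_succ_iff]

lemma smith_d_comp {p' m' : ℤ} (hn : ∑ j, (i j : ℕ) = n) (hm : p + ∑ j, q j = m)
    (hp : p' + 1 = p) (hm' : m' + 1 = m) (h₁ : p' + ∑ j, q j = m')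
    (h₂ : ∀ j, p + ∑ l, (q l - if l = j then 1 else 0) = m') (x : Bar.Chain r p)
    (y : ∀ j, Bar.Chain (i j) (q j)) :
    Bar.d hm' (comp hn x y) = comp hn (Bar.d hp x) y +
      ∑ j, ksign (p + ∑ l with l < j, q l) •
        comp hn x (diffAt Bar.Chain (fun h => Bar.d h) y j) := by
  refine args_ext (f := fun x y => Bar.d hm' (comp hn x y))
    (g := fun x y => comp hn (Bar.d hp x) y +
      ∑ j, ksign (p + ∑ l with l < j, q l) •
        comp hn x (diffAt Bar.Chain (fun h => Bar.d h) y j))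
    ((comp_multiAdd hn).map (Bar.d hm')) (MultiAdd.add
      (comp_multiAdd_map hn (α := Bar.d hp) (β := fun j y => y) (map_add _) fun _ _ _ => rfl)
      (MultiAdd.sum _ fun j _ => MultiAdd.smul _
        (comp_multiAdd_map hn (α := fun x => x) (β := fun l a =>
          if h : l = j then Bar.d (by simp [h]) a else castDeg (by simp [h]) a)
          (fun _ _ => rfl) fun l a b => ?_))) (fun w v _ _ hw hv => ?_) x y
  · by_cases hl : l = j
    · simp only [dif_pos hl, map_add]
    · simp only [dif_neg hl]
      have hcast : ∀ {k k' : ℤ} (h : k = k') (a b : Bar.Chain (i l) k),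
          castDeg (X := Bar.Chain) h (a + b) = castDeg h a + castDeg h b := by
        rintro k _ rfl a b; rfl
      exact hcast _ a b
  · have hdeg := mapL_ez_slotLists_mem_homog hn hm hw hv
    have hpt : Bar.proj n m' (mapL (vertexComp hn) (ptTerm (slotLists w v))) = 0 := by
      refine proj_of_homog_neg_one (mapL_mem_homog ?_)
      unfold ptTerm
      split_ifs
      · exact single_mem_homog (by simp)
      · exact Submodule.zero_mem _
    rw [comp_simplex hn hm hw hv, d_proj hm' hdeg, rawDL_mapL,
      rawDL_ez ltMatrix ltMatrix_self ksign_ltMatrix, map_add, map_add, hpt, zero_add,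
      Fin.sum_univ_succ, stepSign_slotLists_zero, one_smul, map_add, map_add,
      proj_faceSum_zero hn hp h₁ hw hv, map_sum, map_sum]
    congr 1
    refine Finset.sum_congr rfl fun j _ => ?_
    rw [map_zsmul, map_zsmul, proj_faceSum_succ hn j (h₂ j) hw hv, stepSign_slotLists_succ hw hv]

end Laws

section Unit

lemma permComp_one_left {n : ℕ+} (hn : ∑ _j : Fin (1 : ℕ+), (n : ℕ) = n)
    (v : Equiv.Perm (Fin n)) : permComp (i := fun _ => n) hn 1 (fun _ => v) = v := by
  refine Equiv.ext fun a => Fin.ext ?_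
  let l : Fin (1 : ℕ+) := ⟨0, Nat.one_pos⟩
  have h0 : ∀ (l : Fin (1 : ℕ+)) (f : Fin (1 : ℕ+) → ℕ), ∑ b with b < l, f b = 0 := fun l f =>
    Finset.sum_eq_zero fun b hb => absurd (Subsingleton.elim (α := Fin 1) b l)
      (Finset.mem_filter.1 hb).2.ne
  rw [permComp_val hn 1 (fun _ => v) a l a (by rw [h0, zero_add]), h0, zero_add]

lemma permComp_one_right {n : ℕ+} (hn : ∑ _j : Fin n, ((1 : ℕ+) : ℕ) = n)
    (w : Equiv.Perm (Fin n)) : permComp (i := fun _ => 1) hn w (fun _ => 1) = w := by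
  have hcard : ∀ l : Fin n, ∑ b with b < l, ((1 : ℕ+) : ℕ) = l := fun l => by
    rw [Finset.sum_const, Finset.filter_gt_eq_Iio, Fin.card_Iio]
    exact mul_one _
  refine Equiv.ext fun a => Fin.ext ?_
  rw [permComp_val hn w (fun _ => 1) a a (0 : Fin 1) (by rw [hcard]; rfl), hcard]
  rfl

lemma one_eq_simplex : smithOperad.one = Bar.simplex 1 0 [1] := rfl

lemma smith_one_comp {n : ℕ+} {k : ℤ} (hn : ∑ _j : Fin (1 : ℕ+), (n : ℕ) = n)
    (hk : 0 + ∑ _j : Fin (1 : ℕ+), k = k) (y : Bar.Chain n k) :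
    (comp (i := fun _ => n) (q := fun _ => k) hn smithOperad.one (fun _ => y) : Bar.Chain n k) =
      y := by
  refine finsupp_ext (f := AddMonoidHom.mk' (fun y : Bar.Chain n k =>
      (comp (i := fun _ => n) (q := fun _ => k) hn smithOperad.one (fun _ => y) : Bar.Chain n k))
      fun a b => comp_multiAdd_right hn smithOperad.one (0 : Fin 1) _ _ _
        (fun j hj => absurd (Subsingleton.elim (α := Fin 1) _ _) hj)
        (fun j hj => absurd (Subsingleton.elim (α := Fin 1) _ _) hj) rfl)
    (g := AddMonoidHom.id _) (fun w => ?_) y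
  change comp hn _ (fun _ => Finsupp.single w 1) = Finsupp.single w 1
  have hpt : slotLists (r := 1) (i := fun _ => n) [1] (fun _ => w.1) =
      Function.update (fun c => [(1 : Slot 1 (fun _ => n) c)])
        (⟨0, Nat.one_pos⟩ : Fin (1 : ℕ+)).succ w.1 :=
    funext (Fin.cases rfl fun j => by
      obtain rfl : j = ⟨0, Nat.one_pos⟩ := Subsingleton.elim (α := Fin 1) _ _
      rfl)
  have hez := ez_update_pt ltMatrix (X := Slot 1 fun _ => n)
    (⟨0, Nat.one_pos⟩ : Fin (1 : ℕ+)).succ (ltMatrix_self _) (fun _ => 1) (l := w.1) w.2.1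
  rw [← simplex_basis w, one_eq_simplex, comp_simplex hn hk rfl fun _ => w.2.2.1]
  refine (congrArg (fun z => Bar.proj n k (mapL (vertexComp hn) z))
    ((congrArg (ez ltMatrix) hpt).trans hez)).trans ?_
  rw [mapL_single]
  refine (Bar.proj_single n k _).trans (congrArg (Bar.simplex n k) (List.map_map.trans ?_))
  refine (List.map_congr_left (g := id) fun u _ => ?_).trans (List.map_id w.1)
  refine Eq.trans (congrArg (permComp (i := fun _ => n) hn 1) (funext fun j => ?_))
    (permComp_one_left hn u)
  obtain rfl : j = ⟨0, Nat.one_pos⟩ := Subsingleton.elim (α := Fin 1) _ _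
  exact Function.update_self _ _ _

lemma smith_comp_one {n : ℕ+} {k : ℤ} (hn : ∑ _j : Fin n, ((1 : ℕ+) : ℕ) = n)
    (hk : k + ∑ _j : Fin n, 0 = k) (x : Bar.Chain n k) :
    (comp (i := fun _ => 1) (q := fun _ => 0) hn x (fun _ => smithOperad.one) : Bar.Chain n k) =
      x := by
  refine finsupp_ext (f := AddMonoidHom.mk' (fun x : Bar.Chain n k =>
      (comp (i := fun _ => 1) (q := fun _ => 0) hn x (fun _ => smithOperad.one) : Bar.Chain n k))
      fun a b => comp_add_left hn rfl (fun _ => rfl) fun _ => rfl)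
    (g := AddMonoidHom.id _) (fun w => ?_) x
  change comp hn (Finsupp.single w 1) (fun _ => smithOperad.one) = Finsupp.single w 1
  have hpt : slotLists (r := n) (i := fun _ => 1) w.1 (fun _ => [1]) =
      Function.update (fun c => [(1 : Slot n (fun _ => 1) c)]) 0 w.1 :=
    funext (Fin.cases rfl fun j => rfl)
  have hez := ez_update_pt ltMatrix (X := Slot n fun _ => 1) 0 (ltMatrix_self _) (fun _ => 1)
    (l := w.1) w.2.1
  rw [← simplex_basis w, one_eq_simplex, comp_simplex hn hk w.2.2.1 fun _ => rfl]
  refine (congrArg (fun z => Bar.proj n k (mapL (vertexComp hn) z))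
    ((congrArg (ez ltMatrix) hpt).trans hez)).trans ?_
  rw [mapL_single]
  refine (Bar.proj_single n k _).trans (congrArg (Bar.simplex n k) (List.map_map.trans ?_))
  exact (List.map_congr_left fun u _ => permComp_one_right hn u).trans (List.map_id w.1)

end Unit

end Smith

/-! ### Associativity of Smith's operad -/

/-- The strict lexicographic order of a disjoint union, as a matrix. -/
def lexMatrix {B : Type} [LT B] [DecidableEq B] [DecidableLT B] {κ : B → ℕ}
    (f f' : Σ b, Fin (κ b)) : ℤ :=
  if f.1 < f'.1 ∨ f.1 = f'.1 ∧ (f.2 : ℕ) < f'.2 then 1 else 0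

/-- An iterated shuffle product as a shuffle product of all the factors, in any order of these. -/
lemma ezL_nested {B D : Type} [Fintype B] [LinearOrder B] {κ : B → ℕ} [Fintype D] [DecidableEq D]
    {X : D → Type} [∀ d, Inhabited (X d)] {A : B → Type} [∀ b, Inhabited (A b)]
    (e : (Σ b, Fin (κ b)) ≃ D) (ρ θ : D → D → ℤ) (hθ : ∀ d, θ d d = 0)
    (h : ∀ f f', Even (θ (e f) (e f') + θ (e f') (e f) + lexMatrix f f' + ρ (e f) (e f')))
    (w : ∀ d, List (X d)) (G : ∀ b, (∀ f, X (e ⟨b, f⟩)) → A b) (Y : ∀ b, List (A b) →₀ ℤ)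
    (hY : ∀ b, Y b = mapL (G b) (ez ltMatrix fun f => w (e ⟨b, f⟩))) :
    ezL ltMatrix Y =
      ksign (dgForm θ w) • mapL (fun x b => G b fun f => x (e ⟨b, f⟩)) (ez ρ w) := by
  rw [funext hY, ezL_mapL]
  rw [ez_sigma (X := fun p => X (e p)) (ρ := lexMatrix) ltMatrix_self
    (fun b f f' => by simp [lexMatrix, ltMatrix])
    (fun b b' f f' hb => by simp [lexMatrix, ltMatrix, hb]) fun p => w (e p)]
  rw [ez_reindex e hθ h w, map_zsmul, map_zsmul, mapL_mapL, mapL_mapL]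

/-- The shuffle product of a single list. -/
lemma mapL_eval_ez {C : Type} [Fintype C] [DecidableEq C] [Unique C] {X : C → Type}
    [∀ c, Inhabited (X c)] (ρ : C → C → ℤ) (hρ : ∀ c, ρ c c = 0) (w : ∀ c, List (X c))
    (h : w default ≠ []) :
    mapL (fun x : ∀ c, X c => x default) (ez ρ w) = Finsupp.single (w default) 1 := by
  have hw : w = Function.update (fun c => [(default : X c)]) default (w default) :=
    funext fun c => by
      obtain rfl := Unique.eq_default c
      simp
  conv_lhs => rw [hw]
  rw [ez_update_pt ρ default (hρ _) (fun _ => default) h, mapL_single, List.map_map]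
  congr 1
  refine (List.map_congr_left fun u _ => ?_).trans (List.map_id _)
  simp

namespace Smith

section Assoc

/-- The positions of the arguments of a twofold composition `γ(x; γ(y₁; z₁₁, …), …)`: `none` stands
for `x`, `some ⟨j, 0⟩` for `y_j` and `some ⟨j, l + 1⟩` for `z_{jl}`. -/
abbrev Pos {r : ℕ+} (i : Fin r → ℕ+) : Type := Option (Σ j : Fin r, Fin ((i j : ℕ) + 1))

/-- The arities of the arguments of a twofold composition. -/
def posArity {r : ℕ+} {i : Fin r → ℕ+} (c : ∀ j, Fin (i j) → ℕ+) : Pos i → ℕ+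
  | none => r
  | some d => slotArity (i d.1) (c d.1) d.2

/-- The degrees of the arguments of a twofold composition. -/
def posDeg {r : ℕ+} {i : Fin r → ℕ+} (p : ℤ) (q : Fin r → ℤ) (u : ∀ j, Fin (i j) → ℤ) :
    Pos i → ℤ
  | none => p
  | some d => Fin.cons (α := fun _ => ℤ) (q d.1) (u d.1) d.2

/-- The order `x, y₁, z₁₁, z₁₂, …, y₂, z₂₁, …` of the arguments, as a matrix. -/
def posMatrix {r : ℕ+} {i : Fin r → ℕ+} : Pos i → Pos i → ℤ
  | none, none => 0
  | none, some _ => 1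
  | some _, none => 0
  | some d, some d' => lexMatrix d d'

/-- The pairs of arguments that are exchanged when `x, y₁, y₂, …, z₁₁, z₁₂, …` is brought into the
order `x, y₁, z₁₁, z₁₂, …, y₂, z₂₁, …`. -/
def posInv {r : ℕ+} {i : Fin r → ℕ+} : Pos i → Pos i → ℤ
  | some d, some d' => if d.1 < d'.1 ∧ d.2 ≠ 0 ∧ d'.2 = 0 then 1 else 0
  | _, _ => 0

variable {r s n : ℕ+} {i a : Fin r → ℕ+} {c : ∀ j, Fin (i j) → ℕ+}

/-- The grouping of the arguments in `γ(x; γ(y₁; z₁₁, …), …, γ(y_r; z_{r1}, …))`. -/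
def groupRight (i : Fin r → ℕ+) :
    (Σ b : Fin ((r : ℕ) + 1), Fin (Fin.cons (α := fun _ => ℕ) 1 (fun j => (i j : ℕ) + 1) b)) ≃
      Pos i where
  toFun f := Fin.cases (n := (r : ℕ)) (motive := fun b =>
    Fin (Fin.cons (α := fun _ => ℕ) 1 (fun j => (i j : ℕ) + 1) b) → Pos i)
    (fun _ => none) (fun j o => some ⟨j, o⟩) f.1 f.2
  invFun
    | none => ⟨0, (0 : Fin 1)⟩
    | some d => ⟨d.1.succ, d.2⟩
  left_inv := by
    rintro ⟨b, o⟩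
    revert o
    refine Fin.cases (fun o => ?_) (fun j o => rfl) b
    obtain rfl : o = (0 : Fin 1) := Subsingleton.elim (α := Fin 1) _ _
    rfl
  right_inv := by
    rintro (_ | d) <;> rfl

/-- The grouping of the arguments in `γ(γ(x; y₁, …, y_r); z₁₁, z₁₂, …)`. -/
def groupLeft (hs : ∑ j, (i j : ℕ) = s) :
    (Σ b : Fin ((s : ℕ) + 1), Fin (Fin.cons (α := fun _ => ℕ) ((r : ℕ) + 1) (fun _ => 1) b)) ≃
      Pos i where
  toFun f := Fin.cases (n := (s : ℕ)) (motive := fun b =>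
    Fin (Fin.cons (α := fun _ => ℕ) ((r : ℕ) + 1) (fun _ => 1) b) → Pos i)
    (fun o : Fin ((r : ℕ) + 1) => Fin.cases none (fun j => some ⟨j, 0⟩) o)
    (fun t _ => some ⟨((blockEquiv hs).symm t).1, ((blockEquiv hs).symm t).2.succ⟩) f.1 f.2
  invFun
    | none => ⟨0, (0 : Fin ((r : ℕ) + 1))⟩
    | some d => Fin.cases (motive := fun _ => Σ b : Fin ((s : ℕ) + 1),
        Fin (Fin.cons (α := fun _ => ℕ) ((r : ℕ) + 1) (fun _ => 1) b))
        ⟨0, (d.1.succ : Fin ((r : ℕ) + 1))⟩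
        (fun l => ⟨(blockEquiv hs ⟨d.1, l⟩).succ, (0 : Fin 1)⟩) d.2
  left_inv := by
    rintro ⟨b, o⟩
    revert o
    refine Fin.cases (fun o => ?_) (fun t o => ?_) b
    · revert o
      exact Fin.cases (n := (r : ℕ)) rfl fun j => rfl
    · obtain rfl : o = (0 : Fin 1) := Subsingleton.elim (α := Fin 1) _ _
      have := (blockEquiv hs).apply_symm_apply t
      change (⟨(blockEquiv hs ((blockEquiv hs).symm t)).succ, (0 : Fin 1)⟩ :
        Σ b : Fin ((s : ℕ) + 1), Fin (Fin.cons (α := fun _ => ℕ) ((r : ℕ) + 1) (fun _ => 1) b)) =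
        ⟨t.succ, (0 : Fin 1)⟩
      rw [this]
  right_inv := by
    rintro (_ | ⟨j, o⟩)
    · rfl
    · refine Fin.cases rfl (fun l => ?_) o
      have : ∀ d : Σ j, Fin (i j), d = ⟨j, l⟩ →
          (some ⟨d.1, d.2.succ⟩ : Pos i) = some ⟨j, l.succ⟩ := by
        rintro _ rfl; rfl
      exact this _ ((blockEquiv hs).symm_apply_apply _)

/-- The grouping to the right preserves the order of the arguments. -/
lemma lexMatrix_groupRight (f f' : Σ b : Fin ((r : ℕ) + 1),
    Fin (Fin.cons (α := fun _ => ℕ) 1 (fun j => (i j : ℕ) + 1) b)) :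
    lexMatrix f f' = posMatrix (groupRight i f) (groupRight i f') := by
  obtain ⟨b, o⟩ := f
  obtain ⟨b', o'⟩ := f'
  revert o o'
  refine Fin.cases (fun o => ?_) (fun j o => ?_) b
  · obtain rfl : o = (0 : Fin 1) := Subsingleton.elim (α := Fin 1) _ _
    refine Fin.cases (fun o => ?_) (fun j o => ?_) b'
    · obtain rfl : o = (0 : Fin 1) := Subsingleton.elim (α := Fin 1) _ _
      exact if_neg (by simp)
    · exact if_pos (Or.inl (Fin.succ_pos j))
  · refine Fin.cases (fun o' => ?_) (fun j' o' => ?_) b'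
    · exact if_neg (by simp)
    · change (if _ then (1 : ℤ) else 0) = if _ then (1 : ℤ) else 0
      simp only [Fin.succ_lt_succ_iff, Fin.succ_inj]

/-- The grouping to the left changes the order of the arguments by the exchanges `posInv`. -/
lemma even_groupLeft (hs : ∑ j, (i j : ℕ) = s) (f f' : Σ b : Fin ((s : ℕ) + 1),
    Fin (Fin.cons (α := fun _ => ℕ) ((r : ℕ) + 1) (fun _ => 1) b)) :
    Even (posInv (groupLeft hs f) (groupLeft hs f') + posInv (groupLeft hs f') (groupLeft hs f) +
      lexMatrix f f' + posMatrix (groupLeft hs f) (groupLeft hs f')) := by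
  have hlt : ∀ t t' : Fin s, t < t' ↔
      ((blockEquiv hs).symm t).1 < ((blockEquiv hs).symm t').1 ∨
        ((blockEquiv hs).symm t).1 = ((blockEquiv hs).symm t').1 ∧
          (((blockEquiv hs).symm t).2 : ℕ) < ((blockEquiv hs).symm t').2 := fun t t' => by
    have := blockEquiv_lt_iff hs ((blockEquiv hs).symm t').1 ((blockEquiv hs).symm t).1
      ((blockEquiv hs).symm t').2 ((blockEquiv hs).symm t).2
    rw [Sigma.eta, Sigma.eta, Equiv.apply_symm_apply, Equiv.apply_symm_apply] at this
    exact this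
  have hinv : ∀ d d' : Σ j, Fin ((i j : ℕ) + 1), posInv (some d) (some d') =
      if d.1 < d'.1 ∧ d.2 ≠ 0 ∧ d'.2 = 0 then 1 else 0 := fun _ _ => rfl
  have hpos : ∀ d d' : Σ j, Fin ((i j : ℕ) + 1), posMatrix (some d) (some d') =
      if d.1 < d'.1 ∨ d.1 = d'.1 ∧ (d.2 : ℕ) < d'.2 then 1 else 0 := fun _ _ => rfl
  have hzero : ∀ j : Fin r, groupLeft hs ⟨0, (j.succ : Fin ((r : ℕ) + 1))⟩ = some ⟨j, 0⟩ :=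
    fun _ => rfl
  have hsucc : ∀ (t : Fin s) o, groupLeft hs ⟨t.succ, o⟩ =
      some ⟨((blockEquiv hs).symm t).1, ((blockEquiv hs).symm t).2.succ⟩ := fun _ _ => rfl
  have hlt0 : ∀ o o', lexMatrix
      (κ := Fin.cons (α := fun _ => ℕ) ((r : ℕ) + 1) fun _ : Fin s => 1) ⟨0, o⟩ ⟨0, o'⟩ =
      if (o : ℕ) < o' then 1 else 0 := fun o o' => by simp [lexMatrix]
  obtain ⟨b, o⟩ := f
  obtain ⟨b', o'⟩ := f'
  revert o o'
  refine Fin.cases (fun o => ?_) (fun t o => ?_) b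
  · refine Fin.cases (fun o' => ?_) (fun t' o' => ?_) b'
    · rw [hlt0]
      revert o o'
      refine Fin.cases (n := (r : ℕ)) (Fin.cases (n := (r : ℕ)) ?_ fun j' => ?_)
        fun j => Fin.cases (n := (r : ℕ)) ?_ fun j' => ?_
      · exact (by decide : Even (0 + 0 + 0 + 0 : ℤ))
      · exact (by decide : Even (0 + 0 + 1 + 1 : ℤ))
      · exact (by decide : Even (0 + 0 + 0 + 0 : ℤ))
      · rw [hzero, hzero, hinv, hinv, hpos]
        change Even (_ + _ + (if (j : ℕ) + 1 < j' + 1 then (1 : ℤ) else 0) + _)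
        by_cases hj : j < j' <;> simp [hj]
    · have hl : lexMatrix (⟨0, o⟩ : Σ b : Fin ((s : ℕ) + 1),
          Fin (Fin.cons (α := fun _ => ℕ) ((r : ℕ) + 1) (fun _ => 1) b)) ⟨t'.succ, o'⟩ = 1 := by
        simp [lexMatrix]
      rw [hl]
      revert o
      refine Fin.cases (n := (r : ℕ)) (fun _ => ?_) fun j _ => ?_
      · exact (by decide : Even (0 + 0 + 1 + 1 : ℤ))
      · rw [hzero, hsucc, hinv, hinv, hpos]
        rcases lt_trichotomy j ((blockEquiv hs).symm t').1 with h | h | h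
        · simp [h, h.not_gt]
        · simp [← h]
        · simp [h, h.not_gt, h.ne']
  · refine Fin.cases (fun o' => ?_) (fun t' o' => ?_) b'
    · have hl : lexMatrix (⟨t.succ, o⟩ : Σ b : Fin ((s : ℕ) + 1),
          Fin (Fin.cons (α := fun _ => ℕ) ((r : ℕ) + 1) (fun _ => 1) b)) ⟨0, o'⟩ = 0 := by
        simp [lexMatrix]
      rw [hl]
      revert o'
      refine Fin.cases (n := (r : ℕ)) (fun _ => ?_) fun j' _ => ?_
      · exact (by decide : Even (0 + 0 + 0 + 0 : ℤ))
      · rw [hzero, hsucc, hinv, hinv, hpos]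
        by_cases h : ((blockEquiv hs).symm t).1 < j' <;> simp [h]
    · have ho : ¬ (o : ℕ) < o' := by
        have h1 : (o : ℕ) < 1 := o.2
        have h2 : (o' : ℕ) < 1 := o'.2
        omega
      have hl : lexMatrix (⟨t.succ, o⟩ : Σ b : Fin ((s : ℕ) + 1),
          Fin (Fin.cons (α := fun _ => ℕ) ((r : ℕ) + 1) (fun _ => 1) b)) ⟨t'.succ, o'⟩ =
          if t < t' then 1 else 0 := by
        simp [lexMatrix, ho]
      rw [hl, hsucc, hsucc, hinv, hinv, hpos]
      simp only [Fin.succ_ne_zero, and_false, if_false, zero_add, hlt, Fin.val_succ,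
        add_lt_add_iff_right]
      exact Even.add_self _

/-- The exchanges `posInv` produce the Koszul sign of associativity. -/
lemma dgForm_posInv {X : Pos i → Type} {q : Fin r → ℤ} {u : ∀ j, Fin (i j) → ℤ}
    {w : ∀ d, List (X d)} (hq : ∀ j, dg w (some ⟨j, 0⟩) = q j)
    (hu : ∀ j (l : Fin (i j)), dg w (some ⟨j, l.succ⟩) = u j l) :
    dgForm posInv w = assocExp q u := by
  unfold dgForm assocExp
  simp only [Fintype.sum_option, Fintype.sum_sigma, Fin.sum_univ_succ, posInv, hq, hu]
  simp only [zero_mul, ite_mul, one_mul, Finset.sum_const_zero, zero_add, add_zero, ne_eq,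
    not_true_eq_false, and_false, if_false, Fin.succ_ne_zero, not_false_eq_true,
    and_true]
  refine Finset.sum_congr rfl fun j _ => ?_
  rw [Finset.sum_comm]
  refine Finset.sum_congr rfl fun j' _ => ?_
  split_ifs
  · rw [Finset.mul_sum]
    exact Finset.sum_congr rfl fun l _ => mul_comm _ _
  · exact Finset.sum_const_zero

end Assoc

end Smith

namespace Smith

section Assoc

variable {r s n : ℕ+} {i a : Fin r → ℕ+} {c : ∀ j, Fin (i j) → ℕ+} {p e m : ℤ} {q b : Fin r → ℤ}
  {u : ∀ j, Fin (i j) → ℤ}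

/-- The lists at the positions of the arguments of a twofold composition. -/
def posLists (w : List (Equiv.Perm (Fin r))) (v : ∀ j, List (Equiv.Perm (Fin (i j))))
    (z : ∀ j l, List (Equiv.Perm (Fin (c j l)))) :
    ∀ d : Pos i, List (Equiv.Perm (Fin (posArity c d)))
  | none => w
  | some d => slotLists (v d.1) (z d.1) d.2

lemma comp_comp_simplex_right (ha : ∀ j, ∑ l, (c j l : ℕ) = a j)
    (hb : ∀ j, q j + ∑ l, u j l = b j) (hn : ∑ j, (a j : ℕ) = n) (hm : p + ∑ j, b j = m)
    {w : List (Equiv.Perm (Fin r))} {v : ∀ j, List (Equiv.Perm (Fin (i j)))}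
    {z : ∀ j l, List (Equiv.Perm (Fin (c j l)))} (hw0 : w ≠ [])
    (hw : (w.length : ℤ) = p + 1) (hv : ∀ j, ((v j).length : ℤ) = q j + 1)
    (hz : ∀ j l, ((z j l).length : ℤ) = u j l + 1) :
    (comp hn (Bar.simplex r p w) (fun j => (comp (ha j) (Bar.simplex (i j) (q j) (v j))
        (fun l => Bar.simplex (c j l) (u j l) (z j l)) : Bar.Chain (a j) (b j))) :
        Bar.Chain n m) =
      Bar.proj n m (mapL (fun x : ∀ d : Pos i, Equiv.Perm (Fin (posArity c d)) =>
        permComp hn (x none) fun j => permComp (ha j) (x (some ⟨j, 0⟩))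
          fun l => x (some ⟨j, l.succ⟩)) (ez posMatrix (posLists w v z))) := by
  have hE := fun j => mapL_ez_slotLists_mem_homog (ha j) (hb j) (hv j) (hz j)
  let Z : ∀ b, List (Slot r a b) →₀ ℤ :=
    Fin.cons (α := fun b => List (Slot r a b) →₀ ℤ) (Finsupp.single w 1)
      fun j => mapL (vertexComp (ha j)) (ez ltMatrix (slotLists (v j) (z j)))
  have h := comp_proj hn hm Z (single_mem_homog hw) hE
  let G : ∀ b, (∀ f, Equiv.Perm (Fin (posArity c (groupRight i ⟨b, f⟩)))) → Slot r a b :=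
    Fin.cases (fun x => x (0 : Fin 1)) fun j x => vertexComp (ha j) x
  have h' := ezL_nested (groupRight i) posMatrix (fun _ _ => 0) (fun _ => rfl)
    (fun f f' => by
      rw [zero_add, zero_add, lexMatrix_groupRight]
      exact Even.add_self _) (posLists w v z) G Z (Fin.cases
      (mapL_eval_ez (C := Fin 1) ltMatrix ltMatrix_self (fun _ => w) hw0).symm fun j => rfl)
  rw [show dgForm (fun _ _ => 0) (posLists w v z) = 0 by simp [dgForm], ksign_zero, one_smul] at h'
  rw [h', mapL_mapL] at h
  refine Eq.trans ?_ h
  congr 1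
  · exact (Bar.proj_single r p w).symm
  · exact funext fun j => comp_simplex (ha j) (hb j) (hv j) (hz j)

lemma comp_comp_simplex_left (hs : ∑ j, (i j : ℕ) = s) (he : p + ∑ j, q j = e)
    (hn : ∑ t, (c ((blockEquiv hs).symm t).1 ((blockEquiv hs).symm t).2 : ℕ) = n)
    (hm : e + ∑ t, u ((blockEquiv hs).symm t).1 ((blockEquiv hs).symm t).2 = m)
    {w : List (Equiv.Perm (Fin r))} {v : ∀ j, List (Equiv.Perm (Fin (i j)))}
    {z : ∀ j l, List (Equiv.Perm (Fin (c j l)))} (hz0 : ∀ j l, z j l ≠ [])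
    (hw : (w.length : ℤ) = p + 1) (hv : ∀ j, ((v j).length : ℤ) = q j + 1)
    (hz : ∀ j l, ((z j l).length : ℤ) = u j l + 1) :
    (comp hn (comp hs (Bar.simplex r p w) (fun j => Bar.simplex (i j) (q j) (v j)) :
        Bar.Chain s e) (fun t => Bar.simplex _ (u ((blockEquiv hs).symm t).1
          ((blockEquiv hs).symm t).2) (z ((blockEquiv hs).symm t).1 ((blockEquiv hs).symm t).2)) :
        Bar.Chain n m) =
      ksign (assocExp q u) •
      Bar.proj n m (mapL (fun x : ∀ d : Pos i, Equiv.Perm (Fin (posArity c d)) =>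
        permComp hn (permComp hs (x none) fun j => x (some ⟨j, 0⟩))
          fun t => x (some ⟨((blockEquiv hs).symm t).1, ((blockEquiv hs).symm t).2.succ⟩))
        (ez posMatrix (posLists w v z))) := by
  have hE := mapL_ez_slotLists_mem_homog hs he hw hv
  let c' : Fin s → ℕ+ := fun t => c ((blockEquiv hs).symm t).1 ((blockEquiv hs).symm t).2
  let Z : ∀ b, List (Slot s c' b) →₀ ℤ :=
    Fin.cons (α := fun b => List (Slot s c' b) →₀ ℤ)
      (mapL (vertexComp hs) (ez ltMatrix (slotLists w v)))
      fun t => Finsupp.single (z ((blockEquiv hs).symm t).1 ((blockEquiv hs).symm t).2) 1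
  have h := comp_proj (q := fun t => u ((blockEquiv hs).symm t).1 ((blockEquiv hs).symm t).2)
    hn hm Z hE fun t => single_mem_homog (hz _ _)
  let G : ∀ b, (∀ f, Equiv.Perm (Fin (posArity c (groupLeft hs ⟨b, f⟩)))) → Slot s c' b :=
    Fin.cases (fun x => permComp hs (x (0 : Fin ((r : ℕ) + 1)))
      fun j => x (j.succ : Fin ((r : ℕ) + 1))) fun t x => x (0 : Fin 1)
  let φ : ∀ k : Fin ((r : ℕ) + 1),
      Equiv.Perm (Fin (posArity c (groupLeft hs ⟨0, k⟩))) → Slot r i k :=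
    Fin.cases (fun x => x) fun j x => x
  have hφ : slotLists w v =
      fun k : Fin ((r : ℕ) + 1) => (posLists w v z (groupLeft hs ⟨0, k⟩)).map (φ k) :=
    funext (Fin.cases (List.map_id _).symm fun j => (List.map_id _).symm)
  have h0 : mapL (vertexComp hs) (ez ltMatrix (slotLists w v)) =
      mapL (G 0) (ez ltMatrix fun f => posLists w v z (groupLeft hs ⟨0, f⟩)) := by
    rw [hφ, ez_map, mapL_mapL]
    rfl
  have h' := ezL_nested (groupLeft hs) posMatrix posInv (by
      rintro (_ | d)
      · rfl
      · exact if_neg fun h => lt_irrefl _ h.1)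
    (even_groupLeft hs) (posLists w v z) G Z (Fin.cases h0 fun t =>
      (mapL_eval_ez (C := Fin 1) ltMatrix ltMatrix_self
        (fun _ => z ((blockEquiv hs).symm t).1 ((blockEquiv hs).symm t).2) (hz0 _ _)).symm)
  rw [dgForm_posInv (q := q) (u := u) (fun j => ?_) fun j l => ?_] at h'
  · rw [h', map_zsmul, map_zsmul, mapL_mapL] at h
    refine Eq.trans ?_ h
    congr 1
    · exact comp_simplex hs he hw hv
    · exact funext fun t => (Bar.proj_single _ _ _).symm
  · exact dg_slotLists_zero (z j) (hv j)
  · exact dg_slotLists_succ (v j) (hz j) l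

/-- Both sides are additive in each of the arguments `x`, `y_j`, `z_{jl}`, which reduces the claim
to basis elements. -/
lemma smith_assoc (hs : ∑ j, (i j : ℕ) = s) (he : p + ∑ j, q j = e)
    (ha : ∀ j, ∑ l, (c j l : ℕ) = a j) (hb : ∀ j, q j + ∑ l, u j l = b j)
    (hn : ∑ j, (a j : ℕ) = n) (hm : p + ∑ j, b j = m)
    (hn' : ∑ t, (c ((blockEquiv hs).symm t).1 ((blockEquiv hs).symm t).2 : ℕ) = n)
    (hm' : e + ∑ t, u ((blockEquiv hs).symm t).1 ((blockEquiv hs).symm t).2 = m)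
    (x : Bar.Chain r p) (y : ∀ j, Bar.Chain (i j) (q j))
    (z : ∀ j l, Bar.Chain (c j l) (u j l)) :
    (comp hn' (comp hs x y : Bar.Chain s e)
        (fun t => z ((blockEquiv hs).symm t).1 ((blockEquiv hs).symm t).2) : Bar.Chain n m) =
      ksign (assocExp q u) •
        comp hn x (fun j => (comp (ha j) (y j) (z j) : Bar.Chain (a j) (b j))) := by
  let T : Type := ∀ d : Pos i, Bar.Chain (posArity c d) (posDeg p q u d)
  let f : T → Bar.Chain n m := fun U =>
    comp hn' (comp hs (U none) (fun j => U (some ⟨j, 0⟩)) : Bar.Chain s e)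
      fun t => U (some ⟨((blockEquiv hs).symm t).1, ((blockEquiv hs).symm t).2.succ⟩)
  let g : T → Bar.Chain n m := fun U =>
    comp hn (U none) fun j => (comp (ha j) (U (some ⟨j, 0⟩)) (fun l => U (some ⟨j, l.succ⟩)) :
      Bar.Chain (a j) (b j))
  have hinj : ∀ P Q : Σ j, Fin (i j),
      (some ⟨P.1, P.2.succ⟩ : Pos i) = some ⟨Q.1, Q.2.succ⟩ → P = Q := by
    rintro ⟨j, l⟩ ⟨j', l'⟩ h
    obtain ⟨rfl, h⟩ := Sigma.mk.inj (Option.some_injective _ h)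
    obtain rfl := Fin.succ_injective _ (eq_of_heq h)
    rfl
  -- Additivity in `z_{jl}`: in the left-hand side, this is the argument `t` with `(j, l)` the
  -- `t`-th pair in lexicographic order.
  have hfz : ∀ (P : Σ j, Fin (i j)) (U U' U'' : T),
      (∀ d, d ≠ some ⟨P.1, P.2.succ⟩ → U' d = U d) → (∀ d, d ≠ some ⟨P.1, P.2.succ⟩ → U'' d = U d) →
      U (some ⟨P.1, P.2.succ⟩) = U' (some ⟨P.1, P.2.succ⟩) + U'' (some ⟨P.1, P.2.succ⟩) →
      f U = f U' + f U'' := by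
    intro P
    obtain ⟨t, rfl⟩ := (blockEquiv hs).symm.surjective P
    intro U U' U'' h' h'' h
    have hne : ∀ j, (some ⟨j, 0⟩ : Pos i) ≠
        some ⟨((blockEquiv hs).symm t).1, ((blockEquiv hs).symm t).2.succ⟩ := fun j h => by
      have h1 := Option.some_injective _ h
      generalize (blockEquiv hs).symm t = P at h1
      obtain ⟨j', l'⟩ := P
      obtain ⟨rfl, h2⟩ := Sigma.mk.inj h1
      exact Fin.succ_ne_zero _ (eq_of_heq h2).symm
    have hxy : ∀ V : T, (∀ d, d ≠ some ⟨((blockEquiv hs).symm t).1,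
        ((blockEquiv hs).symm t).2.succ⟩ → V d = U d) →
        (comp hs (U none) (fun j => U (some ⟨j, 0⟩)) : Bar.Chain s e) =
          comp hs (V none) fun j => V (some ⟨j, 0⟩) := fun V hV => by
      congr 1
      · exact (hV _ (Option.some_ne_none _).symm).symm
      · exact funext fun j => (hV _ (hne j)).symm
    refine (comp_multiAdd_right hn' _ t _
      (fun t => U' (some ⟨((blockEquiv hs).symm t).1, ((blockEquiv hs).symm t).2.succ⟩))
      (fun t => U'' (some ⟨((blockEquiv hs).symm t).1, ((blockEquiv hs).symm t).2.succ⟩))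
      (fun t' ht => ?_) (fun t' ht => ?_) h).trans (congrArg₂ (· + ·) ?_ ?_)
    · exact h' _ fun h => ht ((blockEquiv hs).symm.injective (hinj _ _ h))
    · exact h'' _ fun h => ht ((blockEquiv hs).symm.injective (hinj _ _ h))
    · exact congrArg (fun x => comp hn' x _) (hxy U' h')
    · exact congrArg (fun x => comp hn' x _) (hxy U'' h'')
  have hf : MultiAdd f := by
    rintro (_ | ⟨j, o⟩) U U' U'' h' h'' h
    · refine comp_add_left hn' (comp_add_left hs h (fun j => ?_) fun j => ?_) (fun t => ?_)
        fun t => ?_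
      · exact h' _ (Option.some_ne_none _)
      · exact h'' _ (Option.some_ne_none _)
      · exact h' _ (Option.some_ne_none _)
      · exact h'' _ (Option.some_ne_none _)
    · revert h' h'' h
      refine Fin.cases (fun h' h'' h => ?_) (fun l h' h'' h => ?_) o
      · have hne : ∀ j', j' ≠ j → (some ⟨j', 0⟩ : Pos i) ≠ some ⟨j, 0⟩ := fun j' hj h =>
          hj (congrArg Sigma.fst (Option.some_injective _ h))
        have hne' : ∀ j' l', (some ⟨j', Fin.succ l'⟩ : Pos i) ≠ some ⟨j, 0⟩ := fun j' l' h => by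
          obtain ⟨rfl, h⟩ := Sigma.mk.inj (Option.some_injective _ h)
          exact Fin.succ_ne_zero _ (eq_of_heq h)
        refine comp_add_left hn' ?_ (fun t => h' _ (hne' _ _)) fun t => h'' _ (hne' _ _)
        rw [h' none (Option.some_ne_none _).symm, h'' none (Option.some_ne_none _).symm]
        exact comp_multiAdd_right hs (U none) j _ _ _ (fun j' hj => h' _ (hne j' hj))
          (fun j' hj => h'' _ (hne j' hj)) h
      · exact hfz ⟨j, l⟩ U U' U'' h' h'' h
  have hgy : ∀ (U V : T) (j : Fin r), (∀ o, V (some ⟨j, o⟩) = U (some ⟨j, o⟩)) →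
      (comp (ha j) (V (some ⟨j, 0⟩)) (fun l => V (some ⟨j, l.succ⟩)) : Bar.Chain (a j) (b j)) =
        comp (ha j) (U (some ⟨j, 0⟩)) fun l => U (some ⟨j, l.succ⟩) := fun U V j h => by
    congr 1
    · exact h 0
    · exact funext fun l => h l.succ
  have hg : MultiAdd g := by
    rintro (_ | ⟨j, o⟩) U U' U'' h' h'' h
    · exact comp_add_left hn h (fun j => hgy U U' j fun o => h' _ (Option.some_ne_none _))
        fun j => hgy U U'' j fun o => h'' _ (Option.some_ne_none _)
    · have hne : ∀ j', j' ≠ j → ∀ o', (some ⟨j', o'⟩ : Pos i) ≠ some ⟨j, o⟩ := fun j' hj o' h =>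
        hj (congrArg Sigma.fst (Option.some_injective _ h))
      have hne' : ∀ o', o' ≠ o → (some ⟨j, o'⟩ : Pos i) ≠ some ⟨j, o⟩ := fun o' ho h =>
        ho (eq_of_heq (Sigma.mk.inj (Option.some_injective _ h)).2)
      change comp hn (U none) _ = comp hn (U' none) _ + comp hn (U'' none) _
      rw [h' none (Option.some_ne_none _).symm, h'' none (Option.some_ne_none _).symm]
      exact comp_multiAdd_right hn (U none) j _ _ _
        (fun j' hj => hgy U U' j' fun o' => h' _ (hne j' hj o'))
        (fun j' hj => hgy U U'' j' fun o' => h'' _ (hne j' hj o'))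
        (comp_multiAdd (p := q j) (q := u j) (ha j) o (fun o => U (some ⟨j, o⟩))
          (fun o => U' (some ⟨j, o⟩)) (fun o => U'' (some ⟨j, o⟩)) (fun o' ho => h' _ (hne' o' ho))
          (fun o' ho => h'' _ (hne' o' ho)) h)
  let V : T := fun d => match d with
    | none => x
    | some d => Fin.cases (motive := fun o => Bar.Chain (posArity c (some ⟨d.1, o⟩))
        (posDeg p q u (some ⟨d.1, o⟩))) (y d.1) (z d.1) d.2
  refine hf.ext_on (hg.smul (ksign (assocExp q u))) V fun v _ => ?_
  have hl := comp_comp_simplex_left (c := c) (u := u) hs he hn' hm' (w := (v none).1)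
    (v := fun j => (v (some ⟨j, 0⟩)).1) (z := fun j l => (v (some ⟨j, l.succ⟩)).1)
    (fun j l => (v (some ⟨j, l.succ⟩)).2.1) (v none).2.2.1 (fun j => (v (some ⟨j, 0⟩)).2.2.1)
    fun j l => (v (some ⟨j, l.succ⟩)).2.2.1
  have hr := comp_comp_simplex_right (c := c) (u := u) ha hb hn hm (w := (v none).1)
    (v := fun j => (v (some ⟨j, 0⟩)).1) (z := fun j l => (v (some ⟨j, l.succ⟩)).1)
    (v none).2.1 (v none).2.2.1 (fun j => (v (some ⟨j, 0⟩)).2.2.1)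
    fun j l => (v (some ⟨j, l.succ⟩)).2.2.1
  refine Eq.trans ?_ (hl.trans (congrArg (ksign (assocExp q u) • ·)
    (Eq.trans ?_ (hr.symm.trans ?_))))
  · change comp hn' _ _ = comp hn' _ _
    congr 1
    · congr 1
      · exact (simplex_basis (v none)).symm
      · exact funext fun j => (simplex_basis (v (some ⟨j, 0⟩))).symm
    · exact funext fun t => (simplex_basis (v (some ⟨_, Fin.succ _⟩))).symm
  · refine congrArg (Bar.proj n m) (congrArg (fun F => mapL F _) (funext fun x => ?_))
    exact permComp_assoc hs ha hn hn' (x none) (fun j => x (some ⟨j, 0⟩))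
      fun j l => x (some ⟨j, l.succ⟩)
  · change comp hn _ _ = comp hn _ _
    congr 1
    · exact simplex_basis (v none)
    · refine funext fun j => ?_
      congr 1
      · exact simplex_basis (v (some ⟨j, 0⟩))
      · exact funext fun l => simplex_basis (v (some ⟨j, l.succ⟩))

end Assoc

end Smith

/-- Smith's operad satisfies the laws of an operad. -/
theorem smithOperad_isOperad : smithOperad.IsOperad where
  comp_add_left hn _ _ _ _ := Smith.comp_add_left hn rfl (fun _ => rfl) fun _ => rfl
  comp_add_right hn _ x y j a b := (Smith.comp_multiAdd_right hn x).map_update_add y j a b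
  d_one h := by
    have := (barObj 1).d_coaug h 1
    rwa [show (barObj 1).coaug 1 = smithOperad.one from one_zsmul _] at this
  d_comp hn hm hp hm' h₁ h₂ x y := Smith.smith_d_comp hn hm hp hm' h₁ h₂ x y
  aug_one := Bar.aug_simplex _ rfl
  aug_comp hn hm x y := Smith.smith_aug_comp hn hm x y
  one_comp hn hk y := Smith.smith_one_comp hn hk y
  comp_one hn hk x := Smith.smith_comp_one hn hk x
  assoc hs he ha hb hn hm hn' hm' x y z := Smith.smith_assoc hs he ha hb hn hm hn' hm' x y z
  comp_act_left hn hm σ hn' hm' x y := Smith.smith_comp_act_left hn hm σ hn' hm' x y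
  comp_act_right hn hm τ x y := Smith.smith_comp_act_right hn hm τ x y

/-! ### Morphisms of operads out of free operads and quotients -/

/-- A morphism of operads: homomorphisms of graded groups which respect the differentials, the
actions, the unit and the compositions; the augmentations are disregarded. -/
structure OperadHom (P Q : PreOperad) where
  toHom : ∀ {n : ℕ+} {k : ℤ}, P.El n k →+ Q.El n k
  map_d : ∀ {n : ℕ+} {k l : ℤ} (h : l + 1 = k) (x : P.El n k), toHom (P.d h x) = Q.d h (toHom x)
  map_act : ∀ {n : ℕ+} {k : ℤ} (σ : Equiv.Perm (Fin n)) (x : P.El n k),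
    toHom (P.act σ x) = Q.act σ (toHom x)
  map_one : toHom P.one = Q.one
  map_comp : ∀ {r n : ℕ+} {i : Fin r → ℕ+} {p m : ℤ} {q : Fin r → ℤ}
    (hn : ∑ j, (i j : ℕ) = n) (hm : p + ∑ j, q j = m)
    (x : P.El r p) (y : ∀ j, P.El (i j) (q j)),
    toHom (P.comp hn hm x y) = Q.comp hn hm (toHom x) fun j => toHom (y j)

/-- A morphism of operads that vanishes on generators of an ideal vanishes on the ideal. -/
lemma OperadHom.eq_zero_of_idealClosure {P : PreOperad} {Q : Operad}
    (f : OperadHom P Q.toPreOperad) {G : ∀ (n : ℕ+) (k : ℤ), P.El n k → Prop}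
    (hG : ∀ n k x, G n k x → f.toHom x = 0) {n : ℕ+} {k : ℤ} {x : P.El n k}
    (hx : IdealClosure P G n k x) : f.toHom x = 0 := by
  induction hx with
  | base h => exact hG _ _ _ h
  | zero => exact map_zero _
  | add _ _ h h' => rw [map_add, h, h', add_zero]
  | neg _ h => rw [map_neg, h, neg_zero]
  | d h _ h' => rw [f.map_d, h', map_zero]
  | act σ _ h => rw [f.map_act, h, map_zero]
  | comp_left hn hm y _ h =>
    have := Q.isOperad.comp_add_left hn hm 0 0 fun j => f.toHom (y j)
    rw [add_zero, right_eq_add] at this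
    rw [f.map_comp, h, this]
  | @comp_right r n i p m q hn hm x y j _ h =>
    have := Q.isOperad.comp_add_right hn hm (f.toHom x) (fun j => f.toHom (y j)) j 0 0
    rw [add_zero, right_eq_add, ← h, Function.update_eq_self] at this
    rw [f.map_comp, this]

/-- The morphism induced on a quotient by a morphism that vanishes on the ideal. -/
def OperadHom.liftQuotient {P : Operad} {Q : PreOperad} (f : OperadHom P.toPreOperad Q)
    (I : OperadicIdeal P.toPreOperad)
    (hI : ∀ (n : ℕ+) (k : ℤ) (x : P.El n k), x ∈ I.carrier n k → f.toHom x = 0) :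
    OperadHom (P.quotient I).toPreOperad Q where
  toHom {n k} := QuotientAddGroup.lift (I.carrier n k) f.toHom (hI n k)
  map_d h x := by
    obtain ⟨x, rfl⟩ := P.toQuot_surjective I x
    exact f.map_d h x
  map_act σ x := by
    obtain ⟨x, rfl⟩ := P.toQuot_surjective I x
    exact f.map_act σ x
  map_one := f.map_one
  map_comp hn hm x y := by
    obtain ⟨x, rfl⟩ := P.toQuot_surjective I x
    obtain ⟨y, rfl⟩ := P.exists_toQuot I y
    refine (congrArg _ (P.toQuot_comp I hn hm x y)).trans ?_
    exact f.map_comp hn hm x y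

namespace OpTerm

variable {M : SModule} {Q : PreOperad}

/-- The value of a formal expression in an operad, for given values of the generators. -/
def eval (f : ∀ {n : ℕ+} {k : ℤ}, M.El n k →+ Q.El n k) :
    ∀ {n : ℕ+} {k : ℤ}, OpTerm M n k → Q.El n k
  | _, _, gen x => f x
  | _, _, one => Q.one
  | _, _, zero => 0
  | _, _, add s t => eval f s + eval f t
  | _, _, neg t => -eval f t
  | _, _, d h t => Q.d h (eval f t)
  | _, _, act σ t => Q.act σ (eval f t)
  | _, _, comp hn hm t s => Q.comp hn hm (eval f t) fun j => eval f (s j)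

variable (f : ∀ {n : ℕ+} {k : ℤ}, M.El n k →+ Q.El n k)

lemma eval_sgn {n : ℕ+} {k : ℤ} (e : ℤ) (t : OpTerm M n k) :
    eval f (sgn e t) = ksign e • eval f t := by
  unfold sgn ksign
  split_ifs with h
  · simp [Int.negOnePow_even e h]
  · simp [Int.negOnePow_odd e (Int.not_even_iff_odd.1 h), eval]

lemma eval_sum {n : ℕ+} {k : ℤ} {r : ℕ} (t : Fin r → OpTerm M n k) :
    eval f (sum t) = ∑ j, eval f (t j) := by
  rw [← List.sum_ofFn, ← Function.comp_def (eval f), ← List.map_ofFn]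
  unfold sum
  induction List.ofFn t with
  | nil => rfl
  | cons a l ih => simp [eval, ih]

lemma eval_update {r : ℕ} {i : Fin r → ℕ+} {q : Fin r → ℤ} (y : ∀ j, OpTerm M (i j) (q j))
    (j : Fin r) (a : OpTerm M (i j) (q j)) :
    (fun l => eval f (Function.update y j a l)) =
      Function.update (fun l => eval f (y l)) j (eval f a) :=
  funext fun l => Function.apply_update (fun _ => eval f) y j a l

/-- Congruent formal expressions have the same value. -/
lemma Rel.eval_eq (hQ : Q.IsOperad)
    (hd : ∀ {n : ℕ+} {k l : ℤ} (h : l + 1 = k) (x : M.El n k), f (M.d h x) = Q.d h (f x))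
    (hact : ∀ {n : ℕ+} {k : ℤ} (σ : Equiv.Perm (Fin n)) (x : M.El n k),
      f (M.act σ x) = Q.act σ (f x))
    {n : ℕ+} {k : ℤ} {s t : OpTerm M n k} (h : Rel s t) : eval f s = eval f t := by
  induction h with
  | refl t => rfl
  | symm _ h => exact h.symm
  | trans _ _ h h' => exact h.trans h'
  | add_congr _ _ h h' => simp only [eval, h, h']
  | neg_congr _ h => simp only [eval, h]
  | d_congr _ _ h => simp only [eval, h]
  | act_congr σ _ h => simp only [eval, h]
  | comp_congr hn hm _ _ h h' => simp only [eval, h, h']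
  | add_assoc s t u => exact _root_.add_assoc _ _ _
  | add_comm s t => exact _root_.add_comm _ _
  | zero_add t => exact _root_.zero_add _
  | neg_add t => exact neg_add_cancel _
  | gen_add x y => exact map_add f x y
  | gen_d h x => exact hd h x
  | gen_act σ x => exact hact σ x
  | d_add h s t => exact map_add _ _ _
  | d_d h h' t => exact (Q.obj _).d_d h h' _
  | act_add σ s t => exact map_add _ _ _
  | act_one t => exact Q.act_one _
  | act_mul σ τ t => exact Q.act_mul σ τ _
  | act_d h σ t => exact Q.act_d h σ _
  | comp_add_left hn hm x x' y => exact hQ.comp_add_left hn hm _ _ _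
  | comp_add_right hn hm x y j a b =>
    simp only [eval, eval_update]
    exact hQ.comp_add_right hn hm _ _ j _ _
  | d_one h => exact hQ.d_one h
  | d_comp hn hm hp hm' h₁ h₂ x y =>
    have hD : ∀ j, (fun l => eval f (diffAt (OpTerm M) d y j l)) =
        diffAt Q.El (fun h => Q.d h) (fun l => eval f (y l)) j := fun j =>
      funext fun l => map_diffAt (X := OpTerm M) (Y := Q.El) (fun _ _ => eval f) d
        (fun h => Q.d h) (fun _ _ => rfl) y j l
    simp only [eval, eval_sum, eval_sgn, hD]
    exact hQ.d_comp hn hm hp hm' h₁ h₂ _ _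
  | one_comp hn hk y => exact hQ.one_comp hn hk _
  | comp_one hn hk x => exact hQ.comp_one hn hk _
  | assoc hs he ha hb hn hm hn' hm' x y z =>
    rw [eval_sgn]
    exact hQ.assoc hs he ha hb hn hm hn' hm' _ _ fun j l => eval f (z j l)
  | comp_act_left hn hm σ hn' hm' x y =>
    rw [eval_sgn]
    exact hQ.comp_act_left hn hm σ hn' hm' _ fun j => eval f (y j)
  | comp_act_right hn hm τ x y => exact hQ.comp_act_right hn hm τ _ _

end OpTerm

/-- The extension of a map of `𝕊`-modules from `M` to an operad to a morphism from the free operad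
on `M`. -/
noncomputable def FreeEl.lift {M : SModule} {Q : PreOperad} (hQ : Q.IsOperad)
    (f : ∀ {n : ℕ+} {k : ℤ}, M.El n k →+ Q.El n k)
    (hd : ∀ {n : ℕ+} {k l : ℤ} (h : l + 1 = k) (x : M.El n k), f (M.d h x) = Q.d h (f x))
    (hact : ∀ {n : ℕ+} {k : ℤ} (σ : Equiv.Perm (Fin n)) (x : M.El n k),
      f (M.act σ x) = Q.act σ (f x)) : OperadHom (freeOperad M).toPreOperad Q where
  toHom := AddMonoidHom.mk'
    (Quotient.lift (OpTerm.eval f) fun _ _ h => OpTerm.Rel.eval_eq f hQ hd hact h) fun a b => by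
      obtain ⟨a, rfl⟩ := FreeEl.mk_surjective a
      obtain ⟨b, rfl⟩ := FreeEl.mk_surjective b
      rfl
  map_d h x := by
    obtain ⟨x, rfl⟩ := FreeEl.mk_surjective x
    rfl
  map_act σ x := by
    obtain ⟨x, rfl⟩ := FreeEl.mk_surjective x
    rfl
  map_one := rfl
  map_comp hn hm x y := by
    obtain ⟨x, rfl⟩ := FreeEl.mk_surjective x
    obtain ⟨y, rfl⟩ := FreeEl.exists_mk y
    exact congrArg (Quotient.lift (OpTerm.eval f) fun _ _ h =>
      OpTerm.Rel.eval_eq f hQ hd hact h) (FreeEl.mk_comp hn hm x y)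

/-! ### Smith's operad as a quotient -/

/-- A composition of elements `[ ]` in Smith's operad is again the element `[ ]`; so the evaluation
of `F(S)` in Smith's operad kills the generators of `𝓙`. -/
lemma Smith.comp_bracket {r n : ℕ+} {i : Fin r → ℕ+} (hn : ∑ j, (i j : ℕ) = n)
    (hm : (0 : ℤ) + ∑ _j : Fin r, (0 : ℤ) = 0) :
    smithOperad.comp (q := fun _ => 0) hn hm (Bar.symbol r 0 1 [])
      (fun j => Bar.symbol (i j) 0 1 []) = Bar.symbol n 0 1 [] := by
  refine (Smith.comp_simplex (q := fun _ => 0) hn hm (w := [1]) (v := fun _ => [1]) rfl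
    fun _ => rfl).trans ?_
  have h : slotLists [1] (fun j => [(1 : Equiv.Perm (Fin (i j)))]) =
      fun c => [(1 : Slot r i c)] := funext (Fin.cases rfl fun _ => rfl)
  rw [h, ez_pt _ _ ltMatrix_self, mapL_single, Bar.proj_single]
  exact congrArg (fun u => Bar.simplex n 0 [u]) (permComp_one hn)

/-- The evaluation of the free operad on `S` in Smith's operad. -/
noncomputable def evalSmith : OperadHom (freeOperad barModule).toPreOperad smithOperad :=
  FreeEl.lift (M := barModule) smithOperad_isOperad (AddMonoidHom.id _) (fun _ _ => rfl)
    fun _ _ => rfl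

/-- Smith's operad, bundled with its laws. -/
noncomputable def smithBundled : Operad := ⟨smithOperad, smithOperad_isOperad⟩

lemma evalSmith_bracketComposite {n : ℕ+} {x : (freeOperad barModule).El n 0}
    (h : IsBracketComposite n x) : evalSmith.toHom x = Bar.symbol n 0 1 [] := by
  induction h with
  | one => rfl
  | bracket n => rfl
  | comp hn hm _ _ hx hy =>
    rw [evalSmith.map_comp, hx, funext hy]
    exact Smith.comp_bracket hn hm

/-- The evaluation of `𝓡` in Smith's operad. -/
noncomputable def evalR : OperadHom operadR.toPreOperad smithOperad :=
  evalSmith.liftQuotient idealJ fun _ _ _ hx =>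
    OperadHom.eq_zero_of_idealClosure (Q := smithBundled) evalSmith (fun _ _ _ h => by
      obtain ⟨hx, hy⟩ := h
      exact (map_sub evalSmith.toHom _ _).trans (sub_eq_zero.2
        ((evalSmith_bracketComposite hx).trans (evalSmith_bracketComposite hy).symm))) hx

lemma toR_d {n : ℕ+} {k l : ℤ} (h : l + 1 = k) (x : barModule.El n k) :
    toR (barModule.d h x) = operadR.d h (toR x) :=
  congrArg ((freeOperad barModule).toQuot idealJ) (FreeEl.mk_eq (.gen_d h x))

lemma toR_act {n : ℕ+} {k : ℤ} (σ : Equiv.Perm (Fin n)) (x : barModule.El n k) :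
    toR (barModule.act σ x) = operadR.act σ (toR x) :=
  congrArg ((freeOperad barModule).toQuot idealJ) (FreeEl.mk_eq (.gen_act σ x))

/-- In `𝓡`, the unit is the class of `[ ]` in arity `1`. -/
lemma toR_one : toR smithOperad.one = operadR.one :=
  ((freeOperad barModule).toQuot_eq idealJ).2 (.base (.sub .one (.bracket 1)))

/-- The operadic ideal of `𝓡` generated by the identifications. -/
noncomputable def identificationIdeal : OperadicIdeal operadR.toPreOperad :=
  OperadicIdeal.span operadR IsIdentification fun _ _ _ h => by
    obtain ⟨hn, hm, x, y⟩ := h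
    rw [map_sub, operadR.isOperad.aug_comp, sub_eq_zero]
    exact smithOperad_isOperad.aug_comp hn hm x y

/-- The map `x ↦ [κ x]` from Smith's operad to the quotient of `𝓡` by the identifications. -/
noncomputable def smithToQuotient {n : ℕ+} {k : ℤ} :
    smithOperad.El n k →+ (operadR.quotient identificationIdeal).El n k :=
  (operadR.toQuot identificationIdeal).comp toR

lemma smithToQuotient_comp {r n : ℕ+} {i : Fin r → ℕ+} {p m : ℤ} {q : Fin r → ℤ}
    (hn : ∑ j, (i j : ℕ) = n) (hm : p + ∑ j, q j = m) (x : smithOperad.El r p)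
    (y : ∀ j, smithOperad.El (i j) (q j)) :
    smithToQuotient (smithOperad.comp hn hm x y) =
      (operadR.quotient identificationIdeal).comp hn hm (smithToQuotient x)
        fun j => smithToQuotient (y j) := by
  refine Eq.trans ?_ (operadR.toQuot_comp identificationIdeal hn hm (toR x) fun j => toR (y j)).symm
  exact ((operadR.toQuot_eq identificationIdeal).2 (.base (.comp hn hm x y))).symm

/-- The evaluation of `𝓡` in Smith's operad vanishes on the identifications and induces a left
inverse. -/
lemma smithToQuotient_injective {n : ℕ+} {k : ℤ} :
    Function.Injective (smithToQuotient (n := n) (k := k)) := by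
  let ψ : OperadHom (operadR.quotient identificationIdeal).toPreOperad smithOperad :=
    evalR.liftQuotient identificationIdeal fun _ _ _ hx =>
      OperadHom.eq_zero_of_idealClosure (Q := smithBundled) evalR (fun _ _ _ h => by
        obtain ⟨hn, hm, x, y⟩ := h
        refine (map_sub evalR.toHom _ _).trans (sub_eq_zero.2 ?_)
        rw [evalR.map_comp]
        rfl) hx
  exact Function.LeftInverse.injective (g := ψ.toHom) fun x => rfl

/-- Every element of the quotient is the class of a generator, since the units and the compositions
of generators are identified with generators. -/
lemma smithToQuotient_surjective {n : ℕ+} {k : ℤ} :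
    Function.Surjective (smithToQuotient (n := n) (k := k)) := by
  intro x
  obtain ⟨x, rfl⟩ := operadR.toQuot_surjective identificationIdeal x
  obtain ⟨x, rfl⟩ := (freeOperad barModule).toQuot_surjective idealJ x
  obtain ⟨t, rfl⟩ := FreeEl.mk_surjective x
  induction t with
  | gen x => exact ⟨x, rfl⟩
  | one => exact ⟨smithOperad.one, congrArg (operadR.toQuot identificationIdeal) toR_one⟩
  | zero => exact ⟨0, map_zero _⟩
  | add s t hs ht =>
    obtain ⟨a, ha⟩ := hs
    obtain ⟨b, hb⟩ := ht
    exact ⟨a + b, (map_add _ _ _).trans (congrArg₂ (· + ·) ha hb)⟩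
  | neg t ht =>
    obtain ⟨a, ha⟩ := ht
    exact ⟨-a, (map_neg _ _).trans (congrArg (- ·) ha)⟩
  | d h t ht =>
    obtain ⟨a, ha⟩ := ht
    exact ⟨smithOperad.d h a, (congrArg (operadR.toQuot identificationIdeal) (toR_d h a)).trans
      (congrArg ((operadR.quotient identificationIdeal).d h) ha)⟩
  | act σ t ht =>
    obtain ⟨a, ha⟩ := ht
    exact ⟨smithOperad.act σ a, (congrArg (operadR.toQuot identificationIdeal) (toR_act σ a)).trans
      (congrArg ((operadR.quotient identificationIdeal).act σ) ha)⟩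
  | @comp r n i p m q hn hm t s ht hs =>
    obtain ⟨a, ha⟩ := ht
    choose b hb using hs
    refine ⟨smithOperad.comp hn hm a b, ?_⟩
    rw [smithToQuotient_comp, ha, funext hb]
    refine (operadR.toQuot_comp identificationIdeal hn hm _ _).trans
      (congrArg (operadR.toQuot identificationIdeal) ?_)
    refine ((freeOperad barModule).toQuot_comp idealJ hn hm _ _).trans
      (congrArg ((freeOperad barModule).toQuot idealJ) ?_)
    exact FreeEl.mk_comp hn hm t s

theorem mainTheorem2 :
    smithOperad.IsOperad ∧
    ∃ I : OperadicIdeal operadR.toPreOperad,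
      (∀ (n : ℕ+) (k : ℤ) (z : operadR.El n k),
        z ∈ I.carrier n k ↔ IdealClosure operadR.toPreOperad IsIdentification n k z) ∧
      ∃ φ : OperadIso smithOperad (operadR.quotient I).toPreOperad,
        ∀ (n : ℕ+) (k : ℤ) (x : barModule.El n k),
          φ.toEquiv (n := n) (k := k) x = operadR.toQuot I (toR x) := by
  refine ⟨smithOperad_isOperad, identificationIdeal, fun n k z => Iff.rfl, ?_⟩
  refine ⟨{
    toEquiv := AddEquiv.ofBijective smithToQuotient
      ⟨smithToQuotient_injective, smithToQuotient_surjective⟩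
    map_d := fun h x => congrArg (operadR.toQuot identificationIdeal) (toR_d h x)
    map_aug := fun x => rfl
    map_coaug := fun a => rfl
    map_act := fun σ x => congrArg (operadR.toQuot identificationIdeal) (toR_act σ x)
    map_one := congrArg (operadR.toQuot identificationIdeal) toR_one
    map_comp := fun hn hm x y => smithToQuotient_comp hn hm x y }, fun n k x => rfl⟩
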